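/- Let $(X,\omega)$ be a compact Kähler manifold of complex dimension $n\ge 1$ with volume element $dV_\omega$. Let $(E_\alpha)_{\alpha\in I}$ and $(B_\beta)_{\beta\in J}$ be finite families of smooth prime divisors on $X$, all distinct, such that $\sum_\alpha E_\alpha+\sum_\beta B_\beta$ has simple normal crossings. Let $b_\beta\in[0,1)$ and let $q=(q_\alpha)_{\alpha\in I}$ with real $q_\alpha\ge 0$. Fix smooth Hermitian metrics on the line bundles $\mathcal O(E_\alpha)$ and $\mathcal O(B_\beta)$, and let $|\sigma_\alpha|$ and $|s_\beta|$ be the corresponding norms of the canonical sections $\sigma_\alpha$, $s_\beta$. For $\varepsilon\ge 0$ and any multi-index $r=(r_\alpha)_{\alpha\in I}$ of non-negative reals put $$d\mu_r^{(\varepsilon)}:=\frac{\prod_{\alpha\in I}(\varepsilon^2+|\sigma_\alpha|^2)^{r_\alpha}}{\prod_{\beta\in J}(\varepsilon^2+|s_\beta|^2)^{b_\beta}}\,dV_\omega .$$ Fix $\varepsilon_0>0$. Let $(g_\varepsilon)_{0\le\varepsilon\le\varepsilon_0}$ be a metric $g_0$ with conic singularities along $\sum_\beta b_\beta B_\beta$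 together with its $\varepsilon$-regularizations; that is, $g_\varepsilon$ is a smooth Riemannian metric on $X$ if $\varepsilon>0$, $g_0$ is a smooth Riemannian metric on $X\setminus\bigcup_\beta B_\beta$, and every point of $X$ has a neighbourhood $V$ with holomorphic coordinates $(z_1,\dots,z_n)$, in which each of the divisors $E_\alpha,B_\beta$ that meets the coordinate domain is the zero set of one of the coordinates (distinct divisors corresponding to distinct coordinates), and a constant $A>0$ such that for all $\varepsilon\in[0,\varepsilon_0]$, on $V$ (on $V\setminus\bigcup_\beta B_\beta$ if $\varepsilon=0$), $$A^{-1}\sum_{k=1}^n\frac{|dz_k|^2}{(\varepsilon^2+|z_k|^2)^{b_k}}\ \le\ g_\varepsilon\ \le\ A\sum_{k=1}^n\frac{|dz_k|^2}{(\varepsilon^2+|z_k|^2)^{b_k}},$$ where $b_k=b_\beta$ if $B_\beta=\{z_k=0\}$ in these coordinates, and $b_k=0$ if there is no such $\beta$. Let $|\nabla_\varepsilon f|$ be the norm of the gradient of $f$ with respect to $g_\varepsilon$, i.e. the norm of $df$ as a real linear map on the tangent spaces normed by $g_\varepsilon$. Let $1\le p<2$ be a real number, and let $q_p$ be the multi-index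 with components $\left(1-\frac p2\right)q_\alpha$. Then there exists a constant $C>0$ such that for every $\varepsilon\in[0,\varepsilon_0]$ and every smooth function $f:X\to\mathbb C$ (in particular for every smooth real-valued $f$), $$\left(\int_X|f|^{\frac{2np}{2n-p}}\,d\mu_q^{(\varepsilon)}\right)^{\frac{2n-p}{2np}}\le C\left(\int_X|\nabla_\varepsilon f|^p\,d\mu_{q_p}^{(\varepsilon)}+\int_X|f|^p\,d\mu_{q_p}^{(\varepsilon)}\right)^{\frac1p}.$$ Here $C$ depends on neither $\varepsilon$ nor $f$, but may depend on everything else. -/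

import Mathlib

open scoped Manifold ContDiff ENNReal Topology

noncomputable section

/-! ### Metrics on complex manifolds

`X` is a complex manifold of dimension `n`, i.e. charted on `ℂⁿ` with analytic transition maps.
Seen as a real manifold, its tangent spaces are `TangentSpace 𝓘(ℝ, Fin n → ℂ) x`. -/

/-- A field of real bilinear forms on the tangent spaces of `X`. -/
abbrev BilinField (n : ℕ) (X : Type*) [TopologicalSpace X] [ChartedSpace (Fin n → ℂ) X] :=
  (x : X) → TangentSpace 𝓘(ℝ, Fin n → ℂ) x →ₗ[ℝ] TangentSpace 𝓘(ℝ, Fin n → ℂ) x →ₗ[ℝ] ℝ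

section Metrics

variable {n : ℕ} {X : Type*} [TopologicalSpace X] [ChartedSpace (Fin n → ℂ) X]

/-- The expression of `g` in the chart `φ`: the form
`(u, v) ↦ g (dφ⁻¹ u, dφ⁻¹ v)` at the point `z` of the target of `φ`. -/
def BilinField.inChart (g : BilinField n X) (φ : OpenPartialHomeomorph X (Fin n → ℂ))
    (z u v : Fin n → ℂ) : ℝ :=
  g (φ.symm z) (mfderiv 𝓘(ℝ, Fin n → ℂ) 𝓘(ℝ, Fin n → ℂ) φ.symm z u)
    (mfderiv 𝓘(ℝ, Fin n → ℂ) 𝓘(ℝ, Fin n → ℂ) φ.symm z v)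

/-- `g` restricts to a smooth Riemannian metric on the open set `U`. -/
structure BilinField.IsSmoothMetricOn (g : BilinField n X) (U : Set X) : Prop where
  symm : ∀ x ∈ U, ∀ v w, g x v w = g x w v
  pos : ∀ x ∈ U, ∀ v, v ≠ 0 → 0 < g x v v
  smooth : ∀ φ ∈ atlas (Fin n → ℂ) X, ∀ u v : Fin n → ℂ,
    ContDiffOn ℝ ∞ (fun z => g.inChart φ z u v) (φ.target ∩ φ.symm ⁻¹' U)

variable (n X) in
/-- A Kähler metric on `X`, given by its underlying Riemannian metric `g`: the latter is invariant
under the complex structure `J`, and the form `g (J ·, ·)` is closed.  The charts being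
holomorphic, `J` is multiplication by `i` in each of them. -/
structure KahlerMetric where
  metric : BilinField n X
  isSmoothMetric : metric.IsSmoothMetricOn Set.univ
  hermitian : ∀ φ ∈ atlas (Fin n → ℂ) X, ∀ z ∈ φ.target, ∀ u v : Fin n → ℂ,
    metric.inChart φ z (Complex.I • u) (Complex.I • v) = metric.inChart φ z u v
  /-- The exterior derivative of `g (J ·, ·)`, evaluated on constant fields, vanishes. -/
  closed : ∀ φ ∈ atlas (Fin n → ℂ) X, ∀ z ∈ φ.target, ∀ u v w : Fin n → ℂ,
    fderiv ℝ (fun y => metric.inChart φ y (Complex.I • v) w) z u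
      + fderiv ℝ (fun y => metric.inChart φ y (Complex.I • w) u) z v
      + fderiv ℝ (fun y => metric.inChart φ y (Complex.I • u) v) z w = 0

/-- The real basis `∂/∂x₁, ∂/∂y₁, …, ∂/∂xₙ, ∂/∂yₙ` of `ℂⁿ`. -/
def realFrame (a : Fin n × Fin 2) : Fin n → ℂ :=
  Pi.single a.1 (if a.2 = 0 then 1 else Complex.I)

/-- The Riemannian volume density `√(det g)` of `g` in the chart `φ`. -/
def BilinField.volumeDensity (g : BilinField n X) (φ : OpenPartialHomeomorph X (Fin n → ℂ))
    (z : Fin n → ℂ) : ℝ :=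
  Real.sqrt (Matrix.det (Matrix.of fun a b : Fin n × Fin 2 =>
    g.inChart φ z (realFrame a) (realFrame b)))

/-- The Riemannian volume of `g` on the domain of the chart `φ`, as a measure on `X`:
the image under `φ⁻¹` of `√(det g)` times Lebesgue measure on the target of `φ`. -/
def BilinField.chartVolume [MeasurableSpace X] (g : BilinField n X)
    (φ : OpenPartialHomeomorph X (Fin n → ℂ)) : MeasureTheory.Measure X :=
  MeasureTheory.Measure.map φ.symm
    ((MeasureTheory.volume.restrict φ.target).withDensity
      fun z => ENNReal.ofReal (g.volumeDensity φ z))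

/-- The Riemannian volume measure.  By the change of variables formula the measures
`g.chartVolume φ` agree on the overlaps of the charts; the measure that they glue to is
their supremum. -/
def BilinField.volumeMeasure [MeasurableSpace X] (g : BilinField n X) :
    MeasureTheory.Measure X :=
  ⨆ φ ∈ atlas (Fin n → ℂ) X, g.chartVolume φ

/-- The norm at `x`, with respect to `g`, of the gradient of `f`, i.e. the norm of `df` as
a real linear form on the tangent space normed by `g`. -/
def BilinField.gradNorm (g : BilinField n X) (f : X → ℂ) (x : X) : ℝ≥0∞ :=
  ⨆ (v : TangentSpace 𝓘(ℝ, Fin n → ℂ) x) (_ : g x v v ≤ 1),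
    let w : ℂ := mfderiv 𝓘(ℝ, Fin n → ℂ) 𝓘(ℝ, ℂ) f x v
    ‖w‖ₑ

end Metrics

/-! ### Divisors and Hermitian metrics on the associated line bundles -/

section Divisors

variable (n : ℕ) {X : Type*} [TopologicalSpace X] [ChartedSpace (Fin n → ℂ) X]

/-- A local (reduced) equation of the smooth hypersurface `D`. -/
structure LocalEquation (D : Set X) where
  domain : Set X
  isOpen_domain : IsOpen domain
  eqn : X → ℂ
  holomorphic : ContMDiffOn 𝓘(ℂ, Fin n → ℂ) 𝓘(ℂ, ℂ) ω eqn domain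
  mem_iff : ∀ x ∈ domain, x ∈ D ↔ eqn x = 0
  submersive : ∀ x ∈ domain, eqn x = 0 →
    mfderiv 𝓘(ℂ, Fin n → ℂ) 𝓘(ℂ, ℂ) eqn x ≠ 0

variable (X) in
/-- A smooth prime divisor: a hypersurface with a reduced local equation near every point of `X`
(in particular closed and smooth) which is irreducible, i.e. connected. -/
structure SmoothPrimeDivisor where
  support : Set X
  isConnected : IsConnected support
  exists_localEquation : ∀ x, ∃ s : LocalEquation n support, x ∈ s.domain

variable {n}

/-- A smooth Hermitian metric on the holomorphic line bundle `O(D)`.  Every local equation `s` of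
`D` gives a holomorphic frame `e_s` of `O(D)` on its domain, in which the canonical section `σ` is
`s • e_s`, and these frames trivialize `O(D)`.  The metric is given by the smooth
positive functions `‖e_s‖²`; they have to be such that `‖σ‖² = |s|² ‖e_s‖²` does not depend on the
frame.  (If `s = u t` with `u` invertible, this says `‖e_t‖² = |u|² ‖e_s‖²` off `D`,
hence everywhere by continuity, which is the transition rule of `O(D)`.) -/
structure DivisorHermitianMetric (D : SmoothPrimeDivisor n X) where
  frameNormSq : LocalEquation n D.support → X → ℝ
  pos : ∀ s, ∀ x ∈ s.domain, 0 < frameNormSq s x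
  smooth : ∀ s, ContMDiffOn 𝓘(ℝ, Fin n → ℂ) 𝓘(ℝ, ℝ) ∞ (frameNormSq s) s.domain
  compatible : ∀ s t, ∀ x ∈ s.domain ∩ t.domain,
    ‖s.eqn x‖ ^ 2 * frameNormSq s x = ‖t.eqn x‖ ^ 2 * frameNormSq t x

/-- The squared norm `|σ|²` of the canonical section of `O(D)`, computed in any frame. -/
def DivisorHermitianMetric.sectionNormSq {D : SmoothPrimeDivisor n X}
    (h : DivisorHermitianMetric D) (x : X) : ℝ :=
  ‖(D.exists_localEquation x).choose.eqn x‖ ^ 2 *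
    h.frameNormSq (D.exists_localEquation x).choose x

variable {ι : Type*}

/-- A holomorphic chart adapted to the family `D`: each member of `D` that meets the domain of the
chart is there the zero set of one of the coordinates, distinct members
corresponding to distinct coordinates. (The value of `coord` at the other members is irrelevant.) -/
structure AdaptedChart (D : ι → SmoothPrimeDivisor n X) where
  chart : OpenPartialHomeomorph X (Fin n → ℂ)
  mem_maximalAtlas : chart ∈ IsManifold.maximalAtlas 𝓘(ℂ, Fin n → ℂ) ω X
  coord : ι → Fin n
  injOn : Set.InjOn coord {i | ((D i).support ∩ chart.source).Nonempty}
  mem_iff : ∀ i, ((D i).support ∩ chart.source).Nonempty →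
    ∀ x ∈ chart.source, x ∈ (D i).support ↔ chart x (coord i) = 0

/-- The members of the family `D` are distinct and have simple normal crossings. -/
def IsSNC (D : ι → SmoothPrimeDivisor n X) : Prop :=
  ∀ x, ∃ c : AdaptedChart D, x ∈ c.chart.source

/-! ### Regularized conic metrics and the weighted measures -/

variable {I J : Type*} [Fintype I] [Fintype J]
  {E : I → SmoothPrimeDivisor n X} {B : J → SmoothPrimeDivisor n X}

open Classical in
/-- The squared length of the tangent vector `v` at `x` for the model metric
`∑ₖ |dzₖ|² / (ε² + |zₖ|²) ^ bₖ` in the adapted chart `c`, where `bₖ = b β` if `zₖ = 0` is the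
equation of `B β` in this chart, and `bₖ = 0` if there is no such `β`. -/
def modelConicNormSq (c : AdaptedChart (Sum.elim E B)) (b : J → ℝ) (ε : ℝ) (x : X)
    (v : TangentSpace 𝓘(ℝ, Fin n → ℂ) x) : ℝ :=
  ∑ k : Fin n,
    ‖(mfderiv 𝓘(ℝ, Fin n → ℂ) 𝓘(ℝ, Fin n → ℂ) c.chart x v : Fin n → ℂ) k‖ ^ 2 /
      ∏ β : J, if ((B β).support ∩ c.chart.source).Nonempty ∧ c.coord (Sum.inr β) = k
        then (ε ^ 2 + ‖c.chart x k‖ ^ 2) ^ b β else 1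

/-- `(g ε)`, `0 ≤ ε ≤ ε₀`, is a conic metric `g 0` along `∑ b β • B β`, smooth off the `B β`,
together with regularizations `g ε`, `ε > 0`, smooth on all of `X`: locally in adapted
coordinates, `g ε` is quasi-isometric to the model metric, uniformly in `ε`. -/
structure IsRegularizedConicMetric (E : I → SmoothPrimeDivisor n X)
    (B : J → SmoothPrimeDivisor n X) (b : J → ℝ) (ε₀ : ℝ) (g : ℝ → BilinField n X) : Prop where
  smooth_zero : (g 0).IsSmoothMetricOn (⋃ β, (B β).support)ᶜ
  smooth_pos : ∀ ε, 0 < ε → ε ≤ ε₀ → (g ε).IsSmoothMetricOn Set.univ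
  quasiIsometric : ∀ x₀ : X, ∃ c : AdaptedChart (Sum.elim E B), ∃ V ∈ 𝓝 x₀, ∃ A : ℝ,
    V ⊆ c.chart.source ∧ 0 < A ∧
    ∀ ε, 0 ≤ ε → ε ≤ ε₀ → ∀ x ∈ V, (ε = 0 → x ∉ ⋃ β, (B β).support) →
      ∀ v : TangentSpace 𝓘(ℝ, Fin n → ℂ) x,
        A⁻¹ * modelConicNormSq c b ε x v ≤ g ε x v v ∧
        g ε x v v ≤ A * modelConicNormSq c b ε x v

/-- The measure
`∏ (ε² + |σ_α|²) ^ q α / ∏ (ε² + |s_β|²) ^ b β  dV`, with `dV` the volume of the Kähler metric. -/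
def weightedMeasure [MeasurableSpace X] (κ : KahlerMetric n X)
    (hE : ∀ α, DivisorHermitianMetric (E α)) (hB : ∀ β, DivisorHermitianMetric (B β))
    (b : J → ℝ) (q : I → ℝ) (ε : ℝ) : MeasureTheory.Measure X :=
  κ.metric.volumeMeasure.withDensity fun x => ENNReal.ofReal
    ((∏ α, (ε ^ 2 + (hE α).sectionNormSq x) ^ q α) /
      ∏ β, (ε ^ 2 + (hB β).sectionNormSq x) ^ b β)

end Divisors

end

/-!
The case `p > 1` follows from the case `p = 1`, applied to `u = |f| ^ γ` with
`γ = p (2n - 1) / (2n - p)`, and Hölder's inequality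
(`lintegral_rpow_le_of_sobolev_one`): the weight with exponents `q / 2`, which belongs to `p = 1`, is
the product of the weights with exponents `q` and `q_p` to the powers `1 - 1 / p` and `1 / p`, and one
divides by a power of `∫ |f| ^ (2np / (2n - p)) dμ_q`. This integral is finite because the exponents
`-b β` are larger than `-1` (`lintegral_divisorWeight_lt_top`).

Let `p = 1`. By compactness the inequality is local, as the local norms of `u` may be estimated by a
global right-hand side (`exists_local_sobolev`). In an adapted chart the function `ε² + |σ|²` of a
divisor is comparable, uniformly in `ε`, to `ε² + |zₖ|²`, so that all the weights become products of
powers of the `ε² + |zₖ|²` (`exists_lintegral_comparable`), and by the quasi-isometry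
`(ε² + |zₖ|²) ^ (bₖ / 2) |∂u / ∂zₖ|` is at most a multiple of `|∇_ε u|`
(`rpow_mul_enorm_fderiv_le_gradNorm`).

What remains is a weighted Gagliardo–Nirenberg–Sobolev inequality on `ℂⁿ` for functions of compact
support, with a constant independent of `ε` (`lintegral_rpow_mul_polyWeight_le`). As in the
unweighted case, one applies the fundamental theorem of calculus on each of the `2n` real coordinate
lines through a point, and multiplies the results by means of `lintegral_prod_lintegral_pow_le`. On
a line in the `k`-th complex coordinate, the weight carries the exponents `gradExponent`, chosen such
that the product of the weights is the one wanted. The derivative falls on the weight, too,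
which produces the additional term `|f| / |zₖ|`; by Hardy's inequality
(`lintegral_enorm_div_le_coordGrad`) its weighted integral is at most that of `|∂f / ∂zₖ|`. Hardy's
inequality is applicable since the exponent of `ε² + |zₖ|²` is `(Qₖ - bₖ) / 2 > -1 / 2`, and its
constant does not depend on `ε`, since its proof only uses how the weight behaves under dilations of
`zₖ`.
-/

open MeasureTheory Set

noncomputable section

/-! ### Hardy's inequality in one complex coordinate -/

/-- The weighted fundamental theorem of calculus on a real line of `ℂ` which misses the origin:
`|y|` is the distance of the line to the origin and `t` the coordinate along the line. -/
theorem enorm_mul_rpow_le_lintegral_line {h : ℝ → ℂ} (hh : ContDiff ℝ 1 h)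
    (hc : HasCompactSupport h) {y : ℝ} (hy : y ≠ 0) (a ε t₀ : ℝ) :
    ‖h t₀‖ₑ * ENNReal.ofReal ((ε ^ 2 + (t₀ ^ 2 + y ^ 2)) ^ a) ≤
      ∫⁻ t, (‖deriv h t‖ₑ
          + ENNReal.ofReal (2 * |a|) * (‖h t‖ₑ * ENNReal.ofReal (√(t ^ 2 + y ^ 2))⁻¹))
        * ENNReal.ofReal ((ε ^ 2 + (t ^ 2 + y ^ 2)) ^ a) := by
  have hpos : ∀ t : ℝ, 0 < t ^ 2 + y ^ 2 := fun t => by positivity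
  have hpos' : ∀ t : ℝ, 0 < ε ^ 2 + (t ^ 2 + y ^ 2) := fun t => by have := hpos t; positivity
  set W : ℝ → ℝ := fun t => (ε ^ 2 + (t ^ 2 + y ^ 2)) ^ a with hW
  have hWpos : ∀ t, 0 < W t := fun t => Real.rpow_pos_of_pos (hpos' t) a
  have hWd : ∀ t, HasDerivAt W (2 * t * a * (ε ^ 2 + (t ^ 2 + y ^ 2)) ^ (a - 1)) t := by
    intro t
    have h1 : HasDerivAt (fun t : ℝ => ε ^ 2 + (t ^ 2 + y ^ 2)) (2 * t) t := by
      simpa using (((hasDerivAt_pow 2 t).add_const (y ^ 2)).const_add (ε ^ 2))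
    exact h1.rpow_const (Or.inl (hpos' t).ne')
  have hWc : ContDiff ℝ 1 W := by
    refine ContDiff.rpow_const_of_ne (by fun_prop) (fun t => (hpos' t).ne')
  set F : ℝ → ℂ := fun t => W t • h t with hF
  have hFc : ContDiff ℝ 1 F := hWc.smul hh
  have hFs : HasCompactSupport F :=
    hc.mono (Function.support_smul_subset_right W h)
  have key := hFs.enorm_le_lintegral_Ici_deriv hFc t₀
  have e1 : ‖F t₀‖ₑ = ‖h t₀‖ₑ * ENNReal.ofReal (W t₀) := by
    rw [hF]; simp only [enorm_smul]
    rw [mul_comm, Real.enorm_of_nonneg (hWpos _).le]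
  rw [← e1]
  refine key.trans ((setLIntegral_le_lintegral _ _).trans (lintegral_mono fun t => ?_))
  have hd : deriv F t = W t • deriv h t
      + (2 * t * a * (ε ^ 2 + (t ^ 2 + y ^ 2)) ^ (a - 1)) • h t :=
    ((hWd t).smul ((hh.differentiable one_ne_zero) t).hasDerivAt).deriv
  -- The logarithmic derivative of the weight is at most `2 |a| |t| / (t² + y²)`.
  have hb : |2 * t * a * (ε ^ 2 + (t ^ 2 + y ^ 2)) ^ (a - 1)| ≤
      2 * |a| * (√(t ^ 2 + y ^ 2))⁻¹ * W t := by
    have hr : 0 < √(t ^ 2 + y ^ 2) := Real.sqrt_pos.2 (hpos t)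
    have hrs : √(t ^ 2 + y ^ 2) ^ 2 = t ^ 2 + y ^ 2 := Real.sq_sqrt (hpos t).le
    have ht : |t| ≤ √(t ^ 2 + y ^ 2) := Real.abs_le_sqrt (by nlinarith [sq_nonneg y])
    rw [Real.rpow_sub_one (hpos' t).ne', abs_mul, abs_mul, abs_mul, abs_two, abs_div,
      abs_of_pos (hpos' t), abs_of_pos (hWpos t)]
    have : |t| / (ε ^ 2 + (t ^ 2 + y ^ 2)) ≤ (√(t ^ 2 + y ^ 2))⁻¹ := by
      rw [div_le_iff₀ (hpos' t), inv_mul_eq_div, le_div_iff₀ hr]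
      nlinarith [sq_nonneg ε]
    calc 2 * |t| * |a| * (W t / (ε ^ 2 + (t ^ 2 + y ^ 2)))
        = 2 * |a| * (|t| / (ε ^ 2 + (t ^ 2 + y ^ 2))) * W t := by ring
      _ ≤ _ := by gcongr
  rw [hd]
  refine (enorm_add_le _ _).trans ?_
  rw [enorm_smul, enorm_smul, Real.enorm_of_nonneg (hWpos t).le, Real.enorm_eq_ofReal_abs, add_mul]
  refine add_le_add (mul_comm _ _).le ?_
  calc ENNReal.ofReal |2 * t * a * (ε ^ 2 + (t ^ 2 + y ^ 2)) ^ (a - 1)| * ‖h t‖ₑ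
      ≤ ENNReal.ofReal (2 * |a| * (√(t ^ 2 + y ^ 2))⁻¹ * W t) * ‖h t‖ₑ := by gcongr
    _ = _ := by
      rw [ENNReal.ofReal_mul (by positivity), ENNReal.ofReal_mul (by positivity)]
      ring

section Hardy

variable {n : ℕ}

/-- The squared absolute value of the `k`-th complex coordinate of `x`. -/
def radSq (k : Fin n) (x : Fin n × Fin 2 → ℝ) : ℝ := x (k, 0) ^ 2 + x (k, 1) ^ 2

theorem radSq_nonneg (k : Fin n) (x : Fin n × Fin 2 → ℝ) : 0 ≤ radSq k x := by
  unfold radSq; positivity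

@[fun_prop]
theorem continuous_radSq (k : Fin n) : Continuous (radSq k) := by
  unfold radSq; fun_prop

/-- Multiplication of the `k`-th complex coordinate by the real number `t`. -/
def scaleCoord (k : Fin n) (t : ℝ) (x : Fin n × Fin 2 → ℝ) : Fin n × Fin 2 → ℝ :=
  fun i => (if i.1 = k then t else 1) * x i

/-- The sum of the absolute values of the partial derivatives of `f` in the two real directions of
the `k`-th complex coordinate. -/
def coordGrad (f : (Fin n × Fin 2 → ℝ) → ℂ) (k : Fin n) (x : Fin n × Fin 2 → ℝ) : ℝ≥0∞ :=
  ∑ j : Fin 2, ‖fderiv ℝ f x (Pi.single (k, j) 1)‖ₑ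

theorem measurable_coordGrad (f : (Fin n × Fin 2 → ℝ) → ℂ) (k : Fin n) :
    Measurable (coordGrad f k) := by
  unfold coordGrad
  exact Finset.measurable_sum _ fun j _ => (measurable_fderiv_apply_const ℝ f _).enorm

@[fun_prop]
theorem continuous_scaleCoord (k : Fin n) (t : ℝ) : Continuous (scaleCoord k t) := by
  unfold scaleCoord; fun_prop

theorem lintegral_comp_scaleCoord (k : Fin n) {t : ℝ} (ht : 0 < t)
    {F : (Fin n × Fin 2 → ℝ) → ℝ≥0∞} (hF : Measurable F) :
    ∫⁻ x, F (scaleCoord k t x) = ENNReal.ofReal (t ^ (-2 : ℝ)) * ∫⁻ x, F x := by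
  classical
  have hdet : Matrix.det (Matrix.diagonal fun i : Fin n × Fin 2 => if i.1 = k then t else 1)
      = t ^ 2 := by
    rw [Matrix.det_diagonal, Fintype.prod_prod_type, Finset.prod_eq_single k]
    · simp
    · intro j _ hj
      simp [hj]
    · simp
  have hlin : ∀ x, Matrix.toLin' (Matrix.diagonal fun i : Fin n × Fin 2 =>
      if i.1 = k then t else 1) x = scaleCoord k t x := by
    intro x
    ext i
    simp [scaleCoord, Matrix.mulVec_diagonal]
  have h := Real.smul_map_diagonal_volume_pi
    (D := fun i : Fin n × Fin 2 => if i.1 = k then t else 1) (by rw [hdet]; positivity)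
  rw [hdet] at h
  have h2 : (Matrix.toLin' (Matrix.diagonal fun i : Fin n × Fin 2 =>
      if i.1 = k then t else 1) : _ → _) = scaleCoord k t := funext hlin
  rw [h2] at h
  conv_rhs => rw [← h, lintegral_smul_measure, lintegral_map hF (by fun_prop)]
  rw [smul_eq_mul, ← mul_assoc, ← ENNReal.ofReal_mul (by positivity), abs_of_pos (by positivity),
    ← Real.rpow_natCast, ← Real.rpow_add ht]
  simp

/-- The fundamental theorem of calculus along the ray `t ↦ scaleCoord k t x`, `t ≥ 1`. -/
theorem enorm_le_lintegral_ray {f : (Fin n × Fin 2 → ℝ) → ℂ} (hf : ContDiff ℝ 1 f)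
    (hc : HasCompactSupport f) (k : Fin n) {x : Fin n × Fin 2 → ℝ} (hx : radSq k x ≠ 0) :
    ‖f x‖ₑ ≤ ENNReal.ofReal (√(radSq k x)) *
      ∫⁻ t in Ici (1 : ℝ), coordGrad f k (scaleCoord k t x) := by
  set v : Fin n × Fin 2 → ℝ := fun i => if i.1 = k then x i else 0 with hv
  -- The parameter is reversed, since `enorm_le_lintegral_Ici_deriv` integrates over `Iic`.
  set γ : ℝ → (Fin n × Fin 2 → ℝ) := fun s => scaleCoord k (-s) x with hγ
  have hγ' : ∀ s, γ s = scaleCoord k 0 x + s • (-v) := by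
    intro s; ext i
    simp only [hγ, hv, scaleCoord, Pi.add_apply, Pi.smul_apply, Pi.neg_apply, smul_eq_mul]
    split_ifs <;> ring
  have hv0 : v ≠ 0 := by
    intro h
    apply hx
    have h0 := congrFun h (k, 0)
    have h1 := congrFun h (k, 1)
    simp [hv] at h0 h1
    simp [radSq, h0, h1]
  have hγd : ∀ s, HasDerivAt γ (-v) s := by
    intro s
    rw [funext hγ']
    simpa using ((hasDerivAt_id s).smul_const (-v)).const_add (scaleCoord k 0 x)
  have hγc : ContDiff ℝ 1 γ := by rw [funext hγ']; fun_prop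
  have hemb : Topology.IsClosedEmbedding γ := by
    rw [funext hγ']
    exact (Homeomorph.addLeft (scaleCoord k 0 x)).isClosedEmbedding.comp
      (isClosedEmbedding_smul_left (neg_ne_zero.2 hv0))
  have key := (hc.comp_isClosedEmbedding hemb).enorm_le_lintegral_Ici_deriv (hf.comp hγc) (-1)
  have hone : γ (-1) = x := by ext i; simp [hγ, scaleCoord]
  rw [Function.comp_apply, hone] at key
  refine key.trans ?_
  have hbound : ∀ s, ‖deriv (f ∘ γ) s‖ₑ ≤
      ENNReal.ofReal (√(radSq k x)) * coordGrad f k (scaleCoord k (-s) x) := by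
    intro s
    have hd : deriv (f ∘ γ) s = fderiv ℝ f (γ s) (-v) :=
      (((hf.differentiable one_ne_zero) (γ s)).hasFDerivAt.comp_hasDerivAt s (hγd s)).deriv
    have hve : v = ∑ j : Fin 2, x (k, j) • (Pi.single (k, j) 1 : Fin n × Fin 2 → ℝ) := by
      ext ⟨i, j⟩
      by_cases hik : i = k
      · subst hik
        fin_cases j <;> simp [hv, Pi.single_apply]
      · simp [hv, hik]
    rw [hd, map_neg, enorm_neg, hve, map_sum]
    refine (enorm_sum_le _ _).trans ?_
    rw [coordGrad, Finset.mul_sum]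
    refine Finset.sum_le_sum fun j _ => ?_
    rw [map_smul, enorm_smul, Real.enorm_eq_ofReal_abs]
    gcongr
    apply Real.abs_le_sqrt
    unfold radSq
    fin_cases j
    · simpa using sq_nonneg _
    · simpa using sq_nonneg _
  calc ∫⁻ s in Iic (-1), ‖deriv (f ∘ γ) s‖ₑ
      ≤ ∫⁻ s in Iic (-1), ENNReal.ofReal (√(radSq k x)) * coordGrad f k (scaleCoord k (-s) x) :=
        lintegral_mono hbound
    _ = ENNReal.ofReal (√(radSq k x)) *
          ∫⁻ s in Iic (-1), coordGrad f k (scaleCoord k (-s) x) :=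
        lintegral_const_mul' _ _ ENNReal.ofReal_ne_top
    _ = _ := by
        congr 1
        have := (Measure.measurePreserving_neg (volume : Measure ℝ)).setLIntegral_comp_preimage_emb
          (MeasurableEquiv.neg ℝ).measurableEmbedding
          (fun t => coordGrad f k (scaleCoord k t x)) (Ici 1)
        rw [← this]
        simp

theorem measurable_scaleCoord_uncurry (k : Fin n) :
    Measurable fun p : ℝ × (Fin n × Fin 2 → ℝ) => scaleCoord k p.1 p.2 := by
  refine measurable_pi_lambda _ fun i => ?_
  unfold scaleCoord
  split_ifs <;> fun_prop

/-- **Hardy's inequality** in the `k`-th complex coordinate, for a weight `H` which under dilations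
of this coordinate does not decay faster than `t ^ (-σ)`. The constant is finite if `σ < 1`, see
`lintegral_Ici_one_rpow_lt_top`. -/
theorem lintegral_enorm_div_le_coordGrad {f : (Fin n × Fin 2 → ℝ) → ℂ} (hf : ContDiff ℝ 1 f)
    (hc : HasCompactSupport f) (k : Fin n) {H : (Fin n × Fin 2 → ℝ) → ℝ≥0∞} (hH : Measurable H)
    {σ : ℝ} (hHσ : ∀ t, 1 ≤ t → ∀ x, H x ≤ ENNReal.ofReal (t ^ σ) * H (scaleCoord k t x)) :
    ∫⁻ x, ‖f x‖ₑ * ENNReal.ofReal (√(radSq k x))⁻¹ * H x ≤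
      (∫⁻ t in Ici (1 : ℝ), ENNReal.ofReal (t ^ (σ - 2))) * ∫⁻ x, coordGrad f k x * H x := by
  set G : (Fin n × Fin 2 → ℝ) → ℝ≥0∞ := fun x => coordGrad f k x * H x with hG
  have hGm : Measurable G := (measurable_coordGrad f k).mul hH
  have hpt : ∀ x, ‖f x‖ₑ * ENNReal.ofReal (√(radSq k x))⁻¹ * H x ≤
      ∫⁻ t in Ici (1 : ℝ), ENNReal.ofReal (t ^ σ) * G (scaleCoord k t x) := by
    intro x
    rcases eq_or_ne (radSq k x) 0 with h0 | h0
    -- Here `(√0)⁻¹ = 0`; such points form a null set anyway.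
    · simp [h0]
    have hr : 0 < √(radSq k x) := Real.sqrt_pos.2 (lt_of_le_of_ne (radSq_nonneg k x) h0.symm)
    have hm : Measurable fun t : ℝ => coordGrad f k (scaleCoord k t x) :=
      (measurable_coordGrad f k).comp
        ((measurable_scaleCoord_uncurry k).comp (measurable_id.prodMk measurable_const))
    calc ‖f x‖ₑ * ENNReal.ofReal (√(radSq k x))⁻¹ * H x
        ≤ (ENNReal.ofReal (√(radSq k x)) *
            ∫⁻ t in Ici (1 : ℝ), coordGrad f k (scaleCoord k t x)) *
              ENNReal.ofReal (√(radSq k x))⁻¹ * H x := by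
          gcongr; exact enorm_le_lintegral_ray hf hc k h0
      _ = (∫⁻ t in Ici (1 : ℝ), coordGrad f k (scaleCoord k t x)) * H x := by
          rw [mul_comm (ENNReal.ofReal _), mul_assoc (lintegral _ _), ← ENNReal.ofReal_mul hr.le,
            mul_inv_cancel₀ hr.ne', ENNReal.ofReal_one, mul_one]
      _ = ∫⁻ t in Ici (1 : ℝ), coordGrad f k (scaleCoord k t x) * H x :=
          (lintegral_mul_const _ hm).symm
      _ ≤ _ := by
          refine setLIntegral_mono' measurableSet_Ici fun t ht => ?_
          calc coordGrad f k (scaleCoord k t x) * H x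
              ≤ coordGrad f k (scaleCoord k t x) *
                (ENNReal.ofReal (t ^ σ) * H (scaleCoord k t x)) := by gcongr; exact hHσ t ht x
            _ = _ := by simp only [hG]; ring
  calc ∫⁻ x, ‖f x‖ₑ * ENNReal.ofReal (√(radSq k x))⁻¹ * H x
      ≤ ∫⁻ x, ∫⁻ t in Ici (1 : ℝ), ENNReal.ofReal (t ^ σ) * G (scaleCoord k t x) :=
        lintegral_mono hpt
    _ = ∫⁻ t in Ici (1 : ℝ), ∫⁻ x, ENNReal.ofReal (t ^ σ) * G (scaleCoord k t x) := by
        refine lintegral_lintegral_swap (Measurable.aemeasurable ?_)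
        refine Measurable.mul (by fun_prop) ?_
        exact hGm.comp ((measurable_scaleCoord_uncurry k).comp measurable_swap)
    _ = ∫⁻ t in Ici (1 : ℝ), ENNReal.ofReal (t ^ (σ - 2)) * ∫⁻ x, G x := by
        refine setLIntegral_congr_fun measurableSet_Ici fun t ht => ?_
        have ht0 : (0 : ℝ) < t := lt_of_lt_of_le one_pos ht
        rw [lintegral_const_mul' _ _ ENNReal.ofReal_ne_top, lintegral_comp_scaleCoord k ht0 hGm,
          ← mul_assoc, ← ENNReal.ofReal_mul (by positivity), ← Real.rpow_add ht0, sub_eq_add_neg]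
    _ = _ := lintegral_mul_const _ (by fun_prop)

theorem lintegral_Ici_one_rpow_lt_top {σ : ℝ} (hσ : σ < 1) :
    ∫⁻ t in Ici (1 : ℝ), ENNReal.ofReal (t ^ (σ - 2)) < ⊤ := by
  rw [setLIntegral_congr Ioi_ae_eq_Ici.symm]
  exact (integrableOn_Ioi_rpow_of_lt (a := σ - 2) (by linarith) one_pos).setLIntegral_lt_top

end Hardy

/-! ### The weighted Gagliardo–Nirenberg–Sobolev inequality -/

section WeightedSobolev

variable {n : ℕ}

/-- The product weight `∏ₖ (ε² + |zₖ|²) ^ e k`, in real coordinates. -/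
def realWeight (ε : ℝ) (e : Fin n → ℝ) (x : Fin n × Fin 2 → ℝ) : ℝ :=
  ∏ k, (ε ^ 2 + radSq k x) ^ e k

theorem measurable_realWeight (ε : ℝ) (e : Fin n → ℝ) : Measurable (realWeight ε e) := by
  unfold realWeight
  refine Finset.measurable_prod _ fun k _ => ?_
  exact ((continuous_radSq k).measurable.const_add _).pow_const _

theorem add_radSq_nonneg (ε : ℝ) (k : Fin n) (x : Fin n × Fin 2 → ℝ) : 0 ≤ ε ^ 2 + radSq k x :=
  add_nonneg (sq_nonneg _) (radSq_nonneg k x)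

theorem realWeight_nonneg (ε : ℝ) (e : Fin n → ℝ) (x : Fin n × Fin 2 → ℝ) :
    0 ≤ realWeight ε e x :=
  Finset.prod_nonneg fun k _ => Real.rpow_nonneg (add_radSq_nonneg ε k x) _

theorem realWeight_eq_mul (ε : ℝ) (e : Fin n → ℝ) (k : Fin n) (x : Fin n × Fin 2 → ℝ) :
    realWeight ε e x = (ε ^ 2 + radSq k x) ^ e k *
      ∏ l ∈ Finset.univ.erase k, (ε ^ 2 + radSq l x) ^ e l :=
  (Finset.mul_prod_erase _ _ (Finset.mem_univ k)).symm

/-- Dilations of the `k`-th coordinate change a weight of exponent `e k > -1/2` in this coordinate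
by a factor whose power is larger than `-1`, as required in Hardy's inequality. -/
theorem realWeight_le_scaleCoord (ε : ℝ) (e : Fin n → ℝ) (k : Fin n) {t : ℝ} (ht : 1 ≤ t)
    (x : Fin n × Fin 2 → ℝ) :
    realWeight ε e x ≤ t ^ max 0 (-2 * e k) * realWeight ε e (scaleCoord k t x) := by
  have ht0 : 0 < t := by linarith
  have hk : radSq k (scaleCoord k t x) = t ^ 2 * radSq k x := by
    simp [radSq, scaleCoord]; ring
  have hl : ∀ l, l ≠ k → radSq l (scaleCoord k t x) = radSq l x := by
    intro l hl
    simp [radSq, scaleCoord, hl]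
  have hrest : ∏ l ∈ Finset.univ.erase k, (ε ^ 2 + radSq l (scaleCoord k t x)) ^ e l =
      ∏ l ∈ Finset.univ.erase k, (ε ^ 2 + radSq l x) ^ e l :=
    Finset.prod_congr rfl fun l h => by rw [hl l (Finset.ne_of_mem_erase h)]
  rw [realWeight_eq_mul ε e k, realWeight_eq_mul ε e k, hk, hrest, ← mul_assoc]
  have hr := radSq_nonneg k x
  have hmono : ε ^ 2 + radSq k x ≤ ε ^ 2 + t ^ 2 * radSq k x := by
    nlinarith [mul_nonneg (by nlinarith : 0 ≤ t ^ 2 - 1) hr]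
  refine mul_le_mul_of_nonneg_right ?_
    (Finset.prod_nonneg fun l _ => Real.rpow_nonneg (add_radSq_nonneg ε l x) _)
  rcases le_total 0 (e k) with he | he
  · rw [max_eq_left (by linarith), Real.rpow_zero, one_mul]
    exact Real.rpow_le_rpow (add_radSq_nonneg ε k x) hmono he
  · rw [max_eq_right (by linarith)]
    rcases (add_radSq_nonneg ε k x).eq_or_lt with h0 | h0
    · have h1 : ε ^ 2 = 0 := by nlinarith [sq_nonneg ε]
      have h2 : radSq k x = 0 := by nlinarith [sq_nonneg ε]
      rw [h1, h2, mul_zero, add_zero]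
      exact le_mul_of_one_le_left (Real.rpow_nonneg le_rfl _)
        (Real.one_le_rpow ht (by linarith))
    · have h1 : ε ^ 2 + t ^ 2 * radSq k x ≤ t ^ 2 * (ε ^ 2 + radSq k x) := by
        nlinarith [mul_nonneg (by nlinarith : 0 ≤ t ^ 2 - 1) (sq_nonneg ε)]
      have h2 := Real.rpow_le_rpow_of_nonpos (h0.trans_le hmono) h1 he
      rw [Real.mul_rpow (by positivity) h0.le, ← Real.rpow_natCast t 2, ← Real.rpow_mul ht0.le] at h2
      calc (ε ^ 2 + radSq k x) ^ e k
          = t ^ (-2 * e k) * (t ^ (((2 : ℕ) : ℝ) * e k) * (ε ^ 2 + radSq k x) ^ e k) := by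
            rw [← mul_assoc, ← Real.rpow_add ht0]
            push_cast
            simp
        _ ≤ _ := by gcongr; simpa using h2

open Function in
/-- The weighted fundamental theorem of calculus on the coordinate line through `x` in the direction
`(k, j)`: only the factor of the weight which belongs to `k` varies along this line. -/
theorem enorm_mul_realWeight_le_lintegral_line {f : (Fin n × Fin 2 → ℝ) → ℂ} (hf : ContDiff ℝ 1 f)
    (hc : HasCompactSupport f) (ε : ℝ) (e : Fin n → ℝ) (k : Fin n) (j : Fin 2)
    {x : Fin n × Fin 2 → ℝ} (hx : ∀ i, x i ≠ 0) {G : (Fin n × Fin 2 → ℝ) → ℝ≥0∞}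
    (hG : ∀ y, (coordGrad f k y + ENNReal.ofReal (2 * |e k|) *
      (‖f y‖ₑ * ENNReal.ofReal (√(radSq k y))⁻¹)) * ENNReal.ofReal (realWeight ε e y) ≤ G y) :
    ‖f x‖ₑ * ENNReal.ofReal (realWeight ε e x) ≤ ∫⁻ s, G (update x (k, j) s) := by
  obtain ⟨y, hy, hrad⟩ : ∃ y : ℝ, y ≠ 0 ∧ ∀ s, radSq k (update x (k, j) s) = s ^ 2 + y ^ 2 := by
    fin_cases j
    · exact ⟨x (k, 1), hx _, fun s => by simp [radSq]⟩
    · exact ⟨x (k, 0), hx _, fun s => by simp [radSq, add_comm]⟩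
  have hrest : ∀ s, ∏ l ∈ Finset.univ.erase k, (ε ^ 2 + radSq l (update x (k, j) s)) ^ e l
      = ∏ l ∈ Finset.univ.erase k, (ε ^ 2 + radSq l x) ^ e l := by
    intro s
    refine Finset.prod_congr rfl fun l h => ?_
    have : l ≠ k := Finset.ne_of_mem_erase h
    simp [radSq, update, this]
  set R : ℝ := ∏ l ∈ Finset.univ.erase k, (ε ^ 2 + radSq l x) ^ e l with hR
  have hR0 : 0 ≤ R := Finset.prod_nonneg fun l _ => Real.rpow_nonneg (add_radSq_nonneg ε l x) _
  have hW : ∀ s, ENNReal.ofReal (realWeight ε e (update x (k, j) s)) =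
      ENNReal.ofReal ((ε ^ 2 + (s ^ 2 + y ^ 2)) ^ e k) * ENNReal.ofReal R := by
    intro s
    rw [realWeight_eq_mul ε e k, hrest, hrad, ENNReal.ofReal_mul (by positivity)]
  have hh : ContDiff ℝ 1 (f ∘ update x (k, j)) := hf.comp (contDiff_update 1 x (k, j))
  have hhc : HasCompactSupport (f ∘ update x (k, j)) :=
    hc.comp_isClosedEmbedding (isClosedEmbedding_update x (k, j))
  have key := enorm_mul_rpow_le_lintegral_line hh hhc hy (e k) ε (x (k, j))
  have hx0 := hW (x (k, j))
  rw [update_eq_self] at hx0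
  calc ‖f x‖ₑ * ENNReal.ofReal (realWeight ε e x)
      = ‖(f ∘ update x (k, j)) (x (k, j))‖ₑ *
          ENNReal.ofReal ((ε ^ 2 + (x (k, j) ^ 2 + y ^ 2)) ^ e k) * ENNReal.ofReal R := by
        rw [hx0, mul_assoc]; simp
    _ ≤ _ := mul_le_mul_left key _
    _ = _ := (lintegral_mul_const' _ _ ENNReal.ofReal_ne_top).symm
    _ ≤ _ := by
        refine lintegral_mono fun s => le_trans ?_ (hG _)
        rw [mul_assoc, ← hW, hrad]
        refine mul_le_mul_left (add_le_add ?_ le_rfl) _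
        have hd : deriv (f ∘ update x (k, j)) s
            = fderiv ℝ f (update x (k, j) s) (Pi.single (k, j) 1) := by
          rw [fderiv_comp_deriv _ (hf.differentiable one_ne_zero).differentiableAt
            (hasDerivAt_update x (k, j) s).differentiableAt, deriv_update]
        rw [hd]
        generalize update x (k, j) s = y
        exact Finset.single_le_sum (f := fun j => ‖fderiv ℝ f y (Pi.single (k, j) 1)‖ₑ)
          (fun _ _ => zero_le) (Finset.mem_univ j)

/-- The exponents of the weight in front of the derivatives in the `k`-th coordinate. Here `Q` and
`b` are the exponents of the divisors in the numerator and in the denominator; the additional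
`b k / 2` makes up for the conic metric, in which the `k`-th coordinate direction is longer. -/
def gradExponent (Q b : Fin n → ℝ) (k l : Fin n) : ℝ :=
  Q l / 2 - b l + if l = k then b k / 2 else 0

theorem gradExponent_self (Q b : Fin n → ℝ) (k : Fin n) :
    gradExponent Q b k k = (Q k - b k) / 2 := by
  simp [gradExponent]; ring

/-- The product, over the `2n` real directions, of the quantities estimated on the coordinate lines,
each to the power `1 / (2n - 1)`. -/
theorem rpow_mul_realWeight_eq_prod (hn : 1 ≤ n) (Q b : Fin n → ℝ) (ε : ℝ)
    {x : Fin n × Fin 2 → ℝ} (hx : ∀ i, x i ≠ 0) (u : ℝ≥0∞) :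
    u ^ (2 * n / (2 * n - 1) : ℝ) *
        ENNReal.ofReal (realWeight ε (fun k => n * Q k / (2 * n - 1) - b k) x) =
      ∏ i : Fin n × Fin 2, (u * ENNReal.ofReal (realWeight ε (gradExponent Q b i.1) x))
        ^ (1 / (2 * n - 1) : ℝ) := by
  have hn' : (1 : ℝ) ≤ n := by exact_mod_cast hn
  have h1 : (0 : ℝ) < 2 * n - 1 := by linarith
  have hr : (0 : ℝ) ≤ 1 / (2 * n - 1) := by positivity
  have hpos : ∀ l, 0 < ε ^ 2 + radSq l x := by
    intro l
    have : 0 < radSq l x := by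
      have := hx (l, 0)
      unfold radSq
      positivity
    positivity
  have hW : ∀ k, 0 ≤ realWeight ε (gradExponent Q b k) x := fun k => realWeight_nonneg _ _ _
  simp_rw [ENNReal.mul_rpow_of_nonneg _ _ hr]
  rw [Finset.prod_mul_distrib]
  congr 1
  · rw [Finset.prod_const, ← ENNReal.rpow_natCast, ← ENNReal.rpow_mul]
    congr 1
    simp
    field_simp
  · simp_rw [ENNReal.ofReal_rpow_of_nonneg (hW _) hr]
    rw [← ENNReal.ofReal_prod_of_nonneg (fun i _ => Real.rpow_nonneg (hW _) _)]
    congr 1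
    rw [Fintype.prod_prod_type]
    simp only [Finset.prod_const, Finset.card_univ, Fintype.card_fin]
    have : ∀ k, (realWeight ε (gradExponent Q b k) x ^ (1 / (2 * n - 1) : ℝ)) ^ 2 =
        ∏ l, (ε ^ 2 + radSq l x) ^ (gradExponent Q b k l * (2 / (2 * n - 1))) := by
      intro k
      rw [← Real.rpow_natCast, ← Real.rpow_mul (hW k), realWeight,
        ← Real.finsetProd_rpow _ _ (fun l _ => Real.rpow_nonneg (hpos l).le _)]
      refine Finset.prod_congr rfl fun l _ => ?_
      rw [← Real.rpow_mul (hpos l).le]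
      congr 1
      push_cast
      ring
    simp_rw [this]
    rw [Finset.prod_comm, realWeight]
    refine Finset.prod_congr rfl fun l _ => ?_
    rw [← Real.rpow_sum_of_pos (hpos l), ← Finset.sum_mul]
    congr 1
    simp only [gradExponent, Finset.sum_add_distrib, Finset.sum_const, Finset.sum_ite_eq,
      Finset.mem_univ, if_true, Finset.card_univ, Fintype.card_fin, nsmul_eq_mul]
    linear_combination b l * mul_inv_cancel₀ h1.ne'

/-- The **weighted Gagliardo–Nirenberg–Sobolev inequality**, in real coordinates. -/
theorem lintegral_rpow_mul_realWeight_le (hn : 1 ≤ n) (Q b : Fin n → ℝ)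
    (hQb : ∀ k, b k - Q k < 1) :
    ∃ C : ℝ≥0∞, C ≠ ⊤ ∧ ∀ (ε : ℝ) (f : (Fin n × Fin 2 → ℝ) → ℂ), ContDiff ℝ 1 f →
      HasCompactSupport f →
      ∫⁻ x, ‖f x‖ₑ ^ (2 * n / (2 * n - 1) : ℝ) *
          ENNReal.ofReal (realWeight ε (fun k => n * Q k / (2 * n - 1) - b k) x) ≤
        (C * ∑ k, ∫⁻ x, coordGrad f k x * ENNReal.ofReal (realWeight ε (gradExponent Q b k) x))
          ^ (2 * n / (2 * n - 1) : ℝ) := by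
  have hn' : (1 : ℝ) ≤ n := by exact_mod_cast hn
  have h1 : (0 : ℝ) < 2 * n - 1 := by linarith
  set σ : Fin n → ℝ := fun k => max 0 (-2 * gradExponent Q b k k) with hσ
  have hσ1 : ∀ k, σ k < 1 := by
    intro k
    have := hQb k
    rw [hσ]
    simp only [gradExponent_self]
    exact max_lt one_pos (by linarith)
  set K : Fin n → ℝ≥0∞ := fun k => 1 + ENNReal.ofReal (2 * |gradExponent Q b k k|) *
    ∫⁻ t in Ici (1 : ℝ), ENNReal.ofReal (t ^ (σ k - 2)) with hK
  have hKtop : ∀ k, K k ≠ ⊤ := fun k => ENNReal.add_ne_top.2 ⟨ENNReal.one_ne_top,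
    ENNReal.mul_ne_top ENNReal.ofReal_ne_top (lintegral_Ici_one_rpow_lt_top (hσ1 k)).ne⟩
  refine ⟨∑ k, K k, ENNReal.sum_ne_top.2 fun k _ => hKtop k, fun ε f hf hc => ?_⟩
  set H : Fin n → (Fin n × Fin 2 → ℝ) → ℝ≥0∞ :=
    fun k x => ENNReal.ofReal (realWeight ε (gradExponent Q b k) x) with hH
  have hHm : ∀ k, Measurable (H k) := fun k => (measurable_realWeight _ _).ennreal_ofReal
  have hfm : Measurable fun x => ‖f x‖ₑ := hf.continuous.measurable.enorm
  set g : Fin n → (Fin n × Fin 2 → ℝ) → ℝ≥0∞ := fun k y =>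
    (coordGrad f k y + ENNReal.ofReal (2 * |gradExponent Q b k k|) *
      (‖f y‖ₑ * ENNReal.ofReal (√(radSq k y))⁻¹)) * H k y with hg
  have hsq : ∀ k, Measurable fun y : Fin n × Fin 2 → ℝ => ENNReal.ofReal (√(radSq k y))⁻¹ :=
    fun k => (continuous_radSq k).measurable.sqrt.inv.ennreal_ofReal
  have hgm : ∀ k, Measurable (g k) := fun k =>
    ((measurable_coordGrad f k).add ((hfm.mul (hsq k)).const_mul _)).mul (hHm k)
  -- By Hardy's inequality the second summand of `g k` may be dropped.
  have hgint : ∀ k, ∫⁻ y, g k y ≤ K k * ∫⁻ y, coordGrad f k y * H k y := by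
    intro k
    have hardy := lintegral_enorm_div_le_coordGrad hf hc k (hHm k) (σ := σ k) (fun t ht x => by
      rw [hH, ← ENNReal.ofReal_mul (by positivity)]
      exact ENNReal.ofReal_le_ofReal (realWeight_le_scaleCoord ε _ k ht x))
    have : ∀ y, g k y = coordGrad f k y * H k y + ENNReal.ofReal (2 * |gradExponent Q b k k|) *
        (‖f y‖ₑ * ENNReal.ofReal (√(radSq k y))⁻¹ * H k y) := by
      intro y; simp only [hg]; ring
    simp_rw [this]
    rw [lintegral_add_left (f := fun y => coordGrad f k y * H k y)
        ((measurable_coordGrad f k).mul (hHm k)),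
      lintegral_const_mul' _ _ ENNReal.ofReal_ne_top, hK, add_mul, one_mul, mul_assoc]
    gcongr
  have hcard : ((Fintype.card (Fin n × Fin 2) : ℕ) : ℝ) = 2 * n := by simp; ring
  have hconj : Real.HolderConjugate (Fintype.card (Fin n × Fin 2) : ℝ) (2 * n / (2 * n - 1)) := by
    rw [hcard]
    exact Real.HolderConjugate.conjExponent (by linarith)
  have hgrid := lintegral_prod_lintegral_pow_le (fun _ : Fin n × Fin 2 => (volume : Measure ℝ))
    hconj (f := fun y => ∑ k, g k y) (Finset.measurable_sum _ fun k _ => hgm k)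
  rw [hcard] at hgrid
  -- Off this null set no coordinate line through `x` meets a hyperplane `zₖ = 0`.
  have hae : ∀ᵐ x : Fin n × Fin 2 → ℝ, ∀ i, x i ≠ 0 :=
    ae_all_iff.2 fun i => Measure.ae_eval_ne _ i 0
  calc _ ≤ ∫⁻ x, ∏ i : Fin n × Fin 2, (∫⁻ s, ∑ k, g k (Function.update x i s))
          ^ (1 / (2 * n - 1) : ℝ) := by
        refine lintegral_mono_ae ?_
        filter_upwards [hae] with x hx
        rw [rpow_mul_realWeight_eq_prod hn Q b ε hx]
        refine Finset.prod_le_prod' fun i _ => ?_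
        refine ENNReal.rpow_le_rpow ?_ (by positivity)
        obtain ⟨k, j⟩ := i
        exact enorm_mul_realWeight_le_lintegral_line hf hc ε _ k j hx
          (G := fun y => ∑ k, g k y) (fun y => Finset.single_le_sum (f := fun k => g k y)
            (fun _ _ => zero_le) (Finset.mem_univ k))
    _ ≤ _ := hgrid
    _ ≤ _ := by
        refine ENNReal.rpow_le_rpow ?_ (by positivity)
        change ∫⁻ x, ∑ k, g k x ≤ _
        rw [lintegral_finsetSum _ fun k _ => hgm k, Finset.mul_sum]
        refine Finset.sum_le_sum fun k _ => (hgint k).trans ?_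
        gcongr
        exact Finset.single_le_sum (fun _ _ => zero_le) (Finset.mem_univ k)

end WeightedSobolev

/-! ### Transfer to complex coordinates, and local integrability of the weights -/

section ComplexCoordinates

variable {n : ℕ}

/-- The real and imaginary parts of the coordinates on `ℂⁿ`. -/
def realCoords (n : ℕ) : (Fin n → ℂ) ≃ₗ[ℝ] (Fin n × Fin 2 → ℝ) where
  toFun z i := if i.2 = 0 then (z i.1).re else (z i.1).im
  invFun x k := ⟨x (k, 0), x (k, 1)⟩
  map_add' z w := by ext i; simp only [Pi.add_apply]; split_ifs <;> simp
  map_smul' c z := by ext i; simp only [Pi.smul_apply, RingHom.id_apply]; split_ifs <;> simp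
  left_inv z := by ext k; simp
  right_inv x := by
    ext ⟨k, j⟩
    fin_cases j <;> simp

theorem realCoords_symm_single (i : Fin n × Fin 2) :
    (realCoords n).symm (Pi.single i 1) = realFrame i := by
  obtain ⟨k, j⟩ := i
  ext l
  by_cases hl : l = k
  · subst hl
    fin_cases j <;> simp [realCoords, realFrame, Complex.ext_iff]
  · simp [realCoords, realFrame, Complex.ext_iff, hl]

theorem radSq_realCoords (k : Fin n) (z : Fin n → ℂ) :
    radSq k (realCoords n z) = ‖z k‖ ^ 2 := by
  rw [Complex.sq_norm, Complex.normSq_apply]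
  simp [radSq, realCoords, sq]

theorem continuous_realCoords : Continuous (realCoords n) :=
  (realCoords n).toLinearMap.continuous_of_finiteDimensional

theorem measurePreserving_realCoords : MeasurePreserving (realCoords n) := by
  refine ⟨continuous_realCoords.measurable, ?_⟩
  refine (Measure.pi_eq fun s hs => ?_).symm
  rw [Measure.map_apply continuous_realCoords.measurable (MeasurableSet.univ_pi hs)]
  have : (realCoords n) ⁻¹' (pi univ s) =
      pi univ fun k => Complex.measurableEquivPi ⁻¹' (pi univ fun j => s (k, j)) := by
    ext z
    simp only [mem_preimage, mem_pi, mem_univ, true_implies, Prod.forall, Fin.forall_fin_two]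
    simp [realCoords]
  rw [this, volume_pi_pi, Fintype.prod_prod_type]
  refine Finset.prod_congr rfl fun k _ => ?_
  rw [Complex.volume_preserving_equiv_pi.measure_preimage
    (MeasurableSet.univ_pi fun j => hs _).nullMeasurableSet, volume_pi_pi]

/-- The product weight `∏ₖ (ε² + |zₖ|²) ^ e k`. -/
def polyWeight (ε : ℝ) (e : Fin n → ℝ) (z : Fin n → ℂ) : ℝ :=
  ∏ k, (ε ^ 2 + ‖z k‖ ^ 2) ^ e k

theorem polyWeight_nonneg (ε : ℝ) (e : Fin n → ℝ) (z : Fin n → ℂ) : 0 ≤ polyWeight ε e z :=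
  Finset.prod_nonneg fun k _ => Real.rpow_nonneg (by positivity) _

/-- The sum of the absolute values of the partial derivatives of `f` in the two real directions of
the `k`-th complex coordinate. -/
def complexGrad (f : (Fin n → ℂ) → ℂ) (k : Fin n) (z : Fin n → ℂ) : ℝ≥0∞ :=
  ∑ j : Fin 2, ‖fderiv ℝ f z (realFrame (k, j))‖ₑ

/-- The **weighted Gagliardo–Nirenberg–Sobolev inequality** on `ℂⁿ`. -/
theorem lintegral_rpow_mul_polyWeight_le (hn : 1 ≤ n) (Q b : Fin n → ℝ)
    (hQb : ∀ k, b k - Q k < 1) :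
    ∃ C : ℝ≥0∞, C ≠ ⊤ ∧ ∀ (ε : ℝ) (f : (Fin n → ℂ) → ℂ), ContDiff ℝ 1 f →
      HasCompactSupport f →
      ∫⁻ z, ‖f z‖ₑ ^ (2 * n / (2 * n - 1) : ℝ) *
          ENNReal.ofReal (polyWeight ε (fun k => n * Q k / (2 * n - 1) - b k) z) ≤
        (C * ∑ k, ∫⁻ z, complexGrad f k z * ENNReal.ofReal (polyWeight ε (gradExponent Q b k) z))
          ^ (2 * n / (2 * n - 1) : ℝ) := by
  obtain ⟨C, hC, h⟩ := lintegral_rpow_mul_realWeight_le hn Q b hQb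
  refine ⟨C, hC, fun ε f hf hc => ?_⟩
  let L : (Fin n → ℂ) ≃L[ℝ] (Fin n × Fin 2 → ℝ) := (realCoords n).toContinuousLinearEquiv
  have hL : ∀ z, L z = realCoords n z := fun z => rfl
  have hw : ∀ e z, realWeight ε e (realCoords n z) = polyWeight ε e z := by
    intro e z
    simp [realWeight, polyWeight, radSq_realCoords]
  have hgrad : ∀ k z, coordGrad (f ∘ L.symm) k (realCoords n z) = complexGrad f k z := by
    intro k z
    unfold coordGrad complexGrad
    refine Finset.sum_congr rfl fun j _ => ?_
    rw [L.symm.comp_right_fderiv, ContinuousLinearMap.comp_apply, ← hL, L.symm_apply_apply,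
      ← realCoords_symm_single]
    rfl
  have hemb : MeasurableEmbedding (realCoords n) := L.toHomeomorph.measurableEmbedding
  have key := h ε (f ∘ L.symm) (hf.comp L.symm.contDiff)
    (hc.comp_homeomorph L.symm.toHomeomorph)
  rw [← measurePreserving_realCoords.lintegral_comp_emb hemb] at key
  simp_rw [← measurePreserving_realCoords.lintegral_comp_emb hemb, hgrad, hw] at key
  simpa [← hL] using key

theorem integrableOn_rpow_closedBall (ε : ℝ) {e : ℝ} (he : -1 < e) (R : ℝ) :
    IntegrableOn (fun w : ℂ => (ε ^ 2 + ‖w‖ ^ 2) ^ e) (Metric.closedBall 0 R) := by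
  rcases eq_or_ne ε 0 with rfl | hε
  · have h1 : Integrable fun w : ℂ => ‖w‖ ^ (2 * e) * Real.exp (-‖w‖ ^ (1 : ℝ)) := by
      -- If not, the integral would be `0`, but it is a positive value of the Gamma function.
      by_contra h
      have h2 := Complex.integral_rpow_mul_exp_neg_rpow (p := 1) (q := 2 * e) le_rfl (by linarith)
      rw [integral_undef h] at h2
      have : 0 < (2 * Real.pi / 1) * Real.Gamma ((2 * e + 2) / 1) :=
        mul_pos (by positivity) (Real.Gamma_pos_of_pos (by linarith))
      linarith
    have h2 := (h1.integrableOn (s := Metric.closedBall 0 R)).mul_continuousOn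
      (g' := fun w : ℂ => Real.exp ‖w‖) (by fun_prop) (isCompact_closedBall 0 R)
    refine h2.congr_fun (fun w _ => ?_) measurableSet_closedBall
    simp only [Real.rpow_one]
    rw [mul_assoc, ← Real.exp_add, neg_add_cancel, Real.exp_zero, mul_one, Real.rpow_mul
      (norm_nonneg _)]
    norm_num
  · refine ContinuousOn.integrableOn_compact (isCompact_closedBall 0 R) (Continuous.continuousOn ?_)
    refine Continuous.rpow_const (by fun_prop) fun w => Or.inl ?_
    positivity

theorem setLIntegral_polyWeight_lt_top (ε : ℝ) {e : Fin n → ℝ} (he : ∀ k, -1 < e k) (R : ℝ) :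
    ∫⁻ z in Metric.closedBall 0 R, ENNReal.ofReal (polyWeight ε e z) < ⊤ := by
  rcases lt_or_ge R 0 with hR | hR
  · simp [Metric.closedBall_eq_empty.2 hR]
  have h := Integrable.fintype_prod (f := fun k (w : ℂ) => (ε ^ 2 + ‖w‖ ^ 2) ^ e k)
    (μ := fun _ : Fin n => (volume : Measure ℂ).restrict (Metric.closedBall 0 R))
    fun k => integrableOn_rpow_closedBall ε (he k) R
  rw [← Measure.restrict_pi_pi, ← volume_pi] at h
  rw [closedBall_pi _ hR]
  exact Integrable.lintegral_lt_top (f := polyWeight ε e) h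

end ComplexCoordinates

/-! ### Holomorphic charts and the Riemannian volume density -/

section RealCharts

variable {n : ℕ}

theorem mem_contDiffGroupoid_real {e : OpenPartialHomeomorph (Fin n → ℂ) (Fin n → ℂ)}
    (he : e ∈ contDiffGroupoid ω 𝓘(ℂ, Fin n → ℂ)) : e ∈ contDiffGroupoid ω 𝓘(ℝ, Fin n → ℂ) := by
  rw [contDiffGroupoid, mem_groupoid_of_pregroupoid] at he ⊢
  simp only [contDiffPregroupoid, modelWithCornersSelf_coe, modelWithCornersSelf_coe_symm,
    Function.comp_id, Function.id_comp, preimage_id, range_id, inter_univ] at he ⊢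
  exact ⟨he.1.restrict_scalars ℝ, he.2.restrict_scalars ℝ⟩

variable (n) in
/-- The holomorphic charts of `X`, those of the maximal atlas, as charts of the underlying real
manifold. -/
abbrev realAtlas (X : Type*) [TopologicalSpace X] [ChartedSpace (Fin n → ℂ) X] :
    Set (OpenPartialHomeomorph X (Fin n → ℂ)) :=
  IsManifold.maximalAtlas 𝓘(ℝ, Fin n → ℂ) ω X

variable {X : Type*} [TopologicalSpace X] [ChartedSpace (Fin n → ℂ) X]

theorem mem_realAtlas {c : OpenPartialHomeomorph X (Fin n → ℂ)}
    (hc : c ∈ IsManifold.maximalAtlas 𝓘(ℂ, Fin n → ℂ) ω X) : c ∈ realAtlas n X := by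
  rw [realAtlas, IsManifold.mem_maximalAtlas_iff, mem_maximalAtlas_iff]
  rw [IsManifold.mem_maximalAtlas_iff, mem_maximalAtlas_iff] at hc
  exact fun e he => ⟨mem_contDiffGroupoid_real (hc e he).1, mem_contDiffGroupoid_real (hc e he).2⟩

variable (n X) in
theorem isManifold_real [IsManifold 𝓘(ℂ, Fin n → ℂ) ω X] : IsManifold 𝓘(ℝ, Fin n → ℂ) ω X :=
  { compatible := fun he he' => mem_contDiffGroupoid_real
      ((contDiffGroupoid ω 𝓘(ℂ, Fin n → ℂ)).compatible he he') }

variable {φ ψ : OpenPartialHomeomorph X (Fin n → ℂ)}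

omit [ChartedSpace (Fin n → ℂ) X] in
theorem mem_transition_source {z : Fin n → ℂ} :
    z ∈ (φ.symm.trans ψ).source ↔ z ∈ φ.target ∧ φ.symm z ∈ ψ.source := by
  simp

theorem BilinField.apply_congr (g : BilinField n X) {x y : X} (h : x = y) (u v : Fin n → ℂ) :
    g x u v = g y u v := by
  subst h; rfl

theorem continuousOn_volumeDensity_of_mem_atlas {g : BilinField n X}
    (hg : g.IsSmoothMetricOn univ) (hφ : φ ∈ atlas (Fin n → ℂ) X) :
    ContinuousOn (g.volumeDensity φ) φ.target := by
  unfold BilinField.volumeDensity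
  refine Real.continuous_sqrt.comp_continuousOn ?_
  refine Continuous.comp_continuousOn (g := Matrix.det) (by fun_prop) ?_
  refine continuousOn_pi.2 fun a => continuousOn_pi.2 fun b => ?_
  simpa using (hg.smooth φ hφ (realFrame a) (realFrame b)).continuousOn

theorem mdifferentiable_of_mem_realAtlas (hφ : φ ∈ realAtlas n X) :
    φ.MDifferentiable 𝓘(ℝ, Fin n → ℂ) 𝓘(ℝ, Fin n → ℂ) :=
  ⟨(contMDiffOn_of_mem_maximalAtlas hφ).mdifferentiableOn (by simp),
    (contMDiffOn_symm_of_mem_maximalAtlas hφ).mdifferentiableOn (by simp)⟩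

theorem contDiffOn_transition (hφ : φ ∈ realAtlas n X) (hψ : ψ ∈ realAtlas n X) :
    ContDiffOn ℝ ω (ψ ∘ φ.symm) (φ.symm.trans ψ).source := by
  have h := IsManifold.compatible_of_mem_maximalAtlas hφ hψ
  rw [contDiffGroupoid, mem_groupoid_of_pregroupoid] at h
  simp only [contDiffPregroupoid, modelWithCornersSelf_coe, modelWithCornersSelf_coe_symm,
    Function.comp_id, Function.id_comp, preimage_id, range_id, inter_univ] at h
  exact h.1

theorem hasFDerivAt_transition (hφ : φ ∈ realAtlas n X) (hψ : ψ ∈ realAtlas n X)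
    {z : Fin n → ℂ} (hz : z ∈ (φ.symm.trans ψ).source) :
    HasFDerivAt (ψ ∘ φ.symm) (fderiv ℝ (ψ ∘ φ.symm) z) z :=
  (((contDiffOn_transition hφ hψ).contDiffAt
    ((φ.symm.trans ψ).open_source.mem_nhds hz)).differentiableAt (by simp)).hasFDerivAt

/-- The differentials of two inverse charts differ by that of the transition map. -/
theorem mfderiv_symm_eq_comp (hφ : φ ∈ realAtlas n X) (hψ : ψ ∈ realAtlas n X)
    {z : Fin n → ℂ} (hz : z ∈ (φ.symm.trans ψ).source) (u : Fin n → ℂ) :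
    (mfderiv 𝓘(ℝ, Fin n → ℂ) 𝓘(ℝ, Fin n → ℂ) φ.symm z u : Fin n → ℂ) =
      (mfderiv 𝓘(ℝ, Fin n → ℂ) 𝓘(ℝ, Fin n → ℂ) ψ.symm ((ψ ∘ φ.symm) z)
        (fderiv ℝ (ψ ∘ φ.symm) z u) : Fin n → ℂ) := by
  have hz' := mem_transition_source.1 hz
  have h1 : φ.symm =ᶠ[𝓝 z] ψ.symm ∘ (ψ ∘ φ.symm) := by
    filter_upwards [(φ.symm.trans ψ).open_source.mem_nhds hz] with w hw
    exact (ψ.left_inv (mem_transition_source.1 hw).2).symm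
  have hT : HasMFDerivAt 𝓘(ℝ, Fin n → ℂ) 𝓘(ℝ, Fin n → ℂ) (ψ ∘ φ.symm) z
      (fderiv ℝ (ψ ∘ φ.symm) z) := (hasFDerivAt_transition hφ hψ hz).hasMFDerivAt
  have hψs := ((mdifferentiable_of_mem_realAtlas hψ).mdifferentiableAt_symm
    (ψ.map_source hz'.2)).hasMFDerivAt
  have h2 := (hψs.comp z hT).congr_of_eventuallyEq h1
  exact DFunLike.congr_fun h2.mfderiv u

theorem inChart_eq_transition (g : BilinField n X) (hφ : φ ∈ realAtlas n X)
    (hψ : ψ ∈ realAtlas n X) {z : Fin n → ℂ} (hz : z ∈ (φ.symm.trans ψ).source)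
    (u v : Fin n → ℂ) :
    g.inChart φ z u v = g.inChart ψ ((ψ ∘ φ.symm) z) (fderiv ℝ (ψ ∘ φ.symm) z u)
      (fderiv ℝ (ψ ∘ φ.symm) z v) := by
  unfold BilinField.inChart
  have hu := mfderiv_symm_eq_comp hφ hψ hz u
  have hv := mfderiv_symm_eq_comp hφ hψ hz v
  refine (BilinField.apply_congr g (ψ.left_inv (mem_transition_source.1 hz).2).symm _ _).trans ?_
  exact congrArg₂ (fun a b : Fin n → ℂ => g (ψ.symm ((ψ ∘ φ.symm) z)) a b) hu hv

/-- The basis of `ℂⁿ` over `ℝ` formed by the vectors of `realFrame`. -/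
def realFrameBasis (n : ℕ) : Module.Basis (Fin n × Fin 2) ℝ (Fin n → ℂ) :=
  Module.Basis.ofEquivFun (realCoords n)

theorem realFrameBasis_apply (a : Fin n × Fin 2) : realFrameBasis n a = realFrame a := by
  rw [realFrameBasis, Module.Basis.coe_ofEquivFun, ← realCoords_symm_single]

/-- The form `g.inChart φ z`, as a bilinear map. -/
def inChartForm (g : BilinField n X) (φ : OpenPartialHomeomorph X (Fin n → ℂ)) (z : Fin n → ℂ) :
    (Fin n → ℂ) →ₗ[ℝ] (Fin n → ℂ) →ₗ[ℝ] ℝ :=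
  LinearMap.compl₁₂ (g (φ.symm z) : (Fin n → ℂ) →ₗ[ℝ] (Fin n → ℂ) →ₗ[ℝ] ℝ)
    (mfderiv 𝓘(ℝ, Fin n → ℂ) 𝓘(ℝ, Fin n → ℂ) φ.symm z : (Fin n → ℂ) →L[ℝ] (Fin n → ℂ)).toLinearMap
    (mfderiv 𝓘(ℝ, Fin n → ℂ) 𝓘(ℝ, Fin n → ℂ) φ.symm z : (Fin n → ℂ) →L[ℝ] (Fin n → ℂ)).toLinearMap

theorem inChartForm_apply (g : BilinField n X) (φ : OpenPartialHomeomorph X (Fin n → ℂ))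
    (z u v : Fin n → ℂ) : inChartForm g φ z u v = g.inChart φ z u v :=
  rfl

theorem det_bilin_comp {ι M : Type*} [Fintype ι] [DecidableEq ι] [AddCommGroup M] [Module ℝ M]
    (β : Module.Basis ι ℝ M) (F : M →ₗ[ℝ] M →ₗ[ℝ] ℝ) (P : M →ₗ[ℝ] M) :
    (Matrix.of fun a b => F (P (β a)) (P (β b))).det =
      LinearMap.det P ^ 2 * (Matrix.of fun a b => F (β a) (β b)).det := by
  have h1 : (Matrix.of fun a b => F (P (β a)) (P (β b))) =
      LinearMap.toMatrix₂ β β (F.compl₁₂ P P) := by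
    ext a b; simp [LinearMap.toMatrix₂_apply]
  have h2 : (Matrix.of fun a b => F (β a) (β b)) = LinearMap.toMatrix₂ β β F := by
    ext a b; simp [LinearMap.toMatrix₂_apply]
  rw [h1, h2, LinearMap.toMatrix₂_compl₁₂ β β β β, Matrix.det_mul, Matrix.det_mul,
    Matrix.det_transpose, LinearMap.det_toMatrix]
  ring

theorem volumeDensity_eq_transition (g : BilinField n X) (hφ : φ ∈ realAtlas n X)
    (hψ : ψ ∈ realAtlas n X) {z : Fin n → ℂ} (hz : z ∈ (φ.symm.trans ψ).source) :
    g.volumeDensity φ z =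
      |(fderiv ℝ (ψ ∘ φ.symm) z).det| * g.volumeDensity ψ ((ψ ∘ φ.symm) z) := by
  have h := det_bilin_comp (realFrameBasis n) (inChartForm g ψ ((ψ ∘ φ.symm) z))
    (fderiv ℝ (ψ ∘ φ.symm) z : (Fin n → ℂ) →ₗ[ℝ] (Fin n → ℂ))
  simp only [realFrameBasis_apply, inChartForm_apply,
    ContinuousLinearMap.coe_coe] at h
  unfold BilinField.volumeDensity
  simp_rw [inChart_eq_transition g hφ hψ hz]
  rw [h, Real.sqrt_mul (sq_nonneg _), Real.sqrt_sq_eq_abs]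

theorem volumeDensity_pos {g : BilinField n X} (hg : g.IsSmoothMetricOn univ)
    (hφ : φ ∈ realAtlas n X) {z : Fin n → ℂ} (hz : z ∈ φ.target) : 0 < g.volumeDensity φ z := by
  unfold BilinField.volumeDensity
  refine Real.sqrt_pos.2 (Matrix.PosDef.det_pos ?_)
  have hinj : Function.Injective
      (mfderiv 𝓘(ℝ, Fin n → ℂ) 𝓘(ℝ, Fin n → ℂ) φ.symm z) :=
    (mdifferentiable_of_mem_realAtlas hφ).symm.mfderiv_injective hz
  have h : (Matrix.of fun a b : Fin n × Fin 2 => g.inChart φ z (realFrame a) (realFrame b)) =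
      LinearMap.toMatrix₂ (realFrameBasis n) (realFrameBasis n) (inChartForm g φ z) := by
    ext a b; simp [LinearMap.toMatrix₂_apply, realFrameBasis_apply, inChartForm_apply]
  refine Matrix.PosDef.of_dotProduct_mulVec_pos ?_ fun x hx => ?_
  · ext a b
    simp only [Matrix.conjTranspose_apply, Matrix.of_apply, star_trivial]
    exact hg.symm _ (mem_univ _) _ _
  · rw [h]
    have hq : star x ⬝ᵥ (LinearMap.toMatrix₂ (realFrameBasis n) (realFrameBasis n)
        (inChartForm g φ z)).mulVec x =
        inChartForm g φ z ((realFrameBasis n).equivFun.symm x)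
          ((realFrameBasis n).equivFun.symm x) := by
      simp only [Module.Basis.equivFun_symm_apply, map_sum, LinearMap.sum_apply, map_smul,
        LinearMap.smul_apply, dotProduct, Matrix.mulVec, LinearMap.toMatrix₂_apply, Pi.star_apply,
        star_trivial, smul_eq_mul, Finset.mul_sum]
      rw [Finset.sum_comm]
      refine Finset.sum_congr rfl fun a _ => Finset.sum_congr rfl fun b _ => ?_
      ring
    rw [hq]
    refine hg.pos _ (mem_univ _) _ fun h0 => hx ?_
    have h1 := hinj (h0.trans (map_zero _).symm)
    exact (realFrameBasis n).equivFun.symm.map_eq_zero_iff.1 h1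

variable [IsManifold 𝓘(ℝ, Fin n → ℂ) ω X]

theorem continuousOn_volumeDensity {g : BilinField n X} (hg : g.IsSmoothMetricOn univ)
    (hφ : φ ∈ realAtlas n X) : ContinuousOn (g.volumeDensity φ) φ.target := by
  intro z hz
  refine ContinuousAt.continuousWithinAt ?_
  set ψ := chartAt (Fin n → ℂ) (φ.symm z) with hψ'
  have hψa : ψ ∈ atlas (Fin n → ℂ) X := chart_mem_atlas _ _
  have hψ : ψ ∈ realAtlas n X := IsManifold.subset_maximalAtlas hψa
  have hzs : z ∈ (φ.symm.trans ψ).source :=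
    mem_transition_source.2 ⟨hz, mem_chart_source _ _⟩
  have hnhds := (φ.symm.trans ψ).open_source.mem_nhds hzs
  have hT := contDiffOn_transition hφ hψ
  have h1 : ContinuousAt (fun w => |(fderiv ℝ (ψ ∘ φ.symm) w).det| *
      g.volumeDensity ψ ((ψ ∘ φ.symm) w)) z := by
    refine ContinuousAt.mul ?_ ?_
    · refine ContinuousAt.abs ?_
      exact ContinuousLinearMap.continuous_det.continuousAt.comp
        ((hT.continuousOn_fderiv_of_isOpen (φ.symm.trans ψ).open_source
          (by simp)).continuousAt hnhds)
    · refine ContinuousAt.comp (g := g.volumeDensity ψ) ?_ (hT.continuousOn.continuousAt hnhds)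
      exact (continuousOn_volumeDensity_of_mem_atlas hg hψa).continuousAt
        (ψ.open_target.mem_nhds (ψ.map_source (mem_chart_source _ _)))
  refine h1.congr ?_
  filter_upwards [hnhds] with w hw
  exact (volumeDensity_eq_transition g hφ hψ hw).symm

end RealCharts

/-! ### The Riemannian volume in a chart -/

section Volume

variable {n : ℕ} {X : Type*} [TopologicalSpace X] [ChartedSpace (Fin n → ℂ) X]
  [MeasurableSpace X] [BorelSpace X]
  {φ ψ : OpenPartialHomeomorph X (Fin n → ℂ)} {g : BilinField n X}

theorem OpenPartialHomeomorph.measurableSet_source_inter_preimage {α β : Type*}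
    [TopologicalSpace α] [MeasurableSpace α] [OpensMeasurableSpace α] [TopologicalSpace β]
    [MeasurableSpace β] [BorelSpace β] (e : OpenPartialHomeomorph α β) {A : Set β}
    (hA : MeasurableSet A) : MeasurableSet (e.source ∩ e ⁻¹' A) := by
  have h : Measurable (e.source.domRestrict e) :=
    (continuousOn_iff_continuous_domRestrict.1 e.continuousOn).measurable
  have h2 := e.open_source.measurableSet.subtype_image (h hA)
  rwa [show e.source ∩ e ⁻¹' A = Subtype.val '' (e.source.domRestrict e ⁻¹' A) by
    ext z; simp [and_comm]]

omit [ChartedSpace (Fin n → ℂ) X] in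
theorem measurableSet_target_inter_preimage {A : Set X} (hA : MeasurableSet A) :
    MeasurableSet (φ.target ∩ φ.symm ⁻¹' A) :=
  φ.symm.measurableSet_source_inter_preimage hA

omit [ChartedSpace (Fin n → ℂ) X] in
theorem aemeasurable_chart_symm (μ : Measure (Fin n → ℂ)) :
    AEMeasurable φ.symm (μ.restrict φ.target) :=
  φ.continuousOn_symm.aemeasurable φ.open_target.measurableSet

theorem chartVolume_apply {A : Set X} (hA : MeasurableSet A) :
    g.chartVolume φ A =
      ∫⁻ z in φ.target ∩ φ.symm ⁻¹' A, ENNReal.ofReal (g.volumeDensity φ z) := by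
  unfold BilinField.chartVolume
  rw [Measure.map_apply_of_aemeasurable
    ((aemeasurable_chart_symm _).mono_ac (withDensity_absolutelyContinuous _ _)) hA,
    withDensity_apply', Measure.restrict_restrict' φ.open_target.measurableSet, inter_comm]

/-- By the change of variables formula, the volumes in two charts agree on the intersection of
their domains. -/
theorem chartVolume_eq_of_subset (hφ : φ ∈ realAtlas n X) (hψ : ψ ∈ realAtlas n X) {A : Set X}
    (hA : MeasurableSet A) (hAφ : A ⊆ φ.source) (hAψ : A ⊆ ψ.source) :
    g.chartVolume φ A = g.chartVolume ψ A := by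
  rw [chartVolume_apply hA, chartVolume_apply hA]
  have hsub : φ.target ∩ φ.symm ⁻¹' A ⊆ (φ.symm.trans ψ).source := fun z hz =>
    mem_transition_source.2 ⟨hz.1, hAψ hz.2⟩
  have himage : ψ.target ∩ ψ.symm ⁻¹' A = (ψ ∘ φ.symm) '' (φ.target ∩ φ.symm ⁻¹' A) := by
    ext w
    constructor
    · rintro ⟨hw, hwA⟩
      refine ⟨φ (ψ.symm w), ⟨φ.map_source (hAφ hwA), ?_⟩, ?_⟩
      · rw [mem_preimage, φ.left_inv (hAφ hwA)]; exact hwA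
      · rw [Function.comp_apply, φ.left_inv (hAφ hwA), ψ.right_inv hw]
    · rintro ⟨z, ⟨hz, hzA⟩, rfl⟩
      refine ⟨ψ.map_source (hAψ hzA), ?_⟩
      rw [mem_preimage, Function.comp_apply, ψ.left_inv (hAψ hzA)]
      exact hzA
  have hinj : InjOn (ψ ∘ φ.symm) (φ.target ∩ φ.symm ⁻¹' A) :=
    (φ.symm.trans ψ).injOn.mono hsub
  rw [himage, lintegral_image_eq_lintegral_abs_det_fderiv_mul volume
    (measurableSet_target_inter_preimage hA)
    (fun z hz => (hasFDerivAt_transition hφ hψ (hsub hz)).hasFDerivWithinAt) hinj]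
  refine setLIntegral_congr_fun (measurableSet_target_inter_preimage hA) fun z hz => ?_
  rw [volumeDensity_eq_transition g hφ hψ (hsub hz), ENNReal.ofReal_mul (abs_nonneg _)]

variable [IsManifold 𝓘(ℝ, Fin n → ℂ) ω X]

theorem lintegral_chartVolume (hg : g.IsSmoothMetricOn univ) (hφ : φ ∈ realAtlas n X)
    {F : X → ℝ≥0∞} (hF : Measurable F) :
    ∫⁻ x, F x ∂(g.chartVolume φ) =
      ∫⁻ z in φ.target, ENNReal.ofReal (g.volumeDensity φ z) * F (φ.symm z) := by
  unfold BilinField.chartVolume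
  have hd : AEMeasurable (fun z => ENNReal.ofReal (g.volumeDensity φ z))
      ((volume : Measure (Fin n → ℂ)).restrict φ.target) :=
    ((continuousOn_volumeDensity hg hφ).aemeasurable φ.open_target.measurableSet).ennreal_ofReal
  have hm := aemeasurable_chart_symm (φ := φ) (volume : Measure (Fin n → ℂ))
  have hm' := hm.mono_ac (withDensity_absolutelyContinuous _
    fun z => ENNReal.ofReal (g.volumeDensity φ z))
  rw [lintegral_map' hF.aemeasurable hm',
    lintegral_withDensity_eq_lintegral_mul₀' (g := fun z => F (φ.symm z)) hd
      (hF.comp_aemeasurable hm')]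
  rfl

/-- The chart `φ` need not belong to the atlas. Since only the charts of the atlas enter the
supremum in `volumeMeasure`, the set `A` is also required to lie in one of them. -/
theorem volumeMeasure_apply_of_subset (hφ : φ ∈ realAtlas n X) {x₀ : X} {A : Set X}
    (hA : MeasurableSet A) (hAφ : A ⊆ φ.source) (hA₀ : A ⊆ (chartAt (Fin n → ℂ) x₀).source) :
    g.volumeMeasure A = g.chartVolume φ A := by
  refine le_antisymm ?_ ?_
  -- The right-hand side is a measure which dominates all the chart volumes, as these agree on `A`.
  · have hle : g.volumeMeasure ≤ g.chartVolume φ + g.volumeMeasure.restrict Aᶜ := by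
      refine iSup₂_le fun ψ hψ => Measure.le_iff.2 fun S hS => ?_
      have hψ' : ψ ∈ realAtlas n X := IsManifold.subset_maximalAtlas hψ
      rw [Measure.add_apply, Measure.restrict_apply hS, ← sdiff_eq,
        ← measure_inter_add_sdiff S hA]
      refine add_le_add ?_ (Measure.le_iff'.1 (le_iSup₂ (f := fun ψ _ => g.chartVolume ψ) ψ hψ) _)
      have h1 : g.chartVolume ψ (S ∩ A) = g.chartVolume ψ (S ∩ A ∩ ψ.source) := by
        rw [chartVolume_apply (hS.inter hA),
          chartVolume_apply ((hS.inter hA).inter ψ.open_source.measurableSet)]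
        congr 2
        ext z
        simp only [mem_inter_iff, mem_preimage]
        exact ⟨fun h => ⟨h.1, h.2, ψ.map_target h.1⟩, fun h => ⟨h.1, h.2.1⟩⟩
      rw [h1, chartVolume_eq_of_subset hψ' hφ
        ((hS.inter hA).inter ψ.open_source.measurableSet) inter_subset_right
        (fun x hx => hAφ hx.1.2)]
      exact measure_mono fun x hx => hx.1.1
    refine (Measure.le_iff'.1 hle A).trans ?_
    rw [Measure.add_apply, Measure.restrict_apply hA]
    simp
  · have h₀ : chartAt (Fin n → ℂ) x₀ ∈ atlas (Fin n → ℂ) X := chart_mem_atlas _ _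
    rw [chartVolume_eq_of_subset hφ (IsManifold.subset_maximalAtlas h₀) hA hAφ hA₀]
    exact Measure.le_iff'.1 (le_iSup₂ (f := fun ψ _ => g.chartVolume ψ) _ h₀) _

/-- The Riemannian volume in a holomorphic chart `φ`. -/
theorem setLIntegral_volumeMeasure (hg : g.IsSmoothMetricOn univ) (hφ : φ ∈ realAtlas n X)
    {x₀ : X} {A : Set X} (hA : MeasurableSet A) (hAφ : A ⊆ φ.source)
    (hA₀ : A ⊆ (chartAt (Fin n → ℂ) x₀).source) {F : X → ℝ≥0∞} (hF : Measurable F) :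
    ∫⁻ x in A, F x ∂g.volumeMeasure =
      ∫⁻ z in φ.target ∩ φ.symm ⁻¹' A, ENNReal.ofReal (g.volumeDensity φ z) * F (φ.symm z) := by
  have hres : g.volumeMeasure.restrict A = (g.chartVolume φ).restrict A := by
    ext S hS
    rw [Measure.restrict_apply hS, Measure.restrict_apply hS,
      volumeMeasure_apply_of_subset hφ (hS.inter hA) (inter_subset_right.trans hAφ)
        (inter_subset_right.trans hA₀)]
  rw [hres, ← lintegral_indicator hA, lintegral_chartVolume hg hφ (hF.indicator hA),
    ← lintegral_indicator φ.open_target.measurableSet,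
    ← lintegral_indicator (measurableSet_target_inter_preimage hA)]
  refine lintegral_congr fun z => ?_
  by_cases hz : z ∈ φ.target
  · by_cases hzA : φ.symm z ∈ A
    · simp [hz, hzA]
    · simp [hz, hzA]
  · simp [hz]

end Volume

/-! ### Norms of canonical sections near a divisor -/

section Divisors

variable {n : ℕ} {X : Type*} [TopologicalSpace X] [ChartedSpace (Fin n → ℂ) X]

/-- A holomorphic function which vanishes on the coordinate hyperplane `zₖ = 0`, with nonzero
differential at the point `z₀` of this hyperplane, is comparable to `zₖ` near `z₀`. -/
theorem eventually_norm_comparable_coord {s : (Fin n → ℂ) → ℂ} {z₀ : Fin n → ℂ} {k : Fin n}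
    (hs : ContDiffAt ℂ ω s z₀) (hk : z₀ k = 0) (hd : fderiv ℂ s z₀ ≠ 0)
    (h0 : ∀ᶠ z in 𝓝 z₀, z k = 0 → s z = 0) :
    ∃ K : ℝ, 0 < K ∧ ∀ᶠ z in 𝓝 z₀, K⁻¹ * ‖z k‖ ≤ ‖s z‖ ∧ ‖s z‖ ≤ K * ‖z k‖ := by
  have hstrict : HasStrictFDerivAt s (fderiv ℂ s z₀) z₀ := hs.hasStrictFDerivAt (by simp)
  set s' := fderiv ℂ s z₀ with hs'
  -- The differential vanishes on the tangent space of the hyperplane.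
  have hker : ∀ v : Fin n → ℂ, v k = 0 → s' v = 0 := by
    intro v hv
    have h1 : HasDerivAt (fun t : ℂ => s (z₀ + t • v)) (s' v) 0 :=
      hstrict.hasFDerivAt.hasLineDerivAt v
    have hcont : Filter.Tendsto (fun t : ℂ => z₀ + t • v) (𝓝 0) (𝓝 z₀) := by
      have : Continuous fun t : ℂ => z₀ + t • v := by fun_prop
      simpa using this.tendsto 0
    have h2 : (fun t : ℂ => s (z₀ + t • v)) =ᶠ[𝓝 0] fun _ => 0 := by
      filter_upwards [hcont.eventually h0] with t ht
      exact ht (by simp [hk, hv])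
    exact h1.unique ((hasDerivAt_const (0 : ℂ) (0 : ℂ)).congr_of_eventuallyEq h2)
  set l : ℂ := s' (Pi.single k 1) with hl
  have hsingle : ∀ w : ℂ, s' (Pi.single k w) = w * l := by
    intro w
    rw [hl, ← smul_eq_mul, ← map_smul, ← Pi.single_smul, smul_eq_mul, mul_one]
  have hl0 : l ≠ 0 := by
    intro h
    apply hd
    ext v
    have : v = (v - Pi.single k (v k)) + Pi.single k (v k) := by simp
    rw [this, map_add, hker _ (by simp), hsingle, h]
    simp
  have hl' : 0 < ‖l‖ := norm_pos_iff.2 hl0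
  -- Compare `z` with its projection to the hyperplane, where `s` vanishes. The strict derivative
  -- gives an estimate which is uniform in both points.
  have hupd : Filter.Tendsto (fun z : Fin n → ℂ => (z, Function.update z k 0)) (𝓝 z₀)
      (𝓝 (z₀, z₀)) := by
    have : Continuous fun z : Fin n → ℂ => (z, Function.update z k 0) := by fun_prop
    have h := this.tendsto z₀
    rwa [show Function.update z₀ k 0 = z₀ by rw [← hk, Function.update_eq_self]] at h
  have hsmall := hupd.eventually (hstrict.isLittleO.def (half_pos hl'))
  have hzero := (hupd.snd_nhds).eventually h0
  refine ⟨max (3 / 2 * ‖l‖) (‖l‖ / 2)⁻¹, lt_max_of_lt_left (by positivity), ?_⟩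
  filter_upwards [hsmall, hzero] with z hz hz0
  have hsub : z - Function.update z k 0 = Pi.single k (z k) := by
    ext i
    by_cases hi : i = k
    · subst hi; simp
    · simp [hi]
  rw [hz0 (by simp), hsub, hsingle, sub_zero, Pi.norm_single] at hz
  have hn : ‖z k * l‖ = ‖l‖ * ‖z k‖ := by rw [norm_mul, mul_comm]
  have h1 := norm_sub_norm_le (s z) (z k * l)
  have h2 := norm_sub_norm_le (z k * l) (s z)
  rw [norm_sub_rev] at h2
  constructor
  · calc (max (3 / 2 * ‖l‖) (‖l‖ / 2)⁻¹)⁻¹ * ‖z k‖ ≤ ‖l‖ / 2 * ‖z k‖ := by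
          gcongr
          exact inv_le_of_inv_le₀ (by positivity) (le_max_right _ _)
      _ ≤ ‖s z‖ := by linarith
  · calc ‖s z‖ ≤ 3 / 2 * ‖l‖ * ‖z k‖ := by linarith
      _ ≤ _ := by gcongr; exact le_max_left _ _

theorem LocalEquation.contDiffAt_comp_symm {D : Set X} (s : LocalEquation n D)
    {c : OpenPartialHomeomorph X (Fin n → ℂ)}
    (hc : c ∈ IsManifold.maximalAtlas 𝓘(ℂ, Fin n → ℂ) ω X) {x₀ : X} (hx : x₀ ∈ c.source)
    (hs : x₀ ∈ s.domain) : ContDiffAt ℂ ω (s.eqn ∘ c.symm) (c x₀) := by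
  rw [← contMDiffAt_iff_contDiffAt]
  have h1 := (contMDiffOn_symm_of_mem_maximalAtlas hc).contMDiffAt
    (c.open_target.mem_nhds (c.map_source hx))
  refine ContMDiffAt.comp (c x₀) ?_ h1
  rw [c.left_inv hx]
  exact s.holomorphic.contMDiffAt (s.isOpen_domain.mem_nhds hs)

theorem LocalEquation.fderiv_comp_symm_ne_zero {D : Set X} (s : LocalEquation n D)
    {c : OpenPartialHomeomorph X (Fin n → ℂ)}
    (hc : c ∈ IsManifold.maximalAtlas 𝓘(ℂ, Fin n → ℂ) ω X) {x₀ : X} (hx : x₀ ∈ c.source)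
    (hs : x₀ ∈ s.domain) (h0 : s.eqn x₀ = 0) : fderiv ℂ (s.eqn ∘ c.symm) (c x₀) ≠ 0 := by
  intro hzero
  refine s.submersive x₀ hs h0 ?_
  have h1 : HasMFDerivAt 𝓘(ℂ, Fin n → ℂ) 𝓘(ℂ, ℂ) (s.eqn ∘ c.symm) (c x₀)
      (0 : (Fin n → ℂ) →L[ℂ] ℂ) := by
    have := ((s.contDiffAt_comp_symm hc hx hs).differentiableAt (by simp)).hasFDerivAt
    rw [hzero] at this
    exact this.hasMFDerivAt
  have h2 := ((contMDiffAt_of_mem_maximalAtlas hc hx).mdifferentiableAt (by simp)).hasMFDerivAt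
  have h3 : s.eqn =ᶠ[𝓝 x₀] (s.eqn ∘ c.symm) ∘ c := by
    filter_upwards [c.open_source.mem_nhds hx] with x hx
    simp [c.left_inv hx]
  have h4 := ((h1.comp x₀ h2).congr_of_eventuallyEq h3).mfderiv
  rw [h4]
  exact ContinuousLinearMap.zero_comp _

namespace DivisorHermitianMetric

variable {D : SmoothPrimeDivisor n X} (h : DivisorHermitianMetric D)

theorem sectionNormSq_eq (s : LocalEquation n D.support) {x : X} (hx : x ∈ s.domain) :
    h.sectionNormSq x = ‖s.eqn x‖ ^ 2 * h.frameNormSq s x :=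
  h.compatible _ s x ⟨(D.exists_localEquation x).choose_spec, hx⟩

theorem continuous_sectionNormSq : Continuous h.sectionNormSq := by
  refine continuous_iff_continuousAt.2 fun x => ?_
  obtain ⟨s, hs⟩ := D.exists_localEquation x
  have hnhds := s.isOpen_domain.mem_nhds hs
  have h1 : ContinuousAt (fun y => ‖s.eqn y‖ ^ 2 * h.frameNormSq s y) x :=
    (((s.holomorphic.continuousOn.continuousAt hnhds).norm).pow 2).mul
      ((h.smooth s).continuousOn.continuousAt hnhds)
  refine h1.congr ?_
  filter_upwards [hnhds] with y hy
  exact (h.sectionNormSq_eq s hy).symm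

theorem sectionNormSq_nonneg (x : X) : 0 ≤ h.sectionNormSq x :=
  mul_nonneg (sq_nonneg _) (h.pos _ x (D.exists_localEquation x).choose_spec).le

theorem sectionNormSq_pos {x : X} (hx : x ∉ D.support) : 0 < h.sectionNormSq x := by
  obtain ⟨s, hs⟩ := D.exists_localEquation x
  rw [h.sectionNormSq_eq s hs]
  refine mul_pos ?_ (h.pos s x hs)
  have : s.eqn x ≠ 0 := fun h0 => hx ((s.mem_iff x hs).2 h0)
  positivity

end DivisorHermitianMetric

/-- Two continuous functions which are positive at `x₀` are comparable near `x₀`. -/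
theorem eventually_comparable_of_pos {a a' : X → ℝ} {x₀ : X} (ha : ContinuousAt a x₀)
    (ha' : ContinuousAt a' x₀) (h : 0 < a x₀) (h' : 0 < a' x₀) :
    ∃ K : ℝ, 0 < K ∧ ∀ᶠ x in 𝓝 x₀, K⁻¹ * a' x ≤ a x ∧ a x ≤ K * a' x := by
  set M := a x₀ / a' x₀ with hM
  have hMpos : 0 < M := div_pos h h'
  have hq : ContinuousAt (fun x => a x / a' x) x₀ := ha.div ha' h'.ne'
  refine ⟨max (2 * M) (M / 2)⁻¹, lt_max_of_lt_left (by positivity), ?_⟩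
  filter_upwards [hq.eventually (Ioo_mem_nhds (half_lt_self hMpos) (by linarith : M < 2 * M)),
    ha'.eventually (lt_mem_nhds h')] with x hx hpos
  constructor
  · calc (max (2 * M) (M / 2)⁻¹)⁻¹ * a' x ≤ M / 2 * a' x := by
          gcongr
          exact inv_le_of_inv_le₀ (by positivity) (le_max_right _ _)
      _ ≤ a x := ((lt_div_iff₀ hpos).1 hx.1).le
  · calc a x ≤ 2 * M * a' x := ((div_lt_iff₀ hpos).1 hx.2).le
      _ ≤ _ := by gcongr; exact le_max_left _ _

/-- In a chart in which the divisor `D` is the coordinate hyperplane `zₖ = 0`, the function `|σ|²`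
is locally comparable to `|zₖ|²`. -/
theorem DivisorHermitianMetric.eventually_comparable_coord {D : SmoothPrimeDivisor n X}
    (h : DivisorHermitianMetric D) {c : OpenPartialHomeomorph X (Fin n → ℂ)}
    (hc : c ∈ IsManifold.maximalAtlas 𝓘(ℂ, Fin n → ℂ) ω X) {k : Fin n}
    (hD : ∀ x ∈ c.source, x ∈ D.support ↔ c x k = 0) {x₀ : X} (hx : x₀ ∈ c.source) :
    ∃ K : ℝ, 0 < K ∧ ∀ᶠ x in 𝓝 x₀, K⁻¹ * ‖c x k‖ ^ 2 ≤ h.sectionNormSq x ∧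
      h.sectionNormSq x ≤ K * ‖c x k‖ ^ 2 := by
  have hcc : ContinuousAt c x₀ := c.continuousAt hx
  by_cases hxD : x₀ ∈ D.support
  · obtain ⟨s, hs⟩ := D.exists_localEquation x₀
    have hk := (hD x₀ hx).1 hxD
    have hnhds := s.isOpen_domain.mem_nhds hs
    have hsymm : ContinuousAt c.symm (c x₀) := c.symm.continuousAt (c.map_source hx)
    have h0 : ∀ᶠ z in 𝓝 (c x₀), z k = 0 → (s.eqn ∘ c.symm) z = 0 := by
      filter_upwards [c.open_target.mem_nhds (c.map_source hx), hsymm.preimage_mem_nhds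
        (by rwa [c.left_inv hx])] with z hz hzs hzk
      refine (s.mem_iff _ hzs).1 ((hD _ (c.map_target hz)).2 ?_)
      rwa [c.right_inv hz]
    obtain ⟨K, hK, hcomp⟩ := eventually_norm_comparable_coord (s.contDiffAt_comp_symm hc hx hs) hk
      (s.fderiv_comp_symm_ne_zero hc hx hs ((s.mem_iff _ hs).1 hxD)) h0
    have hfr : ContinuousAt (h.frameNormSq s) x₀ := (h.smooth s).continuousOn.continuousAt hnhds
    obtain ⟨L, hL, hLcomp⟩ := eventually_comparable_of_pos hfr
      (continuousAt_const (y := (1 : ℝ))) (h.pos s x₀ hs) one_pos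
    refine ⟨K ^ 2 * L, by positivity, ?_⟩
    filter_upwards [hcc.eventually hcomp, hLcomp, hnhds, c.open_source.mem_nhds hx]
      with x hxc hxL hxs hxc'
    rw [Function.comp_apply, c.left_inv hxc'] at hxc
    rw [h.sectionNormSq_eq s hxs]
    simp only [mul_one] at hxL
    constructor
    · calc (K ^ 2 * L)⁻¹ * ‖c x k‖ ^ 2 = (K⁻¹ * ‖c x k‖) ^ 2 * L⁻¹ := by
            rw [mul_inv, mul_pow, inv_pow]; ring
        _ ≤ _ := by gcongr; exacts [hxc.1, hxL.1]
    · calc _ ≤ (K * ‖c x k‖) ^ 2 * L := by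
            gcongr
            exacts [(h.pos s x hxs).le, hxc.2, hxL.2]
        _ = _ := by ring
  · refine eventually_comparable_of_pos h.continuous_sectionNormSq.continuousAt ?_
      (h.sectionNormSq_pos hxD) ?_
    · exact (((continuous_apply k).continuousAt.comp hcc).norm).pow 2
    · have : c x₀ k ≠ 0 := fun h0 => hxD ((hD x₀ hx).2 h0)
      positivity

end Divisors

/-! ### The weights in an adapted chart -/

section Weights

variable {n : ℕ} {X : Type*} [TopologicalSpace X] [ChartedSpace (Fin n → ℂ) X]
  {ι : Type*} [Fintype ι] {D : ι → SmoothPrimeDivisor n X}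

open Classical in
/-- The exponent of `zₖ` in the adapted chart `c` for the divisor `∑ r i • D i`: the sum of the
`r i` over the members `D i` which in this chart have the equation `zₖ = 0`. -/
def chartExponent (c : AdaptedChart D) (r : ι → ℝ) (k : Fin n) : ℝ :=
  ∑ i, if ((D i).support ∩ c.chart.source).Nonempty ∧ c.coord i = k then r i else 0

/-- The weight `∏ (ε² + |σᵢ|²) ^ r i` on `X`. -/
def divisorWeight (h : ∀ i, DivisorHermitianMetric (D i)) (r : ι → ℝ) (ε : ℝ) (x : X) : ℝ :=
  ∏ i, (ε ^ 2 + (h i).sectionNormSq x) ^ r i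

theorem divisorWeight_nonneg (h : ∀ i, DivisorHermitianMetric (D i)) (r : ι → ℝ) (ε : ℝ) (x : X) :
    0 ≤ divisorWeight h r ε x :=
  Finset.prod_nonneg fun i _ =>
    Real.rpow_nonneg (add_nonneg (sq_nonneg _) ((h i).sectionNormSq_nonneg x)) _

theorem measurable_divisorWeight [MeasurableSpace X] [BorelSpace X]
    (h : ∀ i, DivisorHermitianMetric (D i)) (r : ι → ℝ) (ε : ℝ) :
    Measurable (divisorWeight h r ε) := by
  unfold divisorWeight
  refine Finset.measurable_prod _ fun i _ => ?_
  exact ((h i).continuous_sectionNormSq.measurable.const_add _).pow_const _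

/-- Comparable positive numbers have comparable powers, also if the exponent is negative. -/
theorem rpow_comparable {a m K r : ℝ} (hK : 0 < K) (hm : 0 < m) (h₁ : K⁻¹ * m ≤ a)
    (h₂ : a ≤ K * m) :
    (max K K⁻¹ ^ |r|)⁻¹ * m ^ r ≤ a ^ r ∧ a ^ r ≤ max K K⁻¹ ^ |r| * m ^ r := by
  set L := max K K⁻¹ with hL
  have hL0 : 0 < L := lt_max_of_lt_left hK
  have hKL : K ≤ L := le_max_left _ _
  have hKL' : L⁻¹ ≤ K⁻¹ := inv_anti₀ hK hKL
  have ha : 0 < a := lt_of_lt_of_le (by positivity) h₁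
  have h1 : L⁻¹ * m ≤ a := le_trans (by gcongr) h₁
  have h2 : a ≤ L * m := h₂.trans (by gcongr)
  have e1 : m = L * (L⁻¹ * m) := by field_simp
  rcases le_total 0 r with hr | hr
  · rw [abs_of_nonneg hr, ← Real.inv_rpow hL0.le, ← Real.mul_rpow (by positivity) hm.le,
      ← Real.mul_rpow hL0.le hm.le]
    exact ⟨Real.rpow_le_rpow (by positivity) h1 hr, Real.rpow_le_rpow ha.le h2 hr⟩
  · rw [abs_of_nonpos hr, Real.rpow_neg hL0.le, inv_inv, ← Real.inv_rpow hL0.le,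
      ← Real.mul_rpow hL0.le hm.le, ← Real.mul_rpow (by positivity) hm.le]
    exact ⟨Real.rpow_le_rpow_of_nonpos ha h2 hr,
      Real.rpow_le_rpow_of_nonpos (by positivity) h1 hr⟩

open Classical in
/-- The product over the divisors, ordered by the coordinates. -/
theorem prod_rpow_eq_polyWeight (c : AdaptedChart D) (r : ι → ℝ) (ε : ℝ) {z : Fin n → ℂ}
    (hz : ∀ k, z k ≠ 0) :
    ∏ i, (if ((D i).support ∩ c.chart.source).Nonempty then ε ^ 2 + ‖z (c.coord i)‖ ^ 2 else 1)
      ^ r i = polyWeight ε (chartExponent c r) z := by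
  have hpos : ∀ k, 0 < ε ^ 2 + ‖z k‖ ^ 2 := fun k => by
    have := norm_pos_iff.2 (hz k); positivity
  unfold polyWeight chartExponent
  simp_rw [Real.rpow_sum_of_pos (hpos _)]
  rw [Finset.prod_comm]
  refine Finset.prod_congr rfl fun i _ => ?_
  by_cases hi : ((D i).support ∩ c.chart.source).Nonempty
  · rw [Finset.prod_eq_single (c.coord i)]
    · simp [hi]
    · intro k _ hk
      simp [hk.symm]
    · simp
  · simp [hi]

/-- Near a point of an adapted chart, the weight `∏ (ε² + |σᵢ|²) ^ r i` is comparable, uniformly in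
`ε`, to a product of powers of the `ε² + |zₖ|²`. -/
theorem eventually_divisorWeight_comparable (c : AdaptedChart D)
    (h : ∀ i, DivisorHermitianMetric (D i)) (r : ι → ℝ) (ε₀ : ℝ) {x₀ : X}
    (hx₀ : x₀ ∈ c.chart.source) :
    ∃ K : ℝ, 0 < K ∧ ∀ᶠ x in 𝓝 x₀, ∀ ε, 0 ≤ ε → ε ≤ ε₀ → (∀ k, c.chart x k ≠ 0) →
      K⁻¹ * polyWeight ε (chartExponent c r) (c.chart x) ≤ divisorWeight h r ε x ∧
      divisorWeight h r ε x ≤ K * polyWeight ε (chartExponent c r) (c.chart x) := by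
  classical
  set m : ι → ℝ → X → ℝ := fun i ε x =>
    if ((D i).support ∩ c.chart.source).Nonempty then ε ^ 2 + ‖c.chart x (c.coord i)‖ ^ 2
    else 1 with hm
  have hfac : ∀ i, ∃ K : ℝ, 0 < K ∧ ∀ᶠ x in 𝓝 x₀, ∀ ε, 0 ≤ ε → ε ≤ ε₀ →
      (∀ k, c.chart x k ≠ 0) →
      K⁻¹ * m i ε x ^ r i ≤ (ε ^ 2 + (h i).sectionNormSq x) ^ r i ∧
      (ε ^ 2 + (h i).sectionNormSq x) ^ r i ≤ K * m i ε x ^ r i := by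
    intro i
    by_cases hi : ((D i).support ∩ c.chart.source).Nonempty
    · obtain ⟨K, hK, hcomp⟩ := (h i).eventually_comparable_coord c.mem_maximalAtlas
        (c.mem_iff i hi) hx₀
      have hL : 1 ≤ max K 1 := le_max_right _ _
      have hL0 : 0 < max K 1 := by positivity
      refine ⟨max (max K 1) (max K 1)⁻¹ ^ |r i|,
        Real.rpow_pos_of_pos (lt_max_of_lt_left hL0) _, ?_⟩
      filter_upwards [hcomp] with x hx ε hε hε₀ hz
      have hpos := norm_pos_iff.2 (hz (c.coord i))
      have hle : (max K 1)⁻¹ ≤ 1 := inv_le_one_of_one_le₀ hL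
      have hle' : (max K 1)⁻¹ ≤ K⁻¹ := inv_anti₀ hK (le_max_left _ _)
      simp only [hm, hi, if_true]
      refine rpow_comparable hL0 (by positivity) ?_ ?_
      · have h1 : (max K 1)⁻¹ * ε ^ 2 ≤ ε ^ 2 := mul_le_of_le_one_left (sq_nonneg _) hle
        have h2 : (max K 1)⁻¹ * ‖c.chart x (c.coord i)‖ ^ 2 ≤ K⁻¹ * ‖c.chart x (c.coord i)‖ ^ 2 :=
          by gcongr
        linarith [hx.1]
      · have h1 : ε ^ 2 ≤ max K 1 * ε ^ 2 := le_mul_of_one_le_left (sq_nonneg _) hL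
        have h2 : K * ‖c.chart x (c.coord i)‖ ^ 2 ≤ max K 1 * ‖c.chart x (c.coord i)‖ ^ 2 := by
          gcongr; exact le_max_left _ _
        linarith [hx.2]
    -- The divisor misses the chart, so `|σ|²` is bounded above and below near `x₀`.
    · have hx₀D : x₀ ∉ (D i).support := fun hD => hi ⟨x₀, hD, hx₀⟩
      obtain ⟨K, hK, hcomp⟩ := eventually_comparable_of_pos
        (h i).continuous_sectionNormSq.continuousAt (continuousAt_const (y := (1 : ℝ)))
        ((h i).sectionNormSq_pos hx₀D) one_pos
      have hL0 : 0 < K + ε₀ ^ 2 := by positivity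
      refine ⟨max (K + ε₀ ^ 2) (K + ε₀ ^ 2)⁻¹ ^ |r i|,
        Real.rpow_pos_of_pos (lt_max_of_lt_left hL0) _, ?_⟩
      filter_upwards [hcomp] with x hx ε hε hε₀ hz
      simp only [hm, hi, if_false]
      have hε2 : ε ^ 2 ≤ ε₀ ^ 2 := by gcongr
      refine rpow_comparable hL0 one_pos ?_ ?_
      · have h1 : (K + ε₀ ^ 2)⁻¹ ≤ K⁻¹ := inv_anti₀ hK (by nlinarith [sq_nonneg ε₀])
        nlinarith [hx.1, sq_nonneg ε]
      · linarith [hx.2]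
  choose K hK hcomp using hfac
  refine ⟨∏ i, K i, Finset.prod_pos fun i _ => hK i, ?_⟩
  filter_upwards [Filter.eventually_all.2 hcomp] with x hx ε hε hε₀ hz
  have hm0 : ∀ i, 0 ≤ m i ε x := fun i => by
    simp only [hm]; split_ifs <;> positivity
  rw [← prod_rpow_eq_polyWeight c r ε hz, divisorWeight, ← Finset.prod_inv_distrib,
    ← Finset.prod_mul_distrib, ← Finset.prod_mul_distrib]
  constructor
  · refine Finset.prod_le_prod (fun i _ => ?_) fun i _ => (hx i ε hε hε₀ hz).1
    exact mul_nonneg (inv_nonneg.2 (hK i).le) (Real.rpow_nonneg (hm0 i) _)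
  · refine Finset.prod_le_prod (fun i _ => ?_) fun i _ => (hx i ε hε hε₀ hz).2
    exact Real.rpow_nonneg (add_nonneg (sq_nonneg _) ((h i).sectionNormSq_nonneg x)) _

theorem chartExponent_add (c : AdaptedChart D) (r s : ι → ℝ) (k : Fin n) :
    chartExponent c (r + s) k = chartExponent c r k + chartExponent c s k := by
  unfold chartExponent
  rw [← Finset.sum_add_distrib]
  refine Finset.sum_congr rfl fun i _ => ?_
  split_ifs <;> simp

theorem chartExponent_smul (c : AdaptedChart D) (a : ℝ) (r : ι → ℝ) (k : Fin n) :
    chartExponent c (a • r) k = a * chartExponent c r k := by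
  unfold chartExponent
  rw [Finset.mul_sum]
  refine Finset.sum_congr rfl fun i _ => ?_
  split_ifs <;> simp

theorem chartExponent_nonneg (c : AdaptedChart D) {r : ι → ℝ} (hr : ∀ i, 0 ≤ r i) (k : Fin n) :
    0 ≤ chartExponent c r k := by
  refine Finset.sum_nonneg fun i _ => ?_
  split_ifs
  exacts [hr i, le_rfl]

/-- Distinct members of the family correspond to distinct coordinates, so that at most one of them
contributes to `chartExponent c r k`. -/
theorem chartExponent_lt_one (c : AdaptedChart D) {r : ι → ℝ} (hr : ∀ i, r i < 1) (k : Fin n) :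
    chartExponent c r k < 1 := by
  classical
  unfold chartExponent
  by_cases hex : ∃ i, ((D i).support ∩ c.chart.source).Nonempty ∧ c.coord i = k
  · obtain ⟨i, hi, hik⟩ := hex
    rw [Finset.sum_eq_single i]
    · rw [if_pos ⟨hi, hik⟩]; exact hr i
    · intro j _ hj
      rw [if_neg]
      rintro ⟨hj', hjk⟩
      exact hj (c.injOn hj' hi (hjk.trans hik.symm))
    · simp
  · rw [Finset.sum_eq_zero]
    · exact one_pos
    · intro i _
      rw [if_neg fun hi => hex ⟨i, hi⟩]

end Weights

/-! ### Gradients in an adapted chart -/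

section Gradient

variable {n : ℕ} {X : Type*} [TopologicalSpace X] [ChartedSpace (Fin n → ℂ) X]

theorem enorm_fderiv_le_gradNorm {g : BilinField n X} {φ : OpenPartialHomeomorph X (Fin n → ℂ)}
    (hφ : φ ∈ realAtlas n X) {z : Fin n → ℂ} (hz : z ∈ φ.target) {u : X → ℂ}
    (hu : MDifferentiableAt 𝓘(ℝ, Fin n → ℂ) 𝓘(ℝ, ℂ) u (φ.symm z)) (w : Fin n → ℂ)
    (hw : g.inChart φ z w w ≤ 1) :
    ‖fderiv ℝ (u ∘ φ.symm) z w‖ₑ ≤ g.gradNorm u (φ.symm z) := by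
  have h1 := hu.hasMFDerivAt.comp z
    ((mdifferentiable_of_mem_realAtlas hφ).mdifferentiableAt_symm hz).hasMFDerivAt
  have h2 := h1.mfderiv
  rw [mfderiv_eq_fderiv] at h2
  rw [h2]
  exact le_iSup₂ (f := fun (v : TangentSpace 𝓘(ℝ, Fin n → ℂ) (φ.symm z))
    (_ : g (φ.symm z) v v ≤ 1) =>
      let w : ℂ := mfderiv 𝓘(ℝ, Fin n → ℂ) 𝓘(ℝ, ℂ) u (φ.symm z) v
      ‖w‖ₑ) (mfderiv 𝓘(ℝ, Fin n → ℂ) 𝓘(ℝ, Fin n → ℂ) φ.symm z w) hw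

variable {I J : Type*} [Fintype I] [Fintype J]
  {E : I → SmoothPrimeDivisor n X} {B : J → SmoothPrimeDivisor n X}

/-- The model conic metric, off the coordinate hyperplanes, in terms of `chartExponent`. -/
theorem modelConicNormSq_eq (c : AdaptedChart (Sum.elim E B))
    (hc : c.chart ∈ realAtlas n X) (b : J → ℝ) (ε : ℝ) {z : Fin n → ℂ} (hz : z ∈ c.chart.target)
    (hz0 : ∀ k, z k ≠ 0) (w : Fin n → ℂ) :
    modelConicNormSq c b ε (c.chart.symm z)
        (mfderiv 𝓘(ℝ, Fin n → ℂ) 𝓘(ℝ, Fin n → ℂ) c.chart.symm z w) =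
      ∑ k, ‖w k‖ ^ 2 / (ε ^ 2 + ‖z k‖ ^ 2) ^ chartExponent c (Sum.elim 0 b) k := by
  have hid := DFunLike.congr_fun
    ((mdifferentiable_of_mem_realAtlas hc).comp_symm_deriv hz) w
  unfold modelConicNormSq
  refine Finset.sum_congr rfl fun k _ => ?_
  have hpos : 0 < ε ^ 2 + ‖z k‖ ^ 2 := by
    have := norm_pos_iff.2 (hz0 k); positivity
  rw [c.chart.right_inv hz]
  congr 1
  · congr 2
    exact congrFun hid k
  · unfold chartExponent
    rw [Real.rpow_sum_of_pos hpos, Fintype.prod_sum_type]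
    rw [Finset.prod_eq_one (s := (Finset.univ : Finset I)), one_mul]
    swap
    · intro α _
      split_ifs <;> simp
    refine Finset.prod_congr rfl fun β _ => ?_
    by_cases hβ : ((B β).support ∩ c.chart.source).Nonempty ∧ c.coord (Sum.inr β) = k
    · exact (if_pos hβ).trans (congrArg _ (if_pos hβ).symm)
    · exact (if_neg hβ).trans ((Real.rpow_zero _).symm.trans (congrArg _ (if_neg hβ).symm))

end Gradient

/-! ### Cutoff functions -/

section Cutoff

variable {n : ℕ} {v : (Fin n → ℂ) → ℂ} {T : Set (Fin n → ℂ)} {z₀ : Fin n → ℂ}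

theorem contDiff_bump_smul (hT : IsOpen T) (hv : ContDiffOn ℝ 1 v T) (χ : ContDiffBump z₀)
    (hχ : Metric.closedBall z₀ χ.rOut ⊆ T) : ContDiff ℝ 1 fun z => χ z • v z := by
  refine contDiff_iff_contDiffAt.2 fun z => ?_
  by_cases hz : z ∈ T
  · exact χ.contDiffAt.smul (hv.contDiffAt (hT.mem_nhds hz))
  · have hz' : z ∉ tsupport χ := by
      rw [χ.tsupport_eq]; exact fun h => hz (hχ h)
    refine (contDiffAt_const (c := (0 : ℂ))).congr_of_eventuallyEq ?_
    filter_upwards [notMem_tsupport_iff_eventuallyEq.1 hz'] with w hw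
    simp [hw]

theorem hasCompactSupport_bump_smul (v : (Fin n → ℂ) → ℂ) (χ : ContDiffBump z₀) :
    HasCompactSupport fun z => χ z • v z :=
  χ.hasCompactSupport.mono (Function.support_smul_subset_left χ v)

theorem norm_realFrame (i : Fin n × Fin 2) : ‖(realFrame i : Fin n → ℂ)‖ = 1 := by
  unfold realFrame
  rw [Pi.norm_single]
  split_ifs <;> simp

theorem complexGrad_bump_smul_le (hT : IsOpen T) (hv : ContDiffOn ℝ 1 v T) (χ : ContDiffBump z₀)
    {L : ℝ} (hL : ∀ z, ‖fderiv ℝ χ z‖ ≤ L) (k : Fin n) {z : Fin n → ℂ} (hz : z ∈ T) :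
    complexGrad (fun z => χ z • v z) k z ≤
      ∑ j : Fin 2, (ENNReal.ofReal L * ‖v z‖ₑ + ‖fderiv ℝ v z (realFrame (k, j))‖ₑ) := by
  refine Finset.sum_le_sum fun j _ => ?_
  have h1 : HasFDerivAt v (fderiv ℝ v z) z :=
    ((hv.contDiffAt (hT.mem_nhds hz)).differentiableAt one_ne_zero).hasFDerivAt
  have h2 : HasFDerivAt χ (fderiv ℝ χ z) z :=
    ((χ.contDiffAt (n := 1)).differentiableAt one_ne_zero).hasFDerivAt
  rw [show (fun z => χ z • v z) = (χ : (Fin n → ℂ) → ℝ) • v from rfl, (h2.smul h1).fderiv]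
  simp only [add_apply, smul_apply, ContinuousLinearMap.smulRight_apply]
  rw [add_comm]
  refine (enorm_add_le _ _).trans (add_le_add ?_ ?_)
  · rw [enorm_smul]
    gcongr
    rw [← ofReal_norm]
    refine ENNReal.ofReal_le_ofReal ?_
    calc ‖fderiv ℝ χ z (realFrame (k, j))‖ ≤ ‖fderiv ℝ χ z‖ * ‖(realFrame (k, j) : Fin n → ℂ)‖ :=
          ContinuousLinearMap.le_opNorm _ _
      _ ≤ L := by rw [norm_realFrame, mul_one]; exact hL z
  · rw [enorm_smul]
    refine mul_le_of_le_one_left zero_le ?_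
    rw [← ofReal_norm, Real.norm_of_nonneg χ.nonneg]
    simpa using χ.le_one

theorem complexGrad_bump_smul_eq_zero (v : (Fin n → ℂ) → ℂ) (χ : ContDiffBump z₀) (k : Fin n)
    {z : Fin n → ℂ} (hz : z ∉ Metric.closedBall z₀ χ.rOut) :
    complexGrad (fun z => χ z • v z) k z = 0 := by
  have hz' : z ∉ tsupport fun z => χ z • v z := fun h => hz <| by
    rw [← χ.tsupport_eq]
    exact closure_mono (Function.support_smul_subset_left χ v) h
  refine Finset.sum_eq_zero fun j _ => ?_
  rw [fderiv_of_notMem_tsupport ℝ hz']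
  simp

theorem measurable_complexGrad (f : (Fin n → ℂ) → ℂ) (k : Fin n) : Measurable (complexGrad f k) :=
  Finset.measurable_sum _ fun _ _ => (measurable_fderiv_apply_const ℝ f _).enorm

theorem exists_norm_fderiv_bump_le (χ : ContDiffBump z₀) :
    ∃ L : ℝ, 0 ≤ L ∧ ∀ z, ‖fderiv ℝ χ z‖ ≤ L := by
  obtain ⟨L, hL⟩ := (χ.hasCompactSupport.fderiv ℝ).exists_bound_of_continuous
    ((χ.contDiff (n := 1)).continuous_fderiv one_ne_zero)
  exact ⟨L, (norm_nonneg _).trans (hL z₀), hL⟩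

theorem ae_forall_coord_ne_zero : ∀ᵐ z : Fin n → ℂ, ∀ k, z k ≠ 0 :=
  ae_all_iff.2 fun k => Measure.ae_eval_ne _ k 0

theorem measurableSet_forall_coord_ne_zero : MeasurableSet {z : Fin n → ℂ | ∀ k, z k ≠ 0} := by
  simp only [ne_eq, ofPred_forall]
  exact MeasurableSet.iInter fun k => (measurable_pi_apply k (measurableSet_singleton 0)).compl

end Cutoff

/-! ### Comparison with the model in a chart -/

section Local

variable {n : ℕ} {X : Type*} [TopologicalSpace X] [ChartedSpace (Fin n → ℂ) X]

omit [ChartedSpace (Fin n → ℂ) X] in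
theorem measurable_indicator_comp_chart [MeasurableSpace X] [BorelSpace X]
    (φ : OpenPartialHomeomorph X (Fin n → ℂ)) {H : (Fin n → ℂ) → ℝ≥0∞} (hH : Measurable H) :
    Measurable (φ.source.indicator (H ∘ φ)) := by
  have hm : Measurable (φ.source.domRestrict φ) :=
    (continuousOn_iff_continuous_domRestrict.1 φ.continuousOn).measurable
  refine measurable_of_restrict_of_restrict_compl φ.open_source.measurableSet ?_ ?_
  · rw [show φ.source.domRestrict (φ.source.indicator (H ∘ φ)) = H ∘ φ.source.domRestrict φ from
      funext fun x => indicator_of_mem x.2 _]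
    exact hH.comp hm
  · rw [show φ.sourceᶜ.domRestrict (φ.source.indicator (H ∘ φ)) = fun _ => 0 from
      funext fun x => indicator_of_notMem x.2 _]
    exact measurable_const

/-- In an adapted chart near `x₀`, the measure `∏ (ε² + |σᵢ|²) ^ r i dV` is comparable, uniformly in
`ε`, to a product weight times Lebesgue measure. -/
theorem exists_lintegral_comparable [IsManifold 𝓘(ℝ, Fin n → ℂ) ω X]
    [MeasurableSpace X] [BorelSpace X] {G : BilinField n X} (hG : G.IsSmoothMetricOn univ)
    {ι : Type*} [Fintype ι] {D : ι → SmoothPrimeDivisor n X} (c : AdaptedChart D)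
    (h : ∀ i, DivisorHermitianMetric (D i)) (r : ι → ℝ) (ε₀ : ℝ) {x₀ : X}
    (hx₀ : x₀ ∈ c.chart.source) :
    ∃ U ∈ 𝓝 (c.chart x₀), ∃ K : ℝ≥0∞, K ≠ ⊤ ∧ U ⊆ c.chart.target ∧
      ∀ S ⊆ U, MeasurableSet S → ∀ ε, 0 ≤ ε → ε ≤ ε₀ → ∀ F : X → ℝ≥0∞, Measurable F →
        ∫⁻ x in c.chart.source ∩ c.chart ⁻¹' S, F x * ENNReal.ofReal (divisorWeight h r ε x)
            ∂G.volumeMeasure ≤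
          K * ∫⁻ z in S, F (c.chart.symm z) *
            ENNReal.ofReal (polyWeight ε (chartExponent c r) z) ∧
        ∫⁻ z in S, F (c.chart.symm z) * ENNReal.ofReal (polyWeight ε (chartExponent c r) z) ≤
          K * ∫⁻ x in c.chart.source ∩ c.chart ⁻¹' S,
            F x * ENNReal.ofReal (divisorWeight h r ε x) ∂G.volumeMeasure := by
  have hc : c.chart ∈ realAtlas n X := mem_realAtlas c.mem_maximalAtlas
  set z₀ := c.chart x₀ with hz₀
  have hz₀t : z₀ ∈ c.chart.target := c.chart.map_source hx₀
  have hsymm : ContinuousAt c.chart.symm z₀ := c.chart.symm.continuousAt hz₀t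
  have hsx : c.chart.symm z₀ = x₀ := c.chart.left_inv hx₀
  obtain ⟨K, hK, hcomp⟩ := eventually_divisorWeight_comparable c h r ε₀ hx₀
  rw [← hsx] at hcomp
  set M := G.volumeDensity c.chart z₀ with hM
  have hMpos : 0 < M := volumeDensity_pos hG hc hz₀t
  have hdens : ∀ᶠ z in 𝓝 z₀, G.volumeDensity c.chart z ∈ Ioo (M / 2) (2 * M) :=
    ((continuousOn_volumeDensity hG hc).continuousAt (c.chart.open_target.mem_nhds hz₀t)).eventually
      (Ioo_mem_nhds (half_lt_self hMpos) (by linarith))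
  have hchart : ∀ᶠ z in 𝓝 z₀, c.chart.symm z ∈ (chartAt (Fin n → ℂ) x₀).source :=
    hsymm.preimage_mem_nhds (by rw [hsx]; exact chart_source_mem_nhds _ _)
  have hall := (hsymm.eventually hcomp).and (hdens.and (hchart.and
    (c.chart.open_target.mem_nhds hz₀t)))
  set L := max (2 * M * K) ((M / 2)⁻¹ * K) with hL
  have hL0 : 0 < L := lt_max_of_lt_left (by positivity)
  refine ⟨_, hall, ENNReal.ofReal L, ENNReal.ofReal_ne_top, fun z hz => hz.2.2.2,
    fun S hS hSm ε hε hεε₀ F hF => ?_⟩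
  have hSt : S ⊆ c.chart.target := fun z hz => (hS hz).2.2.2
  have hset : c.chart.target ∩ c.chart.symm ⁻¹' (c.chart.source ∩ c.chart ⁻¹' S) = S := by
    ext z
    constructor
    · rintro ⟨hz, _, hzS⟩
      rwa [mem_preimage, c.chart.right_inv hz] at hzS
    · intro hz
      refine ⟨hSt hz, c.chart.map_target (hSt hz), ?_⟩
      rwa [mem_preimage, c.chart.right_inv (hSt hz)]
  have hWm : MeasurableSet (c.chart.source ∩ c.chart ⁻¹' S) :=
    c.chart.measurableSet_source_inter_preimage hSm
  rw [setLIntegral_volumeMeasure hG hc (x₀ := x₀)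
    (F := fun x => F x * ENNReal.ofReal (divisorWeight h r ε x)) hWm inter_subset_left (fun x hx => ?_)
    (hF.mul (measurable_divisorWeight h r ε).ennreal_ofReal), hset]
  swap
  · have := (hS hx.2).2.2.1
    rwa [c.chart.left_inv hx.1] at this
  have hae : ∀ᵐ z : Fin n → ℂ ∂volume.restrict S, z ∈ S ∧ ∀ k, z k ≠ 0 :=
    (ae_restrict_mem hSm).and (ae_restrict_of_ae ae_forall_coord_ne_zero)
  constructor
  · rw [← lintegral_const_mul' _ _ ENNReal.ofReal_ne_top]
    refine lintegral_mono_ae ?_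
    filter_upwards [hae] with z ⟨hz, hz0⟩
    have h1 := (hS hz).1 ε hε hεε₀ (by rwa [c.chart.right_inv (hSt hz)])
    rw [c.chart.right_inv (hSt hz)] at h1
    have hw := polyWeight_nonneg ε (chartExponent c r) z
    calc ENNReal.ofReal (G.volumeDensity c.chart z) * (F (c.chart.symm z) *
          ENNReal.ofReal (divisorWeight h r ε (c.chart.symm z)))
        ≤ ENNReal.ofReal (2 * M) * (F (c.chart.symm z) *
          ENNReal.ofReal (K * polyWeight ε (chartExponent c r) z)) := by
          gcongr
          exacts [(hS hz).2.1.2.le, h1.2]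
      _ = ENNReal.ofReal (2 * M * K) * (F (c.chart.symm z) *
          ENNReal.ofReal (polyWeight ε (chartExponent c r) z)) := by
          rw [ENNReal.ofReal_mul hK.le, ENNReal.ofReal_mul (p := 2 * M) (by positivity)]
          ring
      _ ≤ _ := by gcongr; exact le_max_left _ _
  · rw [← lintegral_const_mul' _ _ ENNReal.ofReal_ne_top]
    refine lintegral_mono_ae ?_
    filter_upwards [hae] with z ⟨hz, hz0⟩
    have h1 := (hS hz).1 ε hε hεε₀ (by rwa [c.chart.right_inv (hSt hz)])
    rw [c.chart.right_inv (hSt hz)] at h1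
    have hw := polyWeight_nonneg ε (chartExponent c r) z
    have h2 : polyWeight ε (chartExponent c r) z ≤ (M / 2)⁻¹ * K *
        (G.volumeDensity c.chart z * divisorWeight h r ε (c.chart.symm z)) := by
      have h3 : M / 2 * (K⁻¹ * polyWeight ε (chartExponent c r) z) ≤
          G.volumeDensity c.chart z * divisorWeight h r ε (c.chart.symm z) := by
        gcongr
        exacts [(volumeDensity_pos hG hc (hSt hz)).le, (hS hz).2.1.1.le, h1.1]
      calc polyWeight ε (chartExponent c r) z
          = (M / 2)⁻¹ * K * (M / 2 * (K⁻¹ * polyWeight ε (chartExponent c r) z)) := by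
            field_simp
        _ ≤ _ := by gcongr
    have hd := (volumeDensity_pos hG hc (hSt hz)).le
    have hdw := divisorWeight_nonneg h r ε (c.chart.symm z)
    calc F (c.chart.symm z) * ENNReal.ofReal (polyWeight ε (chartExponent c r) z)
        ≤ F (c.chart.symm z) * ENNReal.ofReal (L *
          (G.volumeDensity c.chart z * divisorWeight h r ε (c.chart.symm z))) := by
          gcongr
          exact h2.trans (by gcongr; exact le_max_right _ _)
      _ = _ := by
          rw [ENNReal.ofReal_mul hL0.le, ENNReal.ofReal_mul hd]
          ring

variable {I J : Type*} [Fintype I] [Fintype J]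
  {E : I → SmoothPrimeDivisor n X} {B : J → SmoothPrimeDivisor n X}

/-- The partial derivatives in an adapted chart are controlled by the gradient of the conic
metric. -/
theorem rpow_mul_enorm_fderiv_le_gradNorm (c : AdaptedChart (Sum.elim E B))
    (hc : c.chart ∈ realAtlas n X) (b : J → ℝ) {g : BilinField n X} {A ε : ℝ} (hA : 0 < A)
    {z : Fin n → ℂ} (hz : z ∈ c.chart.target) (hz0 : ∀ k, z k ≠ 0)
    (hg : ∀ v : TangentSpace 𝓘(ℝ, Fin n → ℂ) (c.chart.symm z),
      g (c.chart.symm z) v v ≤ A * modelConicNormSq c b ε (c.chart.symm z) v)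
    {u : X → ℂ} (hu : MDifferentiableAt 𝓘(ℝ, Fin n → ℂ) 𝓘(ℝ, ℂ) u (c.chart.symm z))
    (k : Fin n) (j : Fin 2) :
    ENNReal.ofReal ((ε ^ 2 + ‖z k‖ ^ 2) ^ (chartExponent c (Sum.elim 0 b) k / 2)) *
        ‖fderiv ℝ (u ∘ c.chart.symm) z (realFrame (k, j))‖ₑ ≤
      ENNReal.ofReal (√A) * g.gradNorm u (c.chart.symm z) := by
  have hpos : 0 < ε ^ 2 + ‖z k‖ ^ 2 := by
    have := norm_pos_iff.2 (hz0 k); positivity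
  set e := chartExponent c (Sum.elim 0 b) k with he
  set s := (ε ^ 2 + ‖z k‖ ^ 2) ^ (e / 2) with hs
  have hs0 : 0 < s := Real.rpow_pos_of_pos hpos _
  have hs2 : s ^ 2 = (ε ^ 2 + ‖z k‖ ^ 2) ^ e := by
    rw [hs, ← Real.rpow_natCast, ← Real.rpow_mul hpos.le]
    congr 1
    push_cast
    ring
  have hsA : 0 < √A := Real.sqrt_pos.2 hA
  set t := s / √A with ht
  have ht0 : 0 < t := div_pos hs0 hsA
  -- The factor `t` is such that this vector has length at most `1` for `g`.
  have hnorm : g.inChart c.chart z (t • realFrame (k, j)) (t • realFrame (k, j)) ≤ 1 := by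
    refine (hg _).trans ?_
    rw [modelConicNormSq_eq c hc b ε hz hz0, Finset.sum_eq_single k]
    · have h1 : ‖(t • (realFrame (k, j) : Fin n → ℂ)) k‖ = t := by
        simp only [realFrame, Pi.smul_apply, Pi.single_eq_same]
        rw [norm_smul, Real.norm_of_nonneg ht0.le]
        split_ifs <;> simp
      rw [h1, ← he, ← hs2, ht, div_pow, Real.sq_sqrt hA.le]
      apply le_of_eq
      field_simp
    · intro l _ hl
      simp [realFrame, hl]
    · simp
  have key := enorm_fderiv_le_gradNorm hc hz hu _ hnorm
  rw [map_smul, enorm_smul, Real.enorm_of_nonneg ht0.le] at key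
  calc ENNReal.ofReal s * ‖fderiv ℝ (u ∘ c.chart.symm) z (realFrame (k, j))‖ₑ
      = ENNReal.ofReal (√A) * (ENNReal.ofReal t *
        ‖fderiv ℝ (u ∘ c.chart.symm) z (realFrame (k, j))‖ₑ) := by
        rw [← mul_assoc, ← ENNReal.ofReal_mul hsA.le, ht, mul_div_cancel₀ _ hsA.ne']
    _ ≤ _ := by gcongr

end Local

/-! ### Exponents of the model weights -/

section PolyWeight

variable {n : ℕ}

theorem polyWeight_add (ε : ℝ) (e e' : Fin n → ℝ) {z : Fin n → ℂ} (hz : ∀ k, z k ≠ 0) :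
    polyWeight ε (e + e') z = polyWeight ε e z * polyWeight ε e' z := by
  unfold polyWeight
  rw [← Finset.prod_mul_distrib]
  refine Finset.prod_congr rfl fun k _ => ?_
  have := norm_pos_iff.2 (hz k)
  rw [Pi.add_apply, Real.rpow_add (by positivity)]

theorem polyWeight_le {ε ε₀ R : ℝ} (hε : 0 ≤ ε) (hεε₀ : ε ≤ ε₀) {e : Fin n → ℝ} (he : ∀ k, 0 ≤ e k)
    {z : Fin n → ℂ} (hz : ‖z‖ ≤ R) : polyWeight ε e z ≤ ∏ k, (ε₀ ^ 2 + R ^ 2) ^ e k := by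
  refine Finset.prod_le_prod (fun k _ => by positivity) fun k _ => ?_
  have := (norm_le_pi_norm z k).trans hz
  exact Real.rpow_le_rpow (by positivity) (by gcongr) (he k)

theorem polyWeight_single (ε : ℝ) (k : Fin n) (a : ℝ) (z : Fin n → ℂ) :
    polyWeight ε (Pi.single k a) z = (ε ^ 2 + ‖z k‖ ^ 2) ^ a := by
  unfold polyWeight
  rw [Finset.prod_eq_single k]
  · simp
  · intro l _ hl
    simp [hl]
  · simp

theorem gradExponent_eq_add (Q b : Fin n → ℝ) (k : Fin n) :
    gradExponent Q b k = (fun l => Q l / 2 - b l) + Pi.single k (b k / 2) := by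
  ext l
  by_cases hl : l = k
  · subst hl; simp [gradExponent]
  · simp [gradExponent, hl]

end PolyWeight

/-! ### The local Sobolev inequality -/

section LocalSobolev

variable {n : ℕ} {X : Type*} [TopologicalSpace X] [ChartedSpace (Fin n → ℂ) X]
  {I J : Type*} [Fintype I] [Fintype J]
  {E : I → SmoothPrimeDivisor n X} {B : J → SmoothPrimeDivisor n X}

theorem chartExponent_sum_elim (c : AdaptedChart (Sum.elim E B)) (a : ℝ) (q : I → ℝ) (b : J → ℝ)
    (k : Fin n) :
    chartExponent c (Sum.elim (fun α => a * q α) fun β => -b β) k =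
      a * chartExponent c (Sum.elim q 0) k - chartExponent c (Sum.elim 0 b) k := by
  have : (Sum.elim (fun α => a * q α) fun β => -b β) =
      a • (Sum.elim q 0 : I ⊕ J → ℝ) + (-1 : ℝ) • (Sum.elim 0 b : I ⊕ J → ℝ) := by
    ext i
    rcases i with i | i <;> simp
  rw [this, chartExponent_add, chartExponent_smul, chartExponent_smul]
  ring

theorem chartExponent_elim_nonneg (c : AdaptedChart (Sum.elim E B)) {q : I → ℝ} {b : J → ℝ}
    (hq : ∀ α, 0 ≤ q α) (hb : ∀ β, 0 ≤ b β) (k : Fin n) :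
    0 ≤ chartExponent c (Sum.elim q b) k :=
  chartExponent_nonneg c (by rintro (i | i); exacts [hq i, hb i]) k

theorem chartExponent_elim_zero_lt_one (c : AdaptedChart (Sum.elim E B)) {b : J → ℝ}
    (hb : ∀ β, b β < 1) (k : Fin n) : chartExponent c (Sum.elim 0 b) k < 1 :=
  chartExponent_lt_one c (by rintro (i | i); exacts [one_pos, hb i]) k

variable [IsManifold 𝓘(ℝ, Fin n → ℂ) ω X] [MeasurableSpace X] [BorelSpace X]

omit [IsManifold 𝓘(ℝ, Fin n → ℂ) ω X] in
/-- The gradient terms of a function which is cut off in an adapted chart are controlled by the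
gradient for the conic metric and the function itself. The constant depends on the cutoff function,
but not on `ε`. -/
theorem lintegral_complexGrad_bump_le {G : BilinField n X} (c : AdaptedChart (Sum.elim E B))
    (hc : c.chart ∈ realAtlas n X)
    (h : ∀ i, DivisorHermitianMetric (Sum.elim E B i)) {b : J → ℝ} (hb : ∀ β, 0 ≤ b β) (q : I → ℝ)
    {ε₀ A : ℝ} (hA : 0 < A) {g : ℝ → BilinField n X} {V : Set X}
    (hV : ∀ ε, 0 ≤ ε → ε ≤ ε₀ → ∀ x ∈ V, (ε = 0 → x ∉ ⋃ β, (B β).support) →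
      ∀ v : TangentSpace 𝓘(ℝ, Fin n → ℂ) x, g ε x v v ≤ A * modelConicNormSq c b ε x v)
    {U : Set (Fin n → ℂ)} (hUt : U ⊆ c.chart.target) (hUV : U ⊆ c.chart.symm ⁻¹' V)
    {K : ℝ≥0∞} (hK : K ≠ ⊤)
    (hcomp : ∀ S ⊆ U, MeasurableSet S → ∀ ε, 0 ≤ ε → ε ≤ ε₀ → ∀ F : X → ℝ≥0∞, Measurable F →
      ∫⁻ z in S, F (c.chart.symm z) * ENNReal.ofReal (polyWeight ε
          (chartExponent c (Sum.elim (fun α => 1 / 2 * q α) fun β => -b β)) z) ≤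
        K * ∫⁻ x in c.chart.source ∩ c.chart ⁻¹' S, F x * ENNReal.ofReal
          (divisorWeight h (Sum.elim (fun α => 1 / 2 * q α) fun β => -b β) ε x) ∂G.volumeMeasure)
    {z₀ : Fin n → ℂ} (χ : ContDiffBump z₀) (hχ : Metric.closedBall z₀ χ.rOut ⊆ U) (k : Fin n) :
    ∃ C : ℝ≥0∞, C ≠ ⊤ ∧ ∀ ε, 0 ≤ ε → ε ≤ ε₀ → ∀ u : X → ℂ,
      ContMDiff 𝓘(ℝ, Fin n → ℂ) 𝓘(ℝ, ℂ) 1 u →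
      ∫⁻ z, complexGrad (fun z => χ z • (u ∘ c.chart.symm) z) k z * ENNReal.ofReal
          (polyWeight ε (gradExponent (chartExponent c (Sum.elim q 0))
            (chartExponent c (Sum.elim 0 b)) k) z) ≤
        C * (∫⁻ x, (g ε).gradNorm u x * ENNReal.ofReal
            (divisorWeight h (Sum.elim (fun α => 1 / 2 * q α) fun β => -b β) ε x) ∂G.volumeMeasure
          + ∫⁻ x, ‖u x‖ₑ * ENNReal.ofReal
            (divisorWeight h (Sum.elim (fun α => 1 / 2 * q α) fun β => -b β) ε x)
              ∂G.volumeMeasure) := by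
  obtain ⟨L, hL0, hL⟩ := exists_norm_fderiv_bump_le χ
  set r' : I ⊕ J → ℝ := Sum.elim (fun α => 1 / 2 * q α) fun β => -b β with hr'
  set e := chartExponent c (Sum.elim 0 b) k / 2 with he
  have he0 : 0 ≤ e := div_nonneg (chartExponent_elim_nonneg c (fun _ => le_rfl) hb k) two_pos.le
  set R := ‖z₀‖ + χ.rOut with hR
  set M := ENNReal.ofReal ((ε₀ ^ 2 + R ^ 2) ^ e) with hM
  set a : ℝ≥0∞ := 2 * ENNReal.ofReal L * M with ha
  set d : ℝ≥0∞ := 2 * ENNReal.ofReal (√A) with hd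
  have hatop : a ≠ ⊤ := by finiteness
  have hdtop : d ≠ ⊤ := by finiteness
  refine ⟨K * (a + d), by finiteness, fun ε hε hεε₀ u hu => ?_⟩
  set v : (Fin n → ℂ) → ℂ := u ∘ c.chart.symm with hv
  have hvc : ContDiffOn ℝ 1 v c.chart.target := by
    rw [← contMDiffOn_iff_contDiffOn]
    exact hu.comp_contMDiffOn ((contMDiffOn_symm_of_mem_maximalAtlas hc).of_le (by simp))
  set f : (Fin n → ℂ) → ℂ := fun z => χ z • v z with hf
  set S : Set (Fin n → ℂ) := Metric.closedBall z₀ χ.rOut ∩ {z | ∀ k, z k ≠ 0} with hS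
  have hSm : MeasurableSet S :=
    measurableSet_closedBall.inter measurableSet_forall_coord_ne_zero
  have hSU : S ⊆ U := inter_subset_left.trans hχ
  set H : (Fin n → ℂ) → ℝ≥0∞ := fun z =>
    complexGrad f k z * ENNReal.ofReal ((ε ^ 2 + ‖z k‖ ^ 2) ^ e) with hH
  have hHm : Measurable H := by
    refine (measurable_complexGrad f k).mul (Measurable.ennreal_ofReal ?_)
    exact (Continuous.measurable (by fun_prop)).pow_const _
  set F : X → ℝ≥0∞ := c.chart.source.indicator (S.indicator H ∘ c.chart) with hF
  have hFm : Measurable F := measurable_indicator_comp_chart c.chart (hHm.indicator hSm)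
  have hexp : (fun l => chartExponent c (Sum.elim q 0) l / 2 - chartExponent c (Sum.elim 0 b) l) =
      chartExponent c r' := by
    ext l
    rw [hr', chartExponent_sum_elim]
    ring
  -- The derivatives of `f`, transferred to `X`.
  have hFle : ∀ x, F x ≤ a * ‖u x‖ₑ + d * (g ε).gradNorm u x := by
    intro x
    by_cases hx : x ∈ c.chart.source
    swap
    · simp [hF, hx]
    by_cases hxS : c.chart x ∈ S
    swap
    · simp [hF, hx, hxS]
    have hFx : F x = H (c.chart x) := by simp [hF, hx, hxS]
    rw [hFx]
    set z := c.chart x with hz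
    have hzt : z ∈ c.chart.target := c.chart.map_source hx
    have hzx : c.chart.symm z = x := c.chart.left_inv hx
    have hxV : x ∈ V := by rw [← hzx]; exact hUV (hSU hxS)
    have hxB : ε = 0 → x ∉ ⋃ β, (B β).support := by
      intro _ hmem
      obtain ⟨β, hβ⟩ := mem_iUnion.1 hmem
      exact hxS.2 _ ((c.mem_iff (Sum.inr β) ⟨x, hβ, hx⟩ x hx).1 hβ)
    have hgv := hV ε hε hεε₀ x hxV hxB
    have hcg := complexGrad_bump_smul_le c.chart.open_target hvc χ hL k hzt
    have hgrad : ∀ j : Fin 2, ENNReal.ofReal ((ε ^ 2 + ‖z k‖ ^ 2) ^ e) *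
        ‖fderiv ℝ v z (realFrame (k, j))‖ₑ ≤ ENNReal.ofReal (√A) * (g ε).gradNorm u x := by
      intro j
      have := rpow_mul_enorm_fderiv_le_gradNorm c hc b (g := g ε) (ε := ε) hA hzt hxS.2
        (by rw [hzx]; exact hgv) (u := u)
        ((hu _).mdifferentiableAt one_ne_zero) k j
      rwa [hzx] at this
    have hMle : ENNReal.ofReal ((ε ^ 2 + ‖z k‖ ^ 2) ^ e) ≤ M := by
      refine ENNReal.ofReal_le_ofReal (Real.rpow_le_rpow (by positivity) ?_ he0)
      have h1 : ‖z k‖ ≤ R := (norm_le_pi_norm z k).trans (by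
        have := hxS.1
        rw [mem_closedBall_iff_norm] at this
        calc ‖z‖ = ‖z₀ + (z - z₀)‖ := by simp
          _ ≤ R := (norm_add_le _ _).trans (add_le_add le_rfl this))
      gcongr
    have hvz : v z = u x := by rw [hv, Function.comp_apply, hzx]
    calc H z ≤ (∑ j : Fin 2, (ENNReal.ofReal L * ‖v z‖ₑ + ‖fderiv ℝ v z (realFrame (k, j))‖ₑ)) *
          ENNReal.ofReal ((ε ^ 2 + ‖z k‖ ^ 2) ^ e) := by
          exact mul_le_mul_left hcg _
      _ = ∑ j : Fin 2, (ENNReal.ofReal L * ENNReal.ofReal ((ε ^ 2 + ‖z k‖ ^ 2) ^ e) * ‖u x‖ₑ +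
          ENNReal.ofReal ((ε ^ 2 + ‖z k‖ ^ 2) ^ e) * ‖fderiv ℝ v z (realFrame (k, j))‖ₑ) := by
          rw [Finset.sum_mul, hvz]
          refine Finset.sum_congr rfl fun j _ => ?_
          ring
      _ ≤ ∑ _j : Fin 2, (ENNReal.ofReal L * M * ‖u x‖ₑ +
          ENNReal.ofReal (√A) * (g ε).gradNorm u x) := by
          refine Finset.sum_le_sum fun j _ => add_le_add ?_ (hgrad j)
          exact mul_le_mul_left (mul_le_mul_right hMle _) _
      _ = _ := by
          rw [Finset.sum_const, ha, hd]
          simp only [Finset.card_univ, Fintype.card_fin, nsmul_eq_mul, Nat.cast_ofNat]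
          ring
  have hum : Measurable fun x => ‖u x‖ₑ := hu.continuous.measurable.enorm
  have hwm : Measurable fun x => ENNReal.ofReal (divisorWeight h r' ε x) :=
    (measurable_divisorWeight h r' ε).ennreal_ofReal
  calc ∫⁻ z, complexGrad f k z * ENNReal.ofReal (polyWeight ε (gradExponent
          (chartExponent c (Sum.elim q 0)) (chartExponent c (Sum.elim 0 b)) k) z)
      ≤ ∫⁻ z in S, F (c.chart.symm z) *
          ENNReal.ofReal (polyWeight ε (chartExponent c r') z) := by
        rw [← lintegral_indicator hSm]
        refine lintegral_mono_ae ?_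
        filter_upwards [ae_forall_coord_ne_zero] with z hz0
        by_cases hz : z ∈ Metric.closedBall z₀ χ.rOut
        · have hzS : z ∈ S := ⟨hz, hz0⟩
          have hzt := hUt (hχ hz)
          rw [indicator_of_mem hzS]
          have hFz : F (c.chart.symm z) = H z := by
            simp [hF, c.chart.map_target hzt, c.chart.right_inv hzt, hzS]
          rw [hFz, gradExponent_eq_add, polyWeight_add ε _ _ hz0, polyWeight_single, hexp,
            mul_comm (polyWeight _ _ _), ENNReal.ofReal_mul (by positivity), ← mul_assoc]
        · rw [complexGrad_bump_smul_eq_zero v χ k hz, zero_mul]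
          exact zero_le
    _ ≤ K * ∫⁻ x in c.chart.source ∩ c.chart ⁻¹' S, F x *
          ENNReal.ofReal (divisorWeight h r' ε x) ∂G.volumeMeasure :=
        hcomp S hSU hSm ε hε hεε₀ F hFm
    _ ≤ K * ∫⁻ x, (a * (‖u x‖ₑ * ENNReal.ofReal (divisorWeight h r' ε x)) +
          d * ((g ε).gradNorm u x * ENNReal.ofReal (divisorWeight h r' ε x)))
            ∂G.volumeMeasure := by
        refine mul_le_mul_right
          ((setLIntegral_le_lintegral _ _).trans (lintegral_mono fun x => ?_)) _
        calc F x * ENNReal.ofReal (divisorWeight h r' ε x)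
            ≤ (a * ‖u x‖ₑ + d * (g ε).gradNorm u x) * ENNReal.ofReal (divisorWeight h r' ε x) := by
              exact mul_le_mul_left (hFle x) _
          _ = _ := by ring
    _ = K * (a * ∫⁻ x, ‖u x‖ₑ * ENNReal.ofReal (divisorWeight h r' ε x) ∂G.volumeMeasure +
          d * ∫⁻ x, (g ε).gradNorm u x * ENNReal.ofReal (divisorWeight h r' ε x)
            ∂G.volumeMeasure) := by
        rw [lintegral_add_left (f := fun x => a * (‖u x‖ₑ * ENNReal.ofReal (divisorWeight h r' ε x)))
          ((hum.mul hwm).const_mul a), lintegral_const_mul' _ _ hatop,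
          lintegral_const_mul' _ _ hdtop]
    _ ≤ _ := by
        rw [mul_assoc K (a + d)]
        refine mul_le_mul_right ?_ K
        rw [mul_add, add_comm]
        exact add_le_add (mul_le_mul_left le_add_self _) (mul_le_mul_left le_self_add _)

/-- The Sobolev inequality for `p = 1`, near a point. -/
theorem exists_local_sobolev (hn : 1 ≤ n) {G : BilinField n X} (hG : G.IsSmoothMetricOn univ)
    (h : ∀ i, DivisorHermitianMetric (Sum.elim E B i)) {b : J → ℝ}
    (hb : ∀ β, 0 ≤ b β ∧ b β < 1) {q : I → ℝ} (hq : ∀ α, 0 ≤ q α) {ε₀ : ℝ}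
    {g : ℝ → BilinField n X} (hg : IsRegularizedConicMetric E B b ε₀ g) (x₀ : X) :
    ∃ W ∈ 𝓝 x₀, ∃ C : ℝ≥0∞, C ≠ ⊤ ∧ ∀ ε, 0 ≤ ε → ε ≤ ε₀ → ∀ u : X → ℂ,
      ContMDiff 𝓘(ℝ, Fin n → ℂ) 𝓘(ℝ, ℂ) 1 u →
      ∫⁻ x in W, ‖u x‖ₑ ^ (2 * n / (2 * n - 1) : ℝ) *
          ENNReal.ofReal (divisorWeight h (Sum.elim q fun β => -b β) ε x) ∂G.volumeMeasure ≤
        (C * (∫⁻ x, (g ε).gradNorm u x * ENNReal.ofReal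
            (divisorWeight h (Sum.elim (fun α => 1 / 2 * q α) fun β => -b β) ε x) ∂G.volumeMeasure
          + ∫⁻ x, ‖u x‖ₑ * ENNReal.ofReal
            (divisorWeight h (Sum.elim (fun α => 1 / 2 * q α) fun β => -b β) ε x)
              ∂G.volumeMeasure)) ^ (2 * n / (2 * n - 1) : ℝ) := by
  have hn' : (1 : ℝ) ≤ n := by exact_mod_cast hn
  have hn1 : (0 : ℝ) < 2 * n - 1 := by linarith
  have hm0 : (0 : ℝ) < 2 * n / (2 * n - 1) := by positivity
  obtain ⟨c, V, hVn, A, hVs, hA, hquasi⟩ := hg.quasiIsometric x₀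
  have hx₀ : x₀ ∈ c.chart.source := hVs (mem_of_mem_nhds hVn)
  have hc : c.chart ∈ realAtlas n X := mem_realAtlas c.mem_maximalAtlas
  set z₀ := c.chart x₀ with hz₀
  have hz₀t : z₀ ∈ c.chart.target := c.chart.map_source hx₀
  obtain ⟨U₁, hU₁, K₁, hK₁, hU₁t, hcomp₁⟩ :=
    exists_lintegral_comparable hG c h (Sum.elim q fun β => -b β) ε₀ hx₀
  obtain ⟨U₂, hU₂, K₂, hK₂, hU₂t, hcomp₂⟩ := exists_lintegral_comparable hG c h
    (Sum.elim (fun α => 1 / 2 * q α) fun β => -b β) ε₀ hx₀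
  have hU₃ : c.chart.symm ⁻¹' V ∈ 𝓝 z₀ :=
    (c.chart.symm.continuousAt hz₀t).preimage_mem_nhds (by
      rw [hz₀, c.chart.left_inv hx₀]; exact hVn)
  obtain ⟨R, hR, hRU⟩ := Metric.nhds_basis_closedBall.mem_iff.1
    (Filter.inter_mem hU₁ (Filter.inter_mem hU₂ hU₃))
  let χ : ContDiffBump z₀ := ⟨R / 2, R, half_pos hR, half_lt_self hR⟩
  set Q := chartExponent c (Sum.elim q 0) with hQ
  set bb := chartExponent c (Sum.elim 0 b) with hbb
  have hQ0 : ∀ k, 0 ≤ Q k := chartExponent_elim_nonneg c hq fun _ => le_rfl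
  have hbb1 : ∀ k, bb k < 1 := chartExponent_elim_zero_lt_one c fun β => (hb β).2
  obtain ⟨C₀, hC₀, hgns⟩ := lintegral_rpow_mul_polyWeight_le hn Q bb
    fun k => by linarith [hQ0 k, hbb1 k]
  have hgradk := lintegral_complexGrad_bump_le (G := G) (V := V) (U := U₂ ∩ c.chart.symm ⁻¹' V)
    c hc h (fun β => (hb β).1) q
    hA (fun ε hε hεε₀ x hx hxB v => (hquasi ε hε hεε₀ x hx hxB v).2)
    (inter_subset_left.trans hU₂t) inter_subset_right hK₂
    (fun S hS hSm ε hε hεε₀ F hF => (hcomp₂ S (hS.trans inter_subset_left) hSm ε hε hεε₀ F hF).2)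
    χ (hRU.trans inter_subset_right)
  choose C hC hgrad using hgradk
  -- The Gagliardo–Nirenberg–Sobolev inequality has the exponents `n Q / (2n - 1)` in place of `Q`.
  -- The former are smaller by `D`, so the weight is larger, up to a constant, on bounded sets.
  set D : Fin n → ℝ := fun k => Q k * (n - 1) / (2 * n - 1) with hD
  have hD0 : ∀ k, 0 ≤ D k := fun k =>
    div_nonneg (mul_nonneg (hQ0 k) (by linarith)) hn1.le
  set M := ENNReal.ofReal (∏ k, (ε₀ ^ 2 + (‖z₀‖ + R) ^ 2) ^ D k) with hM
  set m : ℝ := 2 * n / (2 * n - 1) with hm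
  set S := Metric.ball z₀ (R / 2) with hS
  have hSR : S ⊆ Metric.closedBall z₀ R :=
    (Metric.ball_subset_closedBall).trans (Metric.closedBall_subset_closedBall (by linarith))
  have hSU : S ⊆ U₁ := hSR.trans (hRU.trans inter_subset_left)
  have hSm : MeasurableSet S := measurableSet_ball
  refine ⟨c.chart.source ∩ c.chart ⁻¹' S, ?_, (K₁ * M) ^ (1 / m) * (C₀ * ∑ k, C k), ?_,
    fun ε hε hεε₀ u hu => ?_⟩
  · exact Filter.inter_mem (c.chart.open_source.mem_nhds hx₀)
      ((c.chart.continuousAt hx₀).preimage_mem_nhds (Metric.ball_mem_nhds _ (half_pos hR)))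
  · refine ENNReal.mul_ne_top (ENNReal.rpow_ne_top_of_nonneg (by positivity) (by finiteness)) ?_
    exact ENNReal.mul_ne_top hC₀ (ENNReal.sum_ne_top.2 fun k _ => hC k)
  set v : (Fin n → ℂ) → ℂ := u ∘ c.chart.symm with hv
  have hvc : ContDiffOn ℝ 1 v c.chart.target := by
    rw [← contMDiffOn_iff_contDiffOn]
    exact hu.comp_contMDiffOn ((contMDiffOn_symm_of_mem_maximalAtlas hc).of_le (by simp))
  have hχt : Metric.closedBall z₀ χ.rOut ⊆ c.chart.target :=
    hRU.trans (inter_subset_left.trans hU₁t)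
  have hfc := contDiff_bump_smul c.chart.open_target hvc χ hχt
  have hfs := hasCompactSupport_bump_smul v χ
  set f : (Fin n → ℂ) → ℂ := fun z => χ z • v z with hf
  set Y := ∫⁻ x, (g ε).gradNorm u x * ENNReal.ofReal
      (divisorWeight h (Sum.elim (fun α => 1 / 2 * q α) fun β => -b β) ε x) ∂G.volumeMeasure
    + ∫⁻ x, ‖u x‖ₑ * ENNReal.ofReal
      (divisorWeight h (Sum.elim (fun α => 1 / 2 * q α) fun β => -b β) ε x) ∂G.volumeMeasure with hY
  have hum : Measurable fun x => ‖u x‖ₑ ^ m := hu.continuous.measurable.enorm.pow_const _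
  have hexp : chartExponent c (Sum.elim q fun β => -b β) =
      (fun k => n * Q k / (2 * n - 1) - bb k) + D := by
    ext k
    have h1 := chartExponent_sum_elim c 1 q b k
    simp only [one_mul] at h1
    rw [h1, Pi.add_apply, ← hQ, ← hbb, hD]
    linear_combination (-(Q k)) * mul_inv_cancel₀ hn1.ne'
  calc ∫⁻ x in c.chart.source ∩ c.chart ⁻¹' S, ‖u x‖ₑ ^ m *
          ENNReal.ofReal (divisorWeight h (Sum.elim q fun β => -b β) ε x) ∂G.volumeMeasure
      ≤ K₁ * ∫⁻ z in S, ‖u (c.chart.symm z)‖ₑ ^ m * ENNReal.ofReal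
          (polyWeight ε (chartExponent c (Sum.elim q fun β => -b β)) z) :=
        (hcomp₁ S hSU hSm ε hε hεε₀ (fun x => ‖u x‖ₑ ^ m) hum).1
    _ ≤ K₁ * ∫⁻ z in S, M * (‖f z‖ₑ ^ m * ENNReal.ofReal
          (polyWeight ε (fun k => n * Q k / (2 * n - 1) - bb k) z)) := by
        refine mul_le_mul_right (lintegral_mono_ae ?_) _
        filter_upwards [ae_restrict_mem hSm, ae_restrict_of_ae ae_forall_coord_ne_zero]
          with z hz hz0
        have hfz : f z = u (c.chart.symm z) := by
          simp only [hf]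
          rw [χ.one_of_mem_closedBall (Metric.ball_subset_closedBall hz), one_smul, hv,
            Function.comp_apply]
        have hzR : ‖z‖ ≤ ‖z₀‖ + R := by
          have := hSR hz
          rw [mem_closedBall_iff_norm] at this
          calc ‖z‖ = ‖z₀ + (z - z₀)‖ := by simp
            _ ≤ _ := (norm_add_le _ _).trans (by gcongr)
        rw [hfz, hexp, polyWeight_add ε _ _ hz0, ENNReal.ofReal_mul (polyWeight_nonneg _ _ _)]
        have hle : ENNReal.ofReal (polyWeight ε D z) ≤ M :=
          ENNReal.ofReal_le_ofReal (polyWeight_le hε hεε₀ hD0 hzR)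
        rw [← mul_assoc, mul_comm]
        gcongr
    _ ≤ K₁ * (M * ∫⁻ z, ‖f z‖ₑ ^ m * ENNReal.ofReal
          (polyWeight ε (fun k => n * Q k / (2 * n - 1) - bb k) z)) := by
        refine mul_le_mul_right ?_ _
        rw [lintegral_const_mul' _ _ ENNReal.ofReal_ne_top]
        exact mul_le_mul_right (setLIntegral_le_lintegral _ _) _
    _ ≤ K₁ * (M * (C₀ * ∑ k, C k * Y) ^ m) := by
        refine mul_le_mul_right (mul_le_mul_right ((hgns ε f hfc hfs).trans ?_) _) _
        refine ENNReal.rpow_le_rpow ?_ hm0.le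
        gcongr with k _
        exact hgrad k ε hε hεε₀ u hu
    _ = _ := by
        rw [← Finset.sum_mul, ← mul_assoc C₀, mul_assoc ((K₁ * M) ^ (1 / m)),
          ENNReal.mul_rpow_of_nonneg ((K₁ * M) ^ (1 / m)) _ hm0.le, ← ENNReal.rpow_mul,
          one_div_mul_cancel hm0.ne', ENNReal.rpow_one, ← mul_assoc]

end LocalSobolev

/-! ### Hölder's inequality -/

section Holder

/-- Hölder's inequality in which the second factor need not be measurable. -/
theorem lintegral_mul_le_Lp_mul_Lq_of_measurable_left {α : Type*} [MeasurableSpace α]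
    (μ : Measure α) {p q : ℝ} (hpq : p.HolderConjugate q) {a : α → ℝ≥0∞} (ha : Measurable a)
    (ha' : ∀ x, a x ≠ ⊤) (G : α → ℝ≥0∞) :
    ∫⁻ x, a x * G x ∂μ ≤ (∫⁻ x, a x ^ p ∂μ) ^ (1 / p) * (∫⁻ x, G x ^ q ∂μ) ^ (1 / q) := by
  -- Replace `G` by the measurable function `F / a ≤ G`, which gives the same integral.
  obtain ⟨F, hF, hFle, hFeq⟩ := exists_measurable_le_lintegral_eq μ fun x => a x * G x
  have hle : ∀ x, F x / a x ≤ G x := fun x => ENNReal.div_le_of_le_mul' (hFle x)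
  calc ∫⁻ x, a x * G x ∂μ = ∫⁻ x, F x ∂μ := hFeq
    _ ≤ ∫⁻ x, (a * fun x => F x / a x) x ∂μ := by
        refine lintegral_mono fun x => ?_
        rcases eq_or_ne (a x) 0 with h0 | h0
        · have := hFle x
          simp only [h0, zero_mul] at this
          exact this.trans zero_le
        · exact (ENNReal.mul_div_cancel h0 (ha' x)).ge
    _ ≤ (∫⁻ x, a x ^ p ∂μ) ^ (1 / p) * (∫⁻ x, (F x / a x) ^ q ∂μ) ^ (1 / q) :=
        ENNReal.lintegral_mul_le_Lp_mul_Lq μ hpq ha.aemeasurable (hF.div ha).aemeasurable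
    _ ≤ _ := by
        have := hpq.symm.pos
        refine mul_le_mul_right (ENNReal.rpow_le_rpow (lintegral_mono fun x => ?_) (by positivity)) _
        exact ENNReal.rpow_le_rpow (hle x) this.le

theorem ENNReal.rpow_sub_le_of_rpow_le_rpow_mul {S T : ℝ≥0∞} (hS : S ≠ ⊤) {a b : ℝ} (hab : b < a)
    (h : S ^ a ≤ S ^ b * T) : S ^ (a - b) ≤ T := by
  rcases eq_or_ne S 0 with rfl | h0
  · rw [ENNReal.zero_rpow_of_pos (sub_pos.2 hab)]
    exact zero_le
  · rw [ENNReal.rpow_sub _ _ h0 hS]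
    exact ENNReal.div_le_of_le_mul' h

theorem ENNReal.rpow_add_rpow_le_two_mul (a b : ℝ≥0∞) {s : ℝ} (hs : 0 ≤ s) :
    a ^ s + b ^ s ≤ 2 * (a + b) ^ s := by
  rw [two_mul]
  exact add_le_add (ENNReal.rpow_le_rpow le_self_add hs) (ENNReal.rpow_le_rpow le_add_self hs)

end Holder

/-! ### The gradient of a power -/

section GradPower

variable {n : ℕ} {X : Type*} [TopologicalSpace X] [ChartedSpace (Fin n → ℂ) X]

theorem contDiff_ofReal_norm_rpow {γ : ℝ} (hγ : 1 < γ) :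
    ContDiff ℝ 1 fun w : ℂ => ((‖w‖ ^ γ : ℝ) : ℂ) :=
  Complex.ofRealCLM.contDiff.comp (contDiff_norm_rpow hγ)

theorem enorm_ofReal_norm_rpow {γ : ℝ} (hγ : 0 ≤ γ) (w : ℂ) :
    ‖((‖w‖ ^ γ : ℝ) : ℂ)‖ₑ = ‖w‖ₑ ^ γ := by
  rw [← ofReal_norm, Complex.norm_real, Real.norm_of_nonneg (by positivity),
    ← ENNReal.ofReal_rpow_of_nonneg (norm_nonneg _) hγ, ofReal_norm]

/-- The chain rule for the gradient of `|f| ^ γ`. -/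
theorem gradNorm_norm_rpow_le (g : BilinField n X) {f : X → ℂ} {x : X}
    (hf : MDifferentiableAt 𝓘(ℝ, Fin n → ℂ) 𝓘(ℝ, ℂ) f x) {γ : ℝ} (hγ : 1 < γ) :
    g.gradNorm (fun y => ((‖f y‖ ^ γ : ℝ) : ℂ)) x ≤
      ENNReal.ofReal γ * ‖f x‖ₑ ^ (γ - 1) * g.gradNorm f x := by
  refine iSup₂_le fun v hv => ?_
  set N : ℂ → ℂ := fun w => ((‖w‖ ^ γ : ℝ) : ℂ) with hN
  have hNd : HasFDerivAt N (Complex.ofRealCLM ∘L fderiv ℝ (fun w : ℂ => ‖w‖ ^ γ) (f x)) (f x) :=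
    Complex.ofRealCLM.hasFDerivAt.comp (f x)
      ((differentiable_norm_rpow hγ) (f x)).hasFDerivAt
  have hcomp := mfderiv_comp (I := 𝓘(ℝ, Fin n → ℂ)) (I' := 𝓘(ℝ, ℂ)) (I'' := 𝓘(ℝ, ℂ)) x
    hNd.differentiableAt.mdifferentiableAt hf
  have hcomp' : mfderiv 𝓘(ℝ, Fin n → ℂ) 𝓘(ℝ, ℂ) (fun y => ((‖f y‖ ^ γ : ℝ) : ℂ)) x =
      mfderiv 𝓘(ℝ, Fin n → ℂ) 𝓘(ℝ, ℂ) (N ∘ f) x := rfl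
  rw [hcomp', hcomp, mfderiv_eq_fderiv, hNd.fderiv]
  set w : ℂ := mfderiv 𝓘(ℝ, Fin n → ℂ) 𝓘(ℝ, ℂ) f x v with hw
  have h1 : ‖fderiv ℝ (fun w : ℂ => ‖w‖ ^ γ) (f x) w‖ₑ ≤
      ENNReal.ofReal γ * ‖f x‖ₑ ^ (γ - 1) * ‖w‖ₑ := by
    have h2 := (fderiv ℝ (fun w : ℂ => ‖w‖ ^ γ) (f x)).le_of_opNorm_le
      (norm_fderiv_norm_id_rpow (f x) hγ).le w
    rw [← ofReal_norm, ← ofReal_norm, ← ofReal_norm,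
      ENNReal.ofReal_rpow_of_nonneg (norm_nonneg _) (by linarith),
      ← ENNReal.ofReal_mul (by linarith), ← ENNReal.ofReal_mul (by positivity)]
    exact ENNReal.ofReal_le_ofReal h2
  have h3 : ‖w‖ₑ ≤ g.gradNorm f x := le_iSup₂_of_le v hv le_rfl
  refine le_trans (le_of_eq ?_) (h1.trans (mul_le_mul_right h3 _))
  change ‖((fderiv ℝ (fun w : ℂ => ‖w‖ ^ γ) (f x) w : ℝ) : ℂ)‖ₑ = _
  rw [← ofReal_norm, Complex.norm_real, ofReal_norm]

end GradPower

/-! ### The Sobolev inequality for `p = 1`, and finiteness of the measures -/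

section Global

variable {n : ℕ} {X : Type*} [TopologicalSpace X] [ChartedSpace (Fin n → ℂ) X]
  {I J : Type*} [Fintype I] [Fintype J]
  {E : I → SmoothPrimeDivisor n X} {B : J → SmoothPrimeDivisor n X}

/-- The hypothesis `hr` excludes that powers of `0` cancel, as in `0 ^ r * 0 ^ (-r) ≠ 0 ^ 0`. -/
theorem divisorWeight_rpow_mul_rpow {ι : Type*} [Fintype ι] {D : ι → SmoothPrimeDivisor n X}
    (h : ∀ i, DivisorHermitianMetric (D i)) (r r' : ι → ℝ) {s t : ℝ}
    (hr : ∀ i, r i * s + r' i * t = 0 → r i * s = 0 ∧ r' i * t = 0) (ε : ℝ) (x : X) :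
    divisorWeight h (fun i => r i * s + r' i * t) ε x =
      divisorWeight h r ε x ^ s * divisorWeight h r' ε x ^ t := by
  have h0 : ∀ i, 0 ≤ ε ^ 2 + (h i).sectionNormSq x := fun i =>
    add_nonneg (sq_nonneg _) ((h i).sectionNormSq_nonneg x)
  unfold divisorWeight
  rw [← Real.finsetProd_rpow _ _ fun i _ => Real.rpow_nonneg (h0 i) _,
    ← Real.finsetProd_rpow _ _ fun i _ => Real.rpow_nonneg (h0 i) _, ← Finset.prod_mul_distrib]
  refine Finset.prod_congr rfl fun i _ => ?_
  rw [← Real.rpow_mul (h0 i), ← Real.rpow_mul (h0 i)]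
  by_cases hi : r i * s + r' i * t = 0
  · simp only [(hr i hi).1, (hr i hi).2, add_zero, Real.rpow_zero, mul_one]
  · exact Real.rpow_add' (h0 i) hi

/-- The Hermitian metrics on the members of two families of divisors, as one family. -/
def hermitianSumElim (hE : ∀ α, DivisorHermitianMetric (E α))
    (hB : ∀ β, DivisorHermitianMetric (B β)) :
    ∀ i, DivisorHermitianMetric (Sum.elim E B i)
  | .inl α => hE α
  | .inr β => hB β

/-- `F` need not be measurable, which matters since the measurability of `gradNorm` is not
known. -/
theorem lintegral_weightedMeasure [MeasurableSpace X] [BorelSpace X] (κ : KahlerMetric n X)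
    (hE : ∀ α, DivisorHermitianMetric (E α)) (hB : ∀ β, DivisorHermitianMetric (B β))
    (b : J → ℝ) (q : I → ℝ) (ε : ℝ) (F : X → ℝ≥0∞) :
    ∫⁻ x, F x ∂weightedMeasure κ hE hB b q ε = ∫⁻ x, F x * ENNReal.ofReal
      (divisorWeight (hermitianSumElim hE hB) (Sum.elim q fun β => -b β) ε x)
        ∂κ.metric.volumeMeasure := by
  have hd : ∀ x, (∏ α, (ε ^ 2 + (hE α).sectionNormSq x) ^ q α) /
      ∏ β, (ε ^ 2 + (hB β).sectionNormSq x) ^ b β =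
      divisorWeight (hermitianSumElim hE hB) (Sum.elim q fun β => -b β) ε x := by
    intro x
    rw [divisorWeight, Fintype.prod_sum_type, div_eq_mul_inv, ← Finset.prod_inv_distrib]
    congr 1
    refine Finset.prod_congr rfl fun β _ => ?_
    exact (Real.rpow_neg (add_nonneg (sq_nonneg _) ((hB β).sectionNormSq_nonneg x)) _).symm
  rw [weightedMeasure]
  simp_rw [hd]
  rw [lintegral_withDensity_eq_lintegral_mul_non_measurable _
    (measurable_divisorWeight _ _ ε).ennreal_ofReal (by simp)]
  exact lintegral_congr fun x => mul_comm _ _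

variable [IsManifold 𝓘(ℝ, Fin n → ℂ) ω X] [MeasurableSpace X] [BorelSpace X] [CompactSpace X]

/-- The Sobolev inequality for `p = 1`. -/
theorem exists_lintegral_rpow_le_gradNorm (hn : 1 ≤ n) {G : BilinField n X}
    (hG : G.IsSmoothMetricOn univ)
    (h : ∀ i, DivisorHermitianMetric (Sum.elim E B i)) {b : J → ℝ}
    (hb : ∀ β, 0 ≤ b β ∧ b β < 1) {q : I → ℝ} (hq : ∀ α, 0 ≤ q α) {ε₀ : ℝ}
    {g : ℝ → BilinField n X} (hg : IsRegularizedConicMetric E B b ε₀ g) :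
    ∃ C : ℝ≥0∞, C ≠ ⊤ ∧ ∀ ε, 0 ≤ ε → ε ≤ ε₀ → ∀ u : X → ℂ,
      ContMDiff 𝓘(ℝ, Fin n → ℂ) 𝓘(ℝ, ℂ) 1 u →
      (∫⁻ x, ‖u x‖ₑ ^ (2 * n / (2 * n - 1) : ℝ) * ENNReal.ofReal
          (divisorWeight h (Sum.elim q fun β => -b β) ε x) ∂G.volumeMeasure) ^
            ((2 * n - 1) / (2 * n) : ℝ) ≤
        C * (∫⁻ x, (g ε).gradNorm u x * ENNReal.ofReal
            (divisorWeight h (Sum.elim (fun α => 1 / 2 * q α) fun β => -b β) ε x) ∂G.volumeMeasure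
          + ∫⁻ x, ‖u x‖ₑ * ENNReal.ofReal
            (divisorWeight h (Sum.elim (fun α => 1 / 2 * q α) fun β => -b β) ε x)
              ∂G.volumeMeasure) := by
  have hn' : (1 : ℝ) ≤ n := by exact_mod_cast hn
  have hn1 : (0 : ℝ) < 2 * n - 1 := by linarith
  choose W hW C hC hloc using exists_local_sobolev hn hG h hb hq hg
  obtain ⟨t, ht⟩ := CompactSpace.elim_nhds_subcover W hW
  set m : ℝ := 2 * n / (2 * n - 1) with hm
  have hm0 : 0 < m := by positivity
  have hminv : ((2 * n - 1) / (2 * n) : ℝ) = m⁻¹ := by rw [hm, inv_div]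
  refine ⟨(∑ x : t, C x ^ m) ^ m⁻¹, ENNReal.rpow_ne_top_of_nonneg (by positivity)
    (ENNReal.sum_ne_top.2 fun x _ => ENNReal.rpow_ne_top_of_nonneg hm0.le (hC x)),
    fun ε hε hεε₀ u hu => ?_⟩
  rw [hminv, ENNReal.rpow_inv_le_iff hm0, ENNReal.mul_rpow_of_nonneg _ _ hm0.le,
    ENNReal.rpow_inv_rpow hm0.ne']
  have hcov : (⋃ x : t, W x) = univ := by
    rw [← top_eq_univ, ← ht]
    exact iUnion_subtype (· ∈ t) _
  rw [← setLIntegral_univ, ← hcov]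
  refine (lintegral_iUnion_le _ _).trans ?_
  rw [tsum_fintype, Finset.sum_mul]
  refine Finset.sum_le_sum fun x _ => ?_
  rw [← ENNReal.mul_rpow_of_nonneg _ _ hm0.le]
  exact hloc x ε hε hεε₀ u hu

/-- The weighted measure is finite, the exponents in an adapted chart being larger than `-1`. -/
theorem lintegral_divisorWeight_lt_top {G : BilinField n X}
    (hG : G.IsSmoothMetricOn univ) (hsnc : IsSNC (Sum.elim E B))
    (h : ∀ i, DivisorHermitianMetric (Sum.elim E B i)) {b : J → ℝ}
    (hb : ∀ β, b β < 1) {q : I → ℝ} (hq : ∀ α, 0 ≤ q α) {ε : ℝ} (hε : 0 ≤ ε) :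
    ∫⁻ x, ENNReal.ofReal (divisorWeight h (Sum.elim q fun β => -b β) ε x) ∂G.volumeMeasure < ⊤ := by
  have hloc : ∀ x₀ : X, ∃ W ∈ 𝓝 x₀, ∫⁻ x in W, ENNReal.ofReal
      (divisorWeight h (Sum.elim q fun β => -b β) ε x) ∂G.volumeMeasure < ⊤ := by
    intro x₀
    obtain ⟨c, hx₀⟩ := hsnc x₀
    obtain ⟨U, hU, K, hK, -, hcomp⟩ :=
      exists_lintegral_comparable hG c h (Sum.elim q fun β => -b β) ε hx₀
    obtain ⟨R, hR, hRU⟩ := Metric.nhds_basis_ball.mem_iff.1 hU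
    have hexp : ∀ k, -1 < chartExponent c (Sum.elim q fun β => -b β) k := by
      intro k
      have h1 := chartExponent_sum_elim c 1 q b k
      simp only [one_mul] at h1
      have h2 := chartExponent_elim_nonneg c (b := 0) hq (fun _ => le_rfl) k
      have h3 := chartExponent_elim_zero_lt_one c hb k
      rw [h1]
      linarith
    refine ⟨c.chart.source ∩ c.chart ⁻¹' Metric.ball (c.chart x₀) R,
      Filter.inter_mem (c.chart.open_source.mem_nhds hx₀)
        ((c.chart.continuousAt hx₀).preimage_mem_nhds (Metric.ball_mem_nhds _ hR)), ?_⟩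
    have := (hcomp _ hRU measurableSet_ball ε hε le_rfl (fun _ => 1) measurable_const).1
    simp only [one_mul] at this
    refine this.trans_lt (ENNReal.mul_lt_top hK.lt_top ?_)
    refine (lintegral_mono_set ?_).trans_lt
      (setLIntegral_polyWeight_lt_top ε hexp (R + ‖c.chart x₀‖))
    refine Metric.ball_subset_closedBall.trans (Metric.closedBall_subset_closedBall' ?_)
    rw [dist_zero_right]
  choose W hW hfin using hloc
  obtain ⟨t, ht⟩ := CompactSpace.elim_nhds_subcover W hW
  have hcov : (⋃ x : t, W x) = univ := by
    rw [← top_eq_univ, ← ht]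
    exact iUnion_subtype (· ∈ t) _
  rw [← setLIntegral_univ, ← hcov]
  refine (lintegral_iUnion_le _ _).trans_lt ?_
  rw [tsum_fintype]
  exact ENNReal.sum_lt_top.2 fun x _ => hfin x

end Global

/-! ### From `p = 1` to all exponents -/

section Interpolation

variable {n : ℕ} {X : Type*} [TopologicalSpace X] [ChartedSpace (Fin n → ℂ) X]
  {I J : Type*} [Fintype I] [Fintype J]
  {E : I → SmoothPrimeDivisor n X} {B : J → SmoothPrimeDivisor n X}

/-- The weight for the exponent `1` is a product of powers of the weights on the two sides of the
inequality for the exponent `p`. -/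
theorem ofReal_divisorWeight_half_eq (h : ∀ i, DivisorHermitianMetric (Sum.elim E B i)) (b : J → ℝ)
    {q : I → ℝ} {p p' : ℝ} (hpp : p'.HolderConjugate p) (ε : ℝ) (x : X) :
    ENNReal.ofReal (divisorWeight h (Sum.elim (fun α => 1 / 2 * q α) fun β => -b β) ε x) =
      ENNReal.ofReal (divisorWeight h (Sum.elim q fun β => -b β) ε x) ^ (1 / p') *
      ENNReal.ofReal (divisorWeight h
        (Sum.elim (fun α => (1 - p / 2) * q α) fun β => -b β) ε x) ^ (1 / p) := by
  have hp0 := hpp.symm.pos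
  have hp'0 := hpp.pos
  have hsum : 1 / p' + 1 / p = 1 := by simpa using hpp.inv_add_inv_eq_one
  have hα : ∀ α, q α * (1 / p') + (1 - p / 2) * q α * (1 / p) = 1 / 2 * q α := by
    intro α
    linear_combination q α * hsum - (q α / 2) * mul_inv_cancel₀ hp0.ne'
  rw [ENNReal.ofReal_rpow_of_nonneg (divisorWeight_nonneg _ _ _ _) (by positivity),
    ENNReal.ofReal_rpow_of_nonneg (divisorWeight_nonneg _ _ _ _) (by positivity),
    ← ENNReal.ofReal_mul (Real.rpow_nonneg (divisorWeight_nonneg _ _ _ _) _),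
    ← divisorWeight_rpow_mul_rpow]
  · congr 2
    ext i
    rcases i with α | β
    · exact (hα α).symm
    · simp only [Sum.elim_inr]
      linear_combination b β * hsum
  · rintro (α | β) hi
    · simp only [Sum.elim_inl] at hi ⊢
      have : q α = 0 := by linarith [hα α]
      simp [this]
    · simp only [Sum.elim_inr] at hi ⊢
      have : b β = 0 := by linear_combination b β * (-hsum) - hi
      simp [this]

variable [MeasurableSpace X] [BorelSpace X]

/-- The Sobolev inequality for `p = 1`, applied to `|f| ^ γ` with `γ = p (2n - 1) / (2n - p)`, gives
the one for `p > 1`. -/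
theorem lintegral_rpow_le_of_sobolev_one (hn : 1 ≤ n) {μ : Measure X}
    (h : ∀ i, DivisorHermitianMetric (Sum.elim E B i)) {b : J → ℝ} {q : I → ℝ}
    {p : ℝ} (hp₁ : 1 < p) (hp₂ : p < 2) {ε : ℝ} {g : BilinField n X} {C : ℝ≥0∞}
    (hC : ∀ u : X → ℂ, ContMDiff 𝓘(ℝ, Fin n → ℂ) 𝓘(ℝ, ℂ) 1 u →
      (∫⁻ x, ‖u x‖ₑ ^ (2 * n / (2 * n - 1) : ℝ) * ENNReal.ofReal
          (divisorWeight h (Sum.elim q fun β => -b β) ε x) ∂μ) ^ ((2 * n - 1) / (2 * n) : ℝ) ≤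
        C * (∫⁻ x, g.gradNorm u x * ENNReal.ofReal
            (divisorWeight h (Sum.elim (fun α => 1 / 2 * q α) fun β => -b β) ε x) ∂μ
          + ∫⁻ x, ‖u x‖ₑ * ENNReal.ofReal
            (divisorWeight h (Sum.elim (fun α => 1 / 2 * q α) fun β => -b β) ε x) ∂μ))
    {f : X → ℂ} (hf : ContMDiff 𝓘(ℝ, Fin n → ℂ) 𝓘(ℝ, ℂ) 1 f)
    (hfin : ∫⁻ x, ‖f x‖ₑ ^ (2 * n * p / (2 * n - p)) * ENNReal.ofReal
          (divisorWeight h (Sum.elim q fun β => -b β) ε x) ∂μ ≠ ⊤) :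
    (∫⁻ x, ‖f x‖ₑ ^ (2 * n * p / (2 * n - p)) * ENNReal.ofReal
          (divisorWeight h (Sum.elim q fun β => -b β) ε x) ∂μ) ^ ((2 * n - p) / (2 * n * p)) ≤
      C * (2 * ENNReal.ofReal (p * (2 * n - 1) / (2 * n - p))) *
        (∫⁻ x, g.gradNorm f x ^ p * ENNReal.ofReal
            (divisorWeight h (Sum.elim (fun α => (1 - p / 2) * q α) fun β => -b β) ε x) ∂μ
          + ∫⁻ x, ‖f x‖ₑ ^ p * ENNReal.ofReal
            (divisorWeight h (Sum.elim (fun α => (1 - p / 2) * q α) fun β => -b β) ε x) ∂μ) ^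
          (1 / p) := by
  have hn' : (1 : ℝ) ≤ n := by exact_mod_cast hn
  have hn1 : (0 : ℝ) < 2 * n - 1 := by linarith
  have hnp : (0 : ℝ) < 2 * n - p := by linarith
  have hp0 : 0 < p := by linarith
  have hpp : (p.conjExponent).HolderConjugate p :=
    (Real.HolderConjugate.conjExponent hp₁).symm
  set p' := p.conjExponent with hp'
  have hp'0 : 0 < p' := hpp.pos
  have hp'e : p' = p / (p - 1) := rfl
  have hp10 : 0 < p - 1 := by linarith
  set γ : ℝ := p * (2 * n - 1) / (2 * n - p) with hγ
  have hγ1 : 1 < γ := by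
    rw [hγ, lt_div_iff₀ hnp]
    nlinarith
  set s : ℝ := 2 * n * p / (2 * n - p) with hs
  -- The choice of `γ` makes the two exponents of `|f|`, on the left and in Hölder's inequality, equal.
  have hγs : γ * (2 * n / (2 * n - 1)) = s := by
    rw [hγ, hs]; field_simp
  have hγs' : (γ - 1) * p' = s := by
    rw [hγ, hs, hp'e]
    have h1 : p * (2 * n - 1) / (2 * n - p) - 1 = 2 * n * (p - 1) / (2 * n - p) := by
      rw [div_sub_one hnp.ne']; ring
    rw [h1]
    field_simp
  set w : X → ℝ≥0∞ := fun x => ENNReal.ofReal (divisorWeight h (Sum.elim q fun β => -b β) ε x)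
    with hw
  set w₁ : X → ℝ≥0∞ := fun x => ENNReal.ofReal
    (divisorWeight h (Sum.elim (fun α => 1 / 2 * q α) fun β => -b β) ε x) with hw₁
  set wp : X → ℝ≥0∞ := fun x => ENNReal.ofReal
    (divisorWeight h (Sum.elim (fun α => (1 - p / 2) * q α) fun β => -b β) ε x) with hwp
  have hw₁e : ∀ x, w₁ x = w x ^ (1 / p') * wp x ^ (1 / p) :=
    ofReal_divisorWeight_half_eq h b hpp ε
  have hwm : Measurable w := (measurable_divisorWeight h _ ε).ennreal_ofReal
  have hfm : Measurable fun x => ‖f x‖ₑ := hf.continuous.measurable.enorm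
  set S := ∫⁻ x, ‖f x‖ₑ ^ s * w x ∂μ with hS
  have hholder : ∀ F : X → ℝ≥0∞, ∫⁻ x, ‖f x‖ₑ ^ (γ - 1) * F x * w₁ x ∂μ ≤
      S ^ (1 / p') * (∫⁻ x, F x ^ p * wp x ∂μ) ^ (1 / p) := by
    intro F
    have h1 := lintegral_mul_le_Lp_mul_Lq_of_measurable_left μ hpp
      (a := fun x => ‖f x‖ₑ ^ (γ - 1) * w x ^ (1 / p'))
      ((hfm.pow_const _).mul (hwm.pow_const _))
      (fun x => ENNReal.mul_ne_top
        (ENNReal.rpow_ne_top_of_nonneg (by linarith) enorm_ne_top)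
        (ENNReal.rpow_ne_top_of_nonneg (by positivity) ENNReal.ofReal_ne_top))
      (fun x => F x * wp x ^ (1 / p))
    refine le_of_eq_of_le (lintegral_congr fun x => ?_) (h1.trans_eq ?_)
    · rw [hw₁e]; ring
    · congr 2
      · refine lintegral_congr fun x => ?_
        rw [ENNReal.mul_rpow_of_nonneg _ _ hp'0.le, ← ENNReal.rpow_mul, ← ENNReal.rpow_mul, hγs',
          one_div_mul_cancel hp'0.ne', ENNReal.rpow_one]
      · refine lintegral_congr fun x => ?_
        rw [ENNReal.mul_rpow_of_nonneg _ _ hp0.le, ← ENNReal.rpow_mul,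
          one_div_mul_cancel hp0.ne', ENNReal.rpow_one]
  set u : X → ℂ := fun x => ((‖f x‖ ^ γ : ℝ) : ℂ) with hu
  have huc : ContMDiff 𝓘(ℝ, Fin n → ℂ) 𝓘(ℝ, ℂ) 1 u :=
    (contDiff_ofReal_norm_rpow hγ1).contMDiff.comp hf
  have hune : ∀ x, ‖u x‖ₑ = ‖f x‖ₑ ^ γ := fun x => enorm_ofReal_norm_rpow (by linarith) _
  set Γ := ENNReal.ofReal γ with hΓ
  have hΓ1 : 1 ≤ Γ := by
    rw [hΓ, ← ENNReal.ofReal_one]; exact ENNReal.ofReal_le_ofReal hγ1.le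
  set P := ∫⁻ x, g.gradNorm f x ^ p * wp x ∂μ with hP
  set N := ∫⁻ x, ‖f x‖ₑ ^ p * wp x ∂μ with hN
  have hgrad : ∫⁻ x, g.gradNorm u x * w₁ x ∂μ ≤ Γ * (S ^ (1 / p') * P ^ (1 / p)) := by
    calc ∫⁻ x, g.gradNorm u x * w₁ x ∂μ
        ≤ ∫⁻ x, Γ * (‖f x‖ₑ ^ (γ - 1) * g.gradNorm f x * w₁ x) ∂μ := by
          refine lintegral_mono fun x => ?_
          refine (mul_le_mul_left (gradNorm_norm_rpow_le g
            ((hf x).mdifferentiableAt one_ne_zero) hγ1) _).trans_eq ?_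
          ring
      _ = Γ * ∫⁻ x, ‖f x‖ₑ ^ (γ - 1) * g.gradNorm f x * w₁ x ∂μ :=
          lintegral_const_mul' _ _ ENNReal.ofReal_ne_top
      _ ≤ _ := mul_le_mul_right (hholder _) _
  have hfun : ∫⁻ x, ‖u x‖ₑ * w₁ x ∂μ ≤ Γ * (S ^ (1 / p') * N ^ (1 / p)) := by
    calc ∫⁻ x, ‖u x‖ₑ * w₁ x ∂μ
        = ∫⁻ x, ‖f x‖ₑ ^ (γ - 1) * ‖f x‖ₑ * w₁ x ∂μ := by
          refine lintegral_congr fun x => ?_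
          have : ‖f x‖ₑ ^ γ = ‖f x‖ₑ ^ (γ - 1) * ‖f x‖ₑ := by
            nth_rw 3 [← ENNReal.rpow_one ‖f x‖ₑ]
            rw [← ENNReal.rpow_add_of_nonneg _ _ (by linarith) one_pos.le, sub_add_cancel]
          rw [hune, this]
      _ ≤ 1 * (S ^ (1 / p') * N ^ (1 / p)) := by rw [one_mul]; exact hholder _
      _ ≤ _ := mul_le_mul_left hΓ1 _
  have hmain : S ^ ((2 * n - 1) / (2 * n) : ℝ) ≤
      S ^ (1 / p') * (C * (2 * Γ) * (P + N) ^ (1 / p)) := by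
    have hSu : S = ∫⁻ x, ‖u x‖ₑ ^ (2 * n / (2 * n - 1) : ℝ) * w x ∂μ := by
      refine lintegral_congr fun x => ?_
      rw [hune, ← ENNReal.rpow_mul, hγs]
    calc S ^ ((2 * n - 1) / (2 * n) : ℝ)
        ≤ C * (Γ * (S ^ (1 / p') * P ^ (1 / p)) + Γ * (S ^ (1 / p') * N ^ (1 / p))) := by
          refine le_trans ?_ (mul_le_mul_right (add_le_add hgrad hfun) C)
          have := hC u huc
          rwa [← hSu] at this
      _ = S ^ (1 / p') * (C * Γ * (P ^ (1 / p) + N ^ (1 / p))) := by ring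
      _ ≤ S ^ (1 / p') * (C * Γ * (2 * (P + N) ^ (1 / p))) :=
          mul_le_mul_right (mul_le_mul_right
            (ENNReal.rpow_add_rpow_le_two_mul P N (by positivity)) _) _
      _ = _ := by ring
  have hexp : ((2 * n - 1) / (2 * n) : ℝ) - 1 / p' = (2 * n - p) / (2 * n * p) := by
    rw [hp'e]
    field_simp
    ring
  have hlt : 1 / p' < ((2 * n - 1) / (2 * n) : ℝ) := by
    rw [← sub_pos, hexp]; positivity
  rw [← hexp]
  exact ENNReal.rpow_sub_le_of_rpow_le_rpow_mul hfin hlt hmain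

end Interpolation

end

theorem proposition2p1 {n : ℕ} (hn : 1 ≤ n) {X : Type*} [TopologicalSpace X] [T2Space X]
    [CompactSpace X] [ChartedSpace (Fin n → ℂ) X] [IsManifold 𝓘(ℂ, Fin n → ℂ) ω X]
    [MeasurableSpace X] [BorelSpace X] (κ : KahlerMetric n X)
    {I J : Type*} [Fintype I] [Fintype J]
    (E : I → SmoothPrimeDivisor n X) (B : J → SmoothPrimeDivisor n X)
    (hsnc : IsSNC (Sum.elim E B))
    (b : J → ℝ) (hb : ∀ β, 0 ≤ b β ∧ b β < 1)
    (hE : ∀ α, DivisorHermitianMetric (E α)) (hB : ∀ β, DivisorHermitianMetric (B β))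
    (q : I → ℝ) (hq : ∀ α, 0 ≤ q α)
    (ε₀ : ℝ) (hε₀ : 0 < ε₀)
    (g : ℝ → BilinField n X) (hg : IsRegularizedConicMetric E B b ε₀ g)
    (p : ℝ) (hp₁ : 1 ≤ p) (hp₂ : p < 2) :
    ∃ C : ℝ, 0 < C ∧ ∀ ε : ℝ, 0 ≤ ε → ε ≤ ε₀ →
      ∀ f : X → ℂ, ContMDiff 𝓘(ℝ, Fin n → ℂ) 𝓘(ℝ, ℂ) ∞ f →
        (∫⁻ x, ‖f x‖ₑ ^ (2 * n * p / (2 * n - p)) ∂(weightedMeasure κ hE hB b q ε))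
            ^ ((2 * n - p) / (2 * n * p))
          ≤ ENNReal.ofReal C *
            ((∫⁻ x, (g ε).gradNorm f x ^ p
                ∂(weightedMeasure κ hE hB b (fun α => (1 - p / 2) * q α) ε))
              + ∫⁻ x, ‖f x‖ₑ ^ p
                ∂(weightedMeasure κ hE hB b (fun α => (1 - p / 2) * q α) ε)) ^ (1 / p) := by
  have := isManifold_real n X
  have hn' : (1 : ℝ) ≤ n := by exact_mod_cast hn
  obtain ⟨C, hC, hsob⟩ := exists_lintegral_rpow_le_gradNorm hn κ.isSmoothMetric
    (hermitianSumElim hE hB) hb hq hg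
  suffices H : ∃ K : ℝ≥0∞, K ≠ ⊤ ∧ ∀ ε : ℝ, 0 ≤ ε → ε ≤ ε₀ →
      ∀ f : X → ℂ, ContMDiff 𝓘(ℝ, Fin n → ℂ) 𝓘(ℝ, ℂ) 1 f →
        (∫⁻ x, ‖f x‖ₑ ^ (2 * n * p / (2 * n - p)) ∂(weightedMeasure κ hE hB b q ε))
            ^ ((2 * n - p) / (2 * n * p))
          ≤ K *
            ((∫⁻ x, (g ε).gradNorm f x ^ p
                ∂(weightedMeasure κ hE hB b (fun α => (1 - p / 2) * q α) ε))
              + ∫⁻ x, ‖f x‖ₑ ^ p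
                ∂(weightedMeasure κ hE hB b (fun α => (1 - p / 2) * q α) ε)) ^ (1 / p) by
    obtain ⟨K, hK, hle⟩ := H
    refine ⟨K.toReal + 1, by positivity, fun ε hε hεε₀ f hf => ?_⟩
    refine (hle ε hε hεε₀ f (hf.of_le (by simp))).trans (mul_le_mul_left ?_ _)
    rw [← ENNReal.ofReal_toReal hK]
    exact ENNReal.ofReal_le_ofReal (by simp)
  simp only [lintegral_weightedMeasure]
  rcases hp₁.eq_or_lt with rfl | hp₁
  · refine ⟨C, hC, fun ε hε hεε₀ f hf => ?_⟩
    have := hsob ε hε hεε₀ f hf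
    norm_num at this ⊢
    exact this
  · refine ⟨_, ?_, fun ε hε hεε₀ f hf => lintegral_rpow_le_of_sobolev_one hn
      (hermitianSumElim hE hB) hp₁ hp₂ (hsob ε hε hεε₀) hf ?_⟩
    · exact ENNReal.mul_ne_top hC (by finiteness)
    · have hfin := lintegral_divisorWeight_lt_top κ.isSmoothMetric hsnc
        (hermitianSumElim hE hB) (fun β => (hb β).2) hq hε
      -- `f` is bounded and the measure is finite.
      obtain ⟨M, hM⟩ := isCompact_univ.exists_bound_of_continuousOn hf.continuous.continuousOn
      have hs : 0 ≤ 2 * n * p / (2 * n - p) := by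
        have : (0 : ℝ) < 2 * n - p := by linarith
        positivity
      refine ne_top_of_le_ne_top ?_ (lintegral_mono fun x => mul_le_mul_left
        (ENNReal.rpow_le_rpow ((ofReal_norm (f x)).symm.le.trans
          (ENNReal.ofReal_le_ofReal (hM x (mem_univ x)))) hs) _)
      rw [lintegral_const_mul' _ _ (by finiteness)]
      exact ENNReal.mul_ne_top (by finiteness) hfin.ne
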